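/- Let $(M,g)$ be a connected, oriented, smooth Riemannian 4-manifold with Levi-Civita connection $\nabla$ and Hodge star $*$. A Killing--Yano (KY) 2-form is a smooth 2-form $Y$ with $\nabla_{(a}Y_{b)c}=0$; it is non-constant if $\nabla Y$ is not identically zero. A conformal Kähler structure on an open set $U\subseteq M$ is a pair $(\Omega,J)$ of a smooth nowhere zero function $\Omega$ and a smooth almost complex structure $J$ on $U$ such that $J$ is compatible with $g$ and integrable (its Nijenhuis tensor vanishes) and the fundamental 2-form $\hat\kappa=\Omega^2\kappa$ of $(\Omega^2 g,J)$ is closed, where $\kappa_{ab}=g_{bc}J^c{}_a$; it is positively (negatively) oriented if $*\kappa=\kappa$ ($*\kappa=-\kappa$). Put $Z=\Omega^{-1}\kappa=\Omega^{-3}\hat\kappa$; the Hamiltonian vector field of $(\Omega,J)$ is $t_c=-\frac13\nabla^aZ_{ac}$. A conformal Kähler structure on $M$ with possible poles of the conformal factor is a conformal Kähler structure $(\Omega,J)$ on a dense open set $U\subseteq M$ for which $Z$ extends to a smooth 2-form on $M$ that vanishes on $M\setminus U$ (the set of poles of $\Omega$); its Hamiltonian vector field is then defined on all of $M$ by the same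 formula. (i) $(M,g)$ admits a non-constant KY 2-form if and only if it admits a positively oriented and a negatively oriented conformal Kähler structure, with possible poles of the conformal factors, whose Hamiltonian vector fields coincide and are not identically zero. (ii) $(M,g)$ admits a non-constant KY 2-form whose self-dual and anti-self-dual parts both vanish nowhere if and only if it admits a positively oriented and a negatively oriented conformal Kähler structure on all of $M$ (without poles) whose Hamiltonian vector fields coincide and are not identically zero. -/

import Mathlib

open scoped Manifold ContDiff Topology

noncomputable section

namespace KillingYano

/-- The model space `ℝ⁴`. -/
abbrev E4 : Type := EuclideanSpace ℝ (Fin 4)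

section Tensors

variable (M : Type*) [TopologicalSpace M] [ChartedSpace E4 M]

/-- Fields of bilinear forms on the tangent spaces (covariant tensor fields of valence two). -/
abbrev BilinField : Type _ :=
  ∀ p : M, TangentSpace (𝓡 4) p →L[ℝ] TangentSpace (𝓡 4) p →L[ℝ] ℝ

/-- Fields of endomorphisms of the tangent spaces. -/
abbrev EndField : Type _ :=
  ∀ p : M, TangentSpace (𝓡 4) p →L[ℝ] TangentSpace (𝓡 4) p

variable [IsManifold (𝓡 4) ∞ M]

/-- A smooth Riemannian metric on the 4-manifold `M`. -/
abbrev Metric : Type _ :=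
  Bundle.ContMDiffRiemannianMetric (𝓡 4) ∞ E4 (fun p : M => TangentSpace (𝓡 4) p)

/-- An orientation of `M`: an orientation of every tangent space, locally constant when read in
the local trivializations of the tangent bundle that come from charts. -/
structure ManifoldOrientation where
  /-- The orientation of the tangent space at a point. -/
  orient : ∀ p : M, Orientation ℝ (TangentSpace (𝓡 4) p) (Fin 4)
  locally_constant : ∀ p : M, ∃ c : Orientation ℝ E4 (Fin 4), ∀ᶠ q in 𝓝 p,
    ∀ hq : q ∈ (trivializationAt E4 (fun x : M => TangentSpace (𝓡 4) x) p).baseSet,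
      Orientation.map (Fin 4)
        ((trivializationAt E4 (fun x : M => TangentSpace (𝓡 4) x) p).continuousLinearEquivAt
          ℝ q hq).toLinearEquiv (orient q) = c

end Tensors

variable {M : Type*} [TopologicalSpace M] [ChartedSpace E4 M] [IsManifold (𝓡 4) ∞ M]

/-! ### Smoothness and calculus in the preferred chart

The tangent space at `p` is, by definition, `ℝ⁴`, through the differential at `p` of the preferred
chart at `p`. So the components at `p` of a tensor, with respect to this chart, are
its values on vectors of the tangent space at `p`. -/

/-- Smoothness of a field of bilinear forms. -/
def SmoothBilin (T : BilinField M) : Prop :=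
  ContMDiff (𝓡 4) ((𝓡 4).prod 𝓘(ℝ, E4 →L[ℝ] E4 →L[ℝ] ℝ)) ∞
    (fun p => Bundle.TotalSpace.mk' (E4 →L[ℝ] E4 →L[ℝ] ℝ)
      (E := fun x : M => TangentSpace (𝓡 4) x →L[ℝ] TangentSpace (𝓡 4) x →L[ℝ] ℝ) p (T p))

/-- Smoothness on `U` of a field of endomorphisms. -/
def SmoothEndOn (J : EndField M) (U : Set M) : Prop :=
  ContMDiffOn (𝓡 4) ((𝓡 4).prod 𝓘(ℝ, E4 →L[ℝ] E4)) ∞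
    (fun p => Bundle.TotalSpace.mk' (E4 →L[ℝ] E4)
      (E := fun x : M => TangentSpace (𝓡 4) x →L[ℝ] TangentSpace (𝓡 4) x) p (J p)) U

/-- At `q`, the map `ℝ⁴ → T_q M`, `v ↦ ∑ vⁱ ∂ᵢ`, where the `∂ᵢ` are the coordinate vector fields of
the preferred chart at `p`. -/
def coordVec (p q : M) : E4 →L[ℝ] TangentSpace (𝓡 4) q :=
  (trivializationAt E4 (fun x : M => TangentSpace (𝓡 4) x) p).symmL ℝ q

/-- The components of a field of bilinear forms in the preferred chart at `p`, as a function of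
the coordinates. -/
def localBilin (T : BilinField M) (p : M) (y : E4) : E4 →L[ℝ] E4 →L[ℝ] ℝ :=
  ((coordVec p ((extChartAt (𝓡 4) p).symm y)).precomp ℝ).comp
    ((T ((extChartAt (𝓡 4) p).symm y)).comp (coordVec p ((extChartAt (𝓡 4) p).symm y)))

/-- The components of a field of endomorphisms in the preferred chart at `p`, as a function of
the coordinates. -/
def localEnd (J : EndField M) (p : M) (y : E4) : E4 →L[ℝ] E4 :=
  ContinuousLinearMap.inCoordinates E4 (fun x : M => TangentSpace (𝓡 4) x)
    E4 (fun x : M => TangentSpace (𝓡 4) x)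
    p ((extChartAt (𝓡 4) p).symm y) p ((extChartAt (𝓡 4) p).symm y)
    (J ((extChartAt (𝓡 4) p).symm y))

/-- Partial derivatives `aⁱ bʲ cᵏ ∂ᵢ T_{jk}` at `p` in the preferred chart at `p`. -/
def partialBilin (T : BilinField M) (p : M) (a b c : TangentSpace (𝓡 4) p) : ℝ :=
  fderiv ℝ (localBilin T p) (extChartAt (𝓡 4) p p) a b c

/-- Partial derivatives `aⁱ bʲ ∂ᵢ Jᵏⱼ` at `p` in the preferred chart at `p`. -/
def partialEnd (J : EndField M) (p : M) (a b : TangentSpace (𝓡 4) p) : TangentSpace (𝓡 4) p :=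
  fderiv ℝ (localEnd J p) (extChartAt (𝓡 4) p p) a b

/-- The coordinate basis of the tangent space at `p` given by the preferred chart at `p`. -/
def coordBasis (p : M) : Fin 4 → TangentSpace (𝓡 4) p :=
  fun i => (EuclideanSpace.single i (1 : ℝ) : E4)

/-- The inverse metric `gⁱʲ` at `p` in the preferred chart at `p`. -/
def invMetric (g : Metric M) (p : M) : Matrix (Fin 4) (Fin 4) ℝ :=
  (Matrix.of fun i j => g.inner p (coordBasis p i) (coordBasis p j))⁻¹

/-- Christoffel symbols of the first kind:
`½ (∂_a g_{bc} + ∂_b g_{ac} - ∂_c g_{ab})`. -/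
def christoffelLower (g : Metric M) (p : M) (a b c : TangentSpace (𝓡 4) p) : ℝ :=
  (partialBilin g.inner p a b c + partialBilin g.inner p b a c - partialBilin g.inner p c a b) / 2

/-- Christoffel symbols of the Levi-Civita connection, `Γᵏ_{ab} = gᵏˡ Γ_{l,ab}`, as a vector. -/
def christoffel (g : Metric M) (p : M) (a b : TangentSpace (𝓡 4) p) : TangentSpace (𝓡 4) p :=
  ∑ k, ∑ l, (invMetric g p k l * christoffelLower g p a b (coordBasis p l)) • coordBasis p k

/-- The Levi-Civita covariant derivative `(∇_a T)(b, c)` of a field of bilinear forms. -/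
def covDeriv (g : Metric M) (T : BilinField M) (p : M) (a b c : TangentSpace (𝓡 4) p) : ℝ :=
  partialBilin T p a b c - T p (christoffel g p a b) c - T p b (christoffel g p a c)

/-- The exterior derivative `(dF)(a, b, c)` of a 2-form. -/
def extDeriv2 (F : BilinField M) (p : M) (a b c : TangentSpace (𝓡 4) p) : ℝ :=
  partialBilin F p a b c + partialBilin F p b c a + partialBilin F p c a b

/-- The Nijenhuis tensor
`N(a, b) = [Ja, Jb] - J[Ja, b] - J[a, Jb] - [a, b]` of an almost complex structure, where
`a`, `b` are extended to vector fields with constant components. -/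
def nijenhuis (J : EndField M) (p : M) (a b : TangentSpace (𝓡 4) p) : TangentSpace (𝓡 4) p :=
  partialEnd J p (J p a) b - partialEnd J p (J p b) a
    + J p (partialEnd J p b a) - J p (partialEnd J p a b)

/-! ### 2-forms and duality -/

/-- Smooth 2-forms. -/
structure IsTwoForm (F : BilinField M) : Prop where
  alternating : ∀ (p : M) (v : TangentSpace (𝓡 4) p), F p v v = 0
  smooth : SmoothBilin F

/-- The value `F` at `p` of a 2-form satisfies `*F = s F`, where `*` is the Hodge star: in
every oriented orthonormal frame, `F₀₁ = s F₂₃`, `F₀₂ = s F₃₁`, `F₀₃ = s F₁₂`.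
It is self-dual for `s = 1` and anti-self-dual for `s = -1`. -/
def HodgeDual (g : Metric M) (o : ManifoldOrientation M) (s : ℝ) (p : M)
    (F : TangentSpace (𝓡 4) p →L[ℝ] TangentSpace (𝓡 4) p →L[ℝ] ℝ) : Prop :=
  ∀ e : Module.Basis (Fin 4) ℝ (TangentSpace (𝓡 4) p),
    (∀ i j, g.inner p (e i) (e j) = if i = j then 1 else 0) →
    e.orientation = o.orient p →
      F (e 0) (e 1) = s * F (e 2) (e 3) ∧
      F (e 0) (e 2) = s * F (e 3) (e 1) ∧
      F (e 0) (e 3) = s * F (e 1) (e 2)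

/-- Killing–Yano 2-forms: `∇_{(a} Y_{b)c} = 0`. -/
structure IsKillingYano (g : Metric M) (Y : BilinField M) : Prop where
  isTwoForm : IsTwoForm Y
  killingYano : ∀ (p : M) (a b c : TangentSpace (𝓡 4) p),
    covDeriv g Y p a b c + covDeriv g Y p b a c = 0

/-- A tensor field is constant when `∇T = 0` on all of `M`. -/
def IsParallel (g : Metric M) (T : BilinField M) : Prop :=
  ∀ (p : M) (a b c : TangentSpace (𝓡 4) p), covDeriv g T p a b c = 0

/-! ### Kähler and conformally Kähler structures -/

/-- The fundamental 2-form `κ(a, b) = h(Ja, b)` of a metric tensor `h` and an almost complex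
structure `J`. -/
def fundamentalForm (h : BilinField M) (J : EndField M) : BilinField M :=
  fun p => (h p).comp (J p)

/-- `(h, J)` is Kähler on the open set `U`: `J` is a smooth almost complex structure compatible
with the metric `h`, it is integrable, and its fundamental 2-form is closed. -/
structure IsKahlerOn (h : BilinField M) (J : EndField M) (U : Set M) : Prop where
  smooth : SmoothEndOn J U
  sq : ∀ p ∈ U, ∀ v : TangentSpace (𝓡 4) p, J p (J p v) = -v
  compatible : ∀ p ∈ U, ∀ v w : TangentSpace (𝓡 4) p, h p (J p v) (J p w) = h p v w
  integrable : ∀ p ∈ U, ∀ v w : TangentSpace (𝓡 4) p, nijenhuis J p v w = 0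
  closed : ∀ p ∈ U, ∀ u v w : TangentSpace (𝓡 4) p,
    extDeriv2 (fundamentalForm h J) p u v w = 0

/-- The conformally rescaled metric tensor `Ω² g`. -/
def conformalMetric (g : Metric M) (Ω : M → ℝ) : BilinField M :=
  fun p => (Ω p ^ 2) • g.inner p

/-- `(Ω, J)` is a conformal Kähler structure for `g` on the open set `U`: `Ω` is smooth and nowhere
zero, `(Ω² g, J)` is Kähler, and the fundamental 2-form is self-dual (`s = 1`) or
anti-self-dual (`s = -1`). -/
structure IsConformallyKahlerOn (g : Metric M) (o : ManifoldOrientation M) (s : ℝ)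
    (U : Set M) (Ω : M → ℝ) (J : EndField M) : Prop where
  smooth : ContMDiffOn (𝓡 4) 𝓘(ℝ) ∞ Ω U
  ne_zero : ∀ p ∈ U, Ω p ≠ 0
  kahler : IsKahlerOn (conformalMetric g Ω) J U
  oriented : ∀ p ∈ U, HodgeDual g o s p (fundamentalForm g.inner J p)

/-- The 2-form `Z = Ω⁻¹ κ = Ω⁻³ κ̂` of a conformal Kähler structure, with `κ`, `κ̂` the fundamental
2-forms of `g` and of `Ω² g`. In spinors it is the Killing spinor `K_{A'B'} ε_{AB}`
(or `σ_{AB} ε_{A'B'}`). -/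
def killingForm (g : Metric M) (Ω : M → ℝ) (J : EndField M) : BilinField M :=
  fun p => (Ω p)⁻¹ • fundamentalForm g.inner J p

/-- The vector field `t_c = -⅓ ∇ᵃ Z_{ac}` (with its index lowered by `g`); for `Z` the 2-form
`killingForm g Ω J` this is the Hamiltonian vector field of the conformal Kähler structure. -/
def hamiltonian (g : Metric M) (Z : BilinField M) (p : M) (c : TangentSpace (𝓡 4) p) : ℝ :=
  -(1 / 3) * ∑ i, ∑ j, invMetric g p i j * covDeriv g Z p (coordBasis p i) (coordBasis p j) c

/-- A conformal Kähler structure whose conformal factor may have poles: `(Ω, J)` is a conformal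
Kähler structure on the dense open set `U`, and the 2-form `Ω⁻¹ κ` of it extends to a smooth
2-form `Z` on `M` that vanishes on the complement of `U` (the set of poles of `Ω`). -/
structure IsConformallyKahlerWithPoles (g : Metric M) (o : ManifoldOrientation M) (s : ℝ)
    (U : Set M) (Ω : M → ℝ) (J : EndField M) (Z : BilinField M) : Prop where
  isOpen : IsOpen U
  dense : Dense U
  conformallyKahler : IsConformallyKahlerOn g o s U Ω J
  isTwoForm : IsTwoForm Z
  eq_on : ∀ p ∈ U, Z p = killingForm g Ω J p
  eq_zero : ∀ p ∉ U, Z p = 0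

end KillingYano

end

/-! The proof passes through the twistor (conformal Killing–Yano) equation for 2-forms `Z` with `*Z
= sZ`: the symmetrization of `∇Z` in its first two slots is pure trace, `2 g_ab τ_c - g_ac τ_b -
g_bc τ_a`. Tracing gives `∇ᵃZ_ac = 3 τ_c`, so `τ` is minus the Hamiltonian field.

Twistor forms and conformal Kähler structures correspond. A nonzero 2-form of duality `s` in
dimension four is a multiple of an orthogonal complex structure: if `K` is `Z` with an index raised,
then `K² = -r` with `r > 0` (`IsInner.sharp_sharp`), and `Ω = r^(-1/2)`, `J = ΩK` give `Z = Ω⁻¹κ`.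
Conversely every pair `(Ω, J)` gives such a form. In a frame adapted to `J`, `∇J` has eight free
components. Vanishing of the Nijenhuis tensor together with closedness of `Ω²κ` amounts to eight
equations expressing them through `d log Ω`, and the twistor equation of `Ω⁻¹κ` amounts to the same
eight (`IsHermitianJet.relations_iff`, `IsHermitianJet.twistor_iff`, transported to the manifold in
`IsConformalHermitianOn.twistor_iff`).

From a Killing–Yano form `Y` to the pair: let `Z₁` be the self-dual part of `Y` and `Z₂ = Z₁ - Y`.
The Levi-Civita connection preserves duality (`chcov_dualIn`), so `∇Z₁` is the self-dual part of
`∇Y`, which is a 3-form; hence `Z₁` is a twistor form with `τ` half the Hodge dual of that 3-form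
(`dualPart_twistor`). As `∇Y` is totally skew, subtracting `Y` changes neither the symmetrization
nor the divergence, so `Z₂` is a twistor form with the same `τ`. Finally `τ = 0` everywhere would
force `∇Y = 0`.

From the pair to `Y`: in `Z₁ - Z₂` the trace terms cancel, so the Killing–Yano equation holds where
both structures live, a dense set, and everywhere by continuity. If `Z₁ - Z₂` were parallel, `∇Z₁ =
∇Z₂` would be both self-dual and anti-self-dual, hence zero, and the Hamiltonian field would vanish.

With poles it remains to see that a twistor form with nonzero divergence is nonzero on a dense set.
Differentiating the equation closes it up into a linear system for `z`, `τ`, the skew part `T` and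
`∂τ` (`IsTwistorSystem.span_pd_second`). Grönwall's inequality along segments then gives local
unique continuation, so the interior of the zero set is clopen, and connectedness finishes
(`IsTwistorForm.dense`). Without poles, `Z₁` or `Z₂` vanishes at a point exactly when `Y` is
anti-self-dual or self-dual there. -/

noncomputable section

open scoped Matrix

namespace KillingYano

set_option linter.unusedSectionVars false

variable {M : Type*} [TopologicalSpace M] [ChartedSpace E4 M] [IsManifold (𝓡 4) ∞ M]

/-! ### Levi-Civita calculus on open subsets of `ℝ⁴` -/

/-- Bilinear forms on `ℝ⁴`. -/
abbrev Bil : Type := E4 →L[ℝ] E4 →L[ℝ] ℝ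

/-- Symmetric positive definite bilinear forms. -/
structure IsInner (B : Bil) : Prop where
  symm : ∀ a b, B a b = B b a
  pos : ∀ a, a ≠ 0 → 0 < B a a

theorem IsInner.ext {B : Bil} (hB : IsInner B) {u v : E4} (h : ∀ c, B u c = B v c) : u = v := by
  by_contra hne
  have := hB.pos (u - v) (sub_ne_zero.2 hne)
  simp [h] at this

/-- The musical isomorphism. It makes `B.inverse` raise indices without a basis, and inversion of
continuous linear maps is smooth. -/
theorem IsInner.isInvertible {B : Bil} (hB : IsInner B) : B.IsInvertible := by
  have hinj : Function.Injective (B : E4 →ₗ[ℝ] (E4 →L[ℝ] ℝ)) := fun u v h =>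
    hB.ext fun c => by
      have := congrArg (fun f : E4 →L[ℝ] ℝ => f c) h
      simpa using this
  have hd : Module.finrank ℝ E4 = Module.finrank ℝ (E4 →L[ℝ] ℝ) := by
    rw [← LinearEquiv.finrank_eq (LinearMap.toContinuousLinearMap (𝕜 := ℝ) (E := E4) (F' := ℝ))]
    exact (Subspace.dual_finrank_eq (K := ℝ) (V := E4)).symm
  refine ⟨(LinearEquiv.ofInjectiveOfFinrankEq (B : E4 →ₗ[ℝ] (E4 →L[ℝ] ℝ)) hinj
    hd).toContinuousLinearEquiv, ?_⟩
  ext u v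
  rfl

theorem IsInner.apply_inverse {B : Bil} (hB : IsInner B) (f : E4 →L[ℝ] ℝ) :
    B (B.inverse f) = f := by
  have := hB.isInvertible.self_comp_inverse
  exact congrArg (fun L : (E4 →L[ℝ] ℝ) →L[ℝ] (E4 →L[ℝ] ℝ) => L f) this

/-- Christoffel symbols of the first kind, on an open subset of `ℝ⁴`. -/
def chrLower (G : E4 → Bil) (y a b : E4) : E4 →L[ℝ] ℝ :=
  (1 / 2 : ℝ) • (fderiv ℝ G y a b + fderiv ℝ G y b a - ((fderiv ℝ G y).flip a).flip b)

theorem chrLower_apply (G : E4 → Bil) (y a b c : E4) : chrLower G y a b c =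
    (fderiv ℝ G y a b c + fderiv ℝ G y b a c - fderiv ℝ G y c a b) / 2 := by
  simp [chrLower]; ring

/-- Christoffel symbols of the second kind, on an open subset of `ℝ⁴`. -/
def chr (G : E4 → Bil) (y a b : E4) : E4 := (G y).inverse (chrLower G y a b)

theorem chr_spec {G : E4 → Bil} {y : E4} (h : IsInner (G y)) (a b c : E4) :
    G y (chr G y a b) c = chrLower G y a b c := by
  rw [chr, h.apply_inverse]

/-- The covariant derivative `(∇_a T)(b, c)` on an open subset of `ℝ⁴`. -/
def chcov (G T : E4 → Bil) (y a b c : E4) : ℝ :=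
  fderiv ℝ T y a b c - T y (chr G y a b) c - T y b (chr G y a c)

/-- The factor `s` serves metrics (`s = 1`) and 2-forms (`s = -1`) alike. -/
theorem fderiv_symm_of_eventually {T : E4 → Bil} {y : E4} {s : ℝ} (hT : DifferentiableAt ℝ T y)
    (h : ∀ᶠ z in 𝓝 y, ∀ a b, T z a b = s * T z b a) (v a b : E4) :
    fderiv ℝ T y v a b = s * fderiv ℝ T y v b a := by
  have h1 : ∀ a b, HasFDerivAt (fun z => T z a b) (((fderiv ℝ T y).flip a).flip b) y := fun a b =>
    ((hT.hasFDerivAt.clm_apply (hasFDerivAt_const a y)).clm_apply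
      (hasFDerivAt_const b y)).congr_fderiv (by ext; simp)
  have h2 := (h1 b a).const_mul s
  have h3 := (h2.congr_of_eventuallyEq (h.mono fun z hz => hz a b)).unique (h1 a b)
  have := congrArg (fun L : E4 →L[ℝ] ℝ => L v) h3
  simpa using this.symm

theorem chr_symm {G : E4 → Bil} {y : E4} (hG : DifferentiableAt ℝ G y)
    (hs : ∀ᶠ z in 𝓝 y, ∀ a b, G z a b = G z b a) (a b : E4) : chr G y a b = chr G y b a := by
  unfold chr
  congr 1
  ext c
  rw [chrLower_apply, chrLower_apply,
    fderiv_symm_of_eventually (s := 1) hG (by simpa using hs) c a b]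
  ring

/-- The Levi-Civita connection is metric. -/
theorem fderiv_metric {G : E4 → Bil} {y : E4} (hG : DifferentiableAt ℝ G y)
    (hs : ∀ᶠ z in 𝓝 y, IsInner (G z)) (a b c : E4) :
    fderiv ℝ G y a b c = G y (chr G y a b) c + G y b (chr G y a c) := by
  have hi := hs.self_of_nhds
  rw [hi.symm b, chr_spec hi, chr_spec hi, chrLower_apply, chrLower_apply]
  have h := fderiv_symm_of_eventually (s := 1) hG (by
    filter_upwards [hs] with z hz a b
    rw [hz.symm a b, one_mul])
  rw [h a c b, h b a c, h c a b]
  ring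

/-- Naturality of the Levi-Civita covariant derivative. -/
theorem chcov_pullback {G T G' T' : E4 → Bil} {ψ : E4 → E4} {x : E4} (hψ : ContDiffAt ℝ 2 ψ x)
    (hG : DifferentiableAt ℝ G (ψ x)) (hT : DifferentiableAt ℝ T (ψ x))
    (hG0 : DifferentiableAt ℝ G' x) (hT0 : DifferentiableAt ℝ T' x)
    (hGG : ∀ᶠ z in 𝓝 x, ∀ a b, G' z a b = G (ψ z) (fderiv ℝ ψ z a) (fderiv ℝ ψ z b))
    (hTT : ∀ᶠ z in 𝓝 x, ∀ a b, T' z a b = T (ψ z) (fderiv ℝ ψ z a) (fderiv ℝ ψ z b))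
    (hi : IsInner (G (ψ x))) (hi' : IsInner (G' x))
    (hA : Function.Surjective (fderiv ℝ ψ x)) (a b c : E4) :
    chcov G' T' x a b c =
      chcov G T (ψ x) (fderiv ℝ ψ x a) (fderiv ℝ ψ x b) (fderiv ℝ ψ x c) := by
  have hψ1 : DifferentiableAt ℝ ψ x := hψ.differentiableAt (by norm_num)
  have hψ2 : DifferentiableAt ℝ (fderiv ℝ ψ) x :=
    (hψ.fderiv_right (m := 1) (by norm_num)).differentiableAt (by norm_num)
  -- Chain rule for a pulled back form; the last two terms carry the Hessian of `ψ`.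
  have key : ∀ {S S' : E4 → Bil}, DifferentiableAt ℝ S (ψ x) → DifferentiableAt ℝ S' x →
      (∀ᶠ z in 𝓝 x, ∀ a b, S' z a b = S (ψ z) (fderiv ℝ ψ z a) (fderiv ℝ ψ z b)) →
      ∀ v a b, fderiv ℝ S' x v a b =
        fderiv ℝ S (ψ x) (fderiv ℝ ψ x v) (fderiv ℝ ψ x a) (fderiv ℝ ψ x b)
        + S (ψ x) (fderiv ℝ (fderiv ℝ ψ) x v a) (fderiv ℝ ψ x b)
        + S (ψ x) (fderiv ℝ ψ x a) (fderiv ℝ (fderiv ℝ ψ) x v b) := by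
    intro S S' hS hS' hSS v a b
    have e1 : HasFDerivAt (fun z => S' z a b) (((fderiv ℝ S' x).flip a).flip b) x :=
      ((hS'.hasFDerivAt.clm_apply (hasFDerivAt_const a x)).clm_apply
        (hasFDerivAt_const b x)).congr_fderiv (by ext; simp)
    have e0 : HasFDerivAt (fun z => S (ψ z)) ((fderiv ℝ S (ψ x)).comp (fderiv ℝ ψ x)) x :=
      HasFDerivAt.comp (f := ψ) (g := S) x hS.hasFDerivAt hψ1.hasFDerivAt
    have e2 := (e0.clm_apply
      (hψ2.hasFDerivAt.clm_apply (hasFDerivAt_const a x))).clm_apply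
      (hψ2.hasFDerivAt.clm_apply (hasFDerivAt_const b x))
    have e3 := (e2.congr_of_eventuallyEq (hSS.mono fun z hz => hz a b)).unique e1
    have := congrArg (fun L : E4 →L[ℝ] ℝ => L v) e3
    simp at this
    linarith
  have hsymm : ∀ u v, fderiv ℝ (fderiv ℝ ψ) x u v = fderiv ℝ (fderiv ℝ ψ) x v u := fun u v =>
    (hψ.isSymmSndFDerivAt (by simp)) u v
  -- Transformation law of the Christoffel symbols: their inhomogeneous Hessian term is what cancels
  -- the Hessian terms of `key`. Surjectivity of the differential allows testing on pushed forward
  -- vectors only.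
  have hchr : ∀ a b, fderiv ℝ ψ x (chr G' x a b) =
      chr G (ψ x) (fderiv ℝ ψ x a) (fderiv ℝ ψ x b) + fderiv ℝ (fderiv ℝ ψ) x a b := by
    intro a b
    refine hi.ext fun c => ?_
    obtain ⟨c, rfl⟩ := hA c
    have k1 := key hG hG0 hGG a b c
    have k2 := key hG hG0 hGG b a c
    have k3 := key hG hG0 hGG c a b
    have e := chr_spec hi' a b c
    rw [hGG.self_of_nhds, chrLower_apply, k1, k2, k3, hsymm b a, hsymm c a, hsymm c b] at e
    rw [e, map_add, add_apply, chr_spec hi, chrLower_apply,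
      hi.symm (fderiv ℝ ψ x b), hi.symm (fderiv ℝ ψ x a) (fderiv ℝ (fderiv ℝ ψ) x b c)]
    ring
  rw [chcov, chcov, key hT hT0 hTT, hTT.self_of_nhds, hTT.self_of_nhds, hchr, hchr]
  simp
  ring

/-! ### Tensors in charts -/

/-- The value of a field of bilinear forms at a point, as a bilinear form on `ℝ⁴`. -/
def bilinAt (T : BilinField M) (p : M) : Bil := T p

/-- The value of a field of endomorphisms at a point, as an endomorphism of `ℝ⁴`. -/
def endAt (J : EndField M) (p : M) : E4 →L[ℝ] E4 := J p

/-- `coordVec p q` as an endomorphism of `ℝ⁴`. -/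
def coordMap (p q : M) : E4 →L[ℝ] E4 := coordVec p q

theorem coordMap_eq {p q : M} (hq : q ∈ (chartAt E4 p).source) :
    coordMap p q = tangentCoordChange (𝓡 4) p q q :=
  TangentBundle.symmL_trivializationAt_eq_core hq

/-- At the centre of a preferred chart no change of coordinates is left, so tensors at `p` agree
literally with their components there. -/
theorem coordMap_self (p : M) : coordMap p p = ContinuousLinearMap.id ℝ E4 := by
  rw [coordMap_eq (mem_chart_source _ p)]
  ext1 v
  exact tangentCoordChange_self (mem_extChartAt_source p)

theorem coordMap_comp {p q r : M} (hp : r ∈ (chartAt E4 p).source) (hq : r ∈ (chartAt E4 q).source)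
    (v : E4) : coordMap p r (tangentCoordChange (𝓡 4) q p r v) = coordMap q r v := by
  rw [coordMap_eq hp, coordMap_eq hq]
  refine tangentCoordChange_comp (I := 𝓡 4) (w := q) (x := p) (y := r) (z := r) (v := v)
    ⟨⟨?_, ?_⟩, ?_⟩
  · simpa using hq
  · simpa using hp
  · exact mem_extChartAt_source r

theorem coordMap_surjective {p q : M} (hq : q ∈ (chartAt E4 p).source) :
    Function.Surjective (coordMap p q) := fun v =>
  ⟨tangentCoordChange (𝓡 4) q p q v, by
    rw [coordMap_comp hq (mem_chart_source _ q), coordMap_self]; rfl⟩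

theorem coordMap_injective {p q : M} (hq : q ∈ (chartAt E4 p).source) :
    Function.Injective (coordMap p q) := by
  have := (LinearMap.injective_iff_surjective (f := (coordMap p q).toLinearMap)).2 (coordMap_surjective hq)
  exact this

/-- The transition map between the preferred charts at `q` and `p`. -/
def transition (q p : M) : E4 → E4 := extChartAt (𝓡 4) p ∘ (extChartAt (𝓡 4) q).symm

theorem contDiffAt_transition {p q r : M} (hp : r ∈ (chartAt E4 p).source)
    (hq : r ∈ (chartAt E4 q).source) :
    ContDiffAt ℝ ∞ (transition q p) (extChartAt (𝓡 4) q r) := by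
  have h := contDiffWithinAt_ext_coord_change (I := 𝓡 4) (n := ∞) p q
    (y := extChartAt (𝓡 4) q r) (by
      rw [PartialEquiv.trans_source, PartialEquiv.symm_source]
      have hq' : r ∈ (extChartAt (𝓡 4) q).source := by simpa using hq
      refine ⟨(extChartAt (𝓡 4) q).map_source hq', ?_⟩
      rw [Set.mem_preimage, (extChartAt (𝓡 4) q).left_inv hq']
      simpa using hp)
  simpa [transition, contDiffWithinAt_univ] using h

theorem fderiv_transition {p q r : M} (hp : r ∈ (chartAt E4 p).source)
    (hq : r ∈ (chartAt E4 q).source) :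
    fderiv ℝ (transition q p) (extChartAt (𝓡 4) q r) = tangentCoordChange (𝓡 4) q p r := by
  have h := hasFDerivWithinAt_tangentCoordChange (I := 𝓡 4) (x := q) (y := p) (z := r)
    ⟨by simpa using hq, by simpa using hp⟩
  rw [ModelWithCorners.range_eq_univ, hasFDerivWithinAt_univ] at h
  exact h.fderiv

theorem extChartAt_symm_mem {p : M} {y : E4} (hy : y ∈ (extChartAt (𝓡 4) p).target) :
    (extChartAt (𝓡 4) p).symm y ∈ (chartAt E4 p).source := by
  simpa using (extChartAt (𝓡 4) p).map_target hy

theorem extChartAt_target_mem_nhds' {p : M} {y : E4} (hy : y ∈ (extChartAt (𝓡 4) p).target) :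
    (extChartAt (𝓡 4) p).target ∈ 𝓝 y := (isOpen_extChartAt_target p).mem_nhds hy

theorem localBilin_apply (T : BilinField M) (p : M) (y a b : E4) :
    localBilin T p y a b = bilinAt T ((extChartAt (𝓡 4) p).symm y)
      (coordMap p ((extChartAt (𝓡 4) p).symm y) a) (coordMap p ((extChartAt (𝓡 4) p).symm y) b) :=
  rfl

theorem localBilin_apply' (T : BilinField M) {p q : M} (hq : q ∈ (chartAt E4 p).source)
    (a b : E4) :
    localBilin T p (extChartAt (𝓡 4) p q) a b = bilinAt T q (coordMap p q a) (coordMap p q b) := by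
  rw [localBilin_apply, (extChartAt (𝓡 4) p).left_inv (by simpa using hq)]

theorem localBilin_self (T : BilinField M) (p : M) :
    localBilin T p (extChartAt (𝓡 4) p p) = bilinAt T p := by
  ext a b
  rw [localBilin_apply' T (mem_chart_source _ p), coordMap_self]
  rfl

/-- Components in two charts are pullbacks of each other by the transition map, which is the input
needed for `chcov_pullback`. -/
theorem localBilin_change (T : BilinField M) {p q r : M} (hp : r ∈ (chartAt E4 p).source)
    (hq : r ∈ (chartAt E4 q).source) (a b : E4) :
    localBilin T q (extChartAt (𝓡 4) q r) a b =
      localBilin T p (transition q p (extChartAt (𝓡 4) q r))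
        (fderiv ℝ (transition q p) (extChartAt (𝓡 4) q r) a)
        (fderiv ℝ (transition q p) (extChartAt (𝓡 4) q r) b) := by
  have : transition q p (extChartAt (𝓡 4) q r) = extChartAt (𝓡 4) p r := by
    rw [transition, Function.comp_apply, (extChartAt (𝓡 4) q).left_inv (by simpa using hq)]
  rw [this, localBilin_apply' T hq, localBilin_apply' T hp, fderiv_transition hp hq,
    coordMap_comp hp hq, coordMap_comp hp hq]

theorem eventually_transition {p q r : M} (hp : r ∈ (chartAt E4 p).source)
    (hq : r ∈ (chartAt E4 q).source) {P : E4 → Prop}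
    (h : ∀ r, r ∈ (chartAt E4 p).source → r ∈ (chartAt E4 q).source →
      P (extChartAt (𝓡 4) q r)) : ∀ᶠ z in 𝓝 (extChartAt (𝓡 4) q r), P z := by
  have hq' : r ∈ (extChartAt (𝓡 4) q).source := by simpa using hq
  have h1 : ∀ᶠ z in 𝓝 (extChartAt (𝓡 4) q r), z ∈ (extChartAt (𝓡 4) q).target :=
    extChartAt_target_mem_nhds' ((extChartAt (𝓡 4) q).map_source hq')
  have h2 : ∀ᶠ z in 𝓝 (extChartAt (𝓡 4) q r),
      (extChartAt (𝓡 4) q).symm z ∈ (chartAt E4 p).source := by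
    have hc := continuousAt_extChartAt_symm' (I := 𝓡 4) hq'
    apply hc
    rw [(extChartAt (𝓡 4) q).left_inv hq']
    exact (chartAt E4 p).open_source.mem_nhds hp
  filter_upwards [h1, h2] with z hz hz'
  have := h _ hz' (extChartAt_symm_mem hz)
  rwa [(extChartAt (𝓡 4) q).right_inv hz] at this

theorem inCoordinates_bilin (T : BilinField M) {p q : M} (hq : q ∈ (chartAt E4 p).source) :
    ContinuousLinearMap.inCoordinates E4 (fun x : M => TangentSpace (𝓡 4) x) (E4 →L[ℝ] ℝ)
      (fun x : M => TangentSpace (𝓡 4) x →L[ℝ] ℝ) p q p q (T q) =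
    localBilin T p (extChartAt (𝓡 4) p q) := by
  ext v w
  have hb : q ∈ (trivializationAt E4 (fun x : M => TangentSpace (𝓡 4) x) p).baseSet := hq
  rw [localBilin_apply' T hq]
  refine (inCoordinates_apply_eq₂ (𝕜 := ℝ) (F₃ := ℝ) (E₃ := Bundle.Trivial M ℝ) hb hb
    (show q ∈ (Bundle.Trivial.trivialization M ℝ).baseSet from Set.mem_univ _)).trans ?_
  simp only [Bundle.Trivial.fiberBundle_trivializationAt',
    Bundle.Trivial.linearMapAt_trivialization, LinearMap.id_apply]
  have hs : ∀ v, coordMap p q v =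
      (trivializationAt E4 (fun x : M => TangentSpace (𝓡 4) x) p).symm q v := fun v =>
    Bundle.Trivialization.symmL_apply _ hb v
  rw [hs, hs]
  rfl

/-- Smoothness of a bundle section becomes smoothness of component functions, to be checked only at
the centre of each chart. -/
theorem smoothBilin_iff {T : BilinField M} :
    SmoothBilin T ↔ ∀ p, ContDiffAt ℝ ∞ (localBilin T p) (extChartAt (𝓡 4) p p) := by
  have : ∀ p, ContMDiffAt (𝓡 4) ((𝓡 4).prod 𝓘(ℝ, E4 →L[ℝ] E4 →L[ℝ] ℝ)) ∞
    (fun p => Bundle.TotalSpace.mk' (E4 →L[ℝ] E4 →L[ℝ] ℝ)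
      (E := fun x : M => TangentSpace (𝓡 4) x →L[ℝ] TangentSpace (𝓡 4) x →L[ℝ] ℝ) p (T p)) p ↔
      ContDiffAt ℝ ∞ (localBilin T p) (extChartAt (𝓡 4) p p) := by
    intro p
    refine (contMDiffAt_hom_bundle _).trans ((and_iff_right contMDiffAt_id).trans ?_)
    rw [contMDiffAt_iff_source]
    rw [ModelWithCorners.range_eq_univ, contMDiffWithinAt_univ, contMDiffAt_iff_contDiffAt]
    refine (fun h => ⟨fun h' => h'.congr_of_eventuallyEq h.symm,
      fun h' => h'.congr_of_eventuallyEq h⟩ : ∀ {f₁ f₂ : E4 → Bil} {x : E4}, f₁ =ᶠ[𝓝 x] f₂ →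
        (ContDiffAt ℝ ∞ f₁ x ↔ ContDiffAt ℝ ∞ f₂ x)) ?_
    filter_upwards [extChartAt_target_mem_nhds' (mem_extChartAt_target (I := 𝓡 4) p)] with y hy
    have := inCoordinates_bilin T (extChartAt_symm_mem hy)
    rw [(extChartAt (𝓡 4) p).right_inv hy] at this
    exact this
  exact forall_congr' this

/-- Away from the centre of the chart at `p`, the components are the pullback of those in the chart
centred at `q`, where smoothness is known. -/
theorem SmoothBilin.contDiffAt {T : BilinField M} (hT : SmoothBilin T) {p q : M}
    (hq : q ∈ (chartAt E4 p).source) :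
    ContDiffAt ℝ ∞ (localBilin T p) (extChartAt (𝓡 4) p q) := by
  have hq' := mem_chart_source E4 q
  have hψ := contDiffAt_transition hq' hq
  have hψ1 : transition p q (extChartAt (𝓡 4) p q) = extChartAt (𝓡 4) q q := by
    rw [transition, Function.comp_apply, (extChartAt (𝓡 4) p).left_inv (by simpa using hq)]
  have h1 : ContDiffAt ℝ ∞ (fun z => localBilin T q (transition p q z)) (extChartAt (𝓡 4) p q) :=
    ContDiffAt.comp (g := localBilin T q) _ (hψ1 ▸ smoothBilin_iff.1 hT q) hψ
  have h2 : ContDiffAt ℝ ∞ (fderiv ℝ (transition p q)) (extChartAt (𝓡 4) p q) :=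
    hψ.fderiv_right (by simp)
  have h3 : ContDiffAt ℝ ∞ (fun z => ((ContinuousLinearMap.compL ℝ E4 E4 ℝ).flip
      (fderiv ℝ (transition p q) z)).comp ((localBilin T q (transition p q z)).comp
        (fderiv ℝ (transition p q) z))) (extChartAt (𝓡 4) p q) :=
    (contDiffAt_const.clm_apply h2).clm_comp (h1.clm_comp h2)
  refine h3.congr_of_eventuallyEq (eventually_transition hq' hq fun r hr hr' => ?_)
  ext a b
  exact localBilin_change T hr hr' a b

theorem smoothEndOn_iff {J : EndField M} {U : Set M} (hU : IsOpen U) :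
    SmoothEndOn J U ↔ ∀ p ∈ U, ContDiffAt ℝ ∞ (localEnd J p) (extChartAt (𝓡 4) p p) := by
  have : ∀ p, ContMDiffAt (𝓡 4) ((𝓡 4).prod 𝓘(ℝ, E4 →L[ℝ] E4)) ∞
    (fun p => Bundle.TotalSpace.mk' (E4 →L[ℝ] E4)
      (E := fun x : M => TangentSpace (𝓡 4) x →L[ℝ] TangentSpace (𝓡 4) x) p (J p)) p ↔
      ContDiffAt ℝ ∞ (localEnd J p) (extChartAt (𝓡 4) p p) := by
    intro p
    refine (contMDiffAt_hom_bundle _).trans ((and_iff_right contMDiffAt_id).trans ?_)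
    rw [contMDiffAt_iff_source]
    rw [ModelWithCorners.range_eq_univ, contMDiffWithinAt_univ, contMDiffAt_iff_contDiffAt]
    rfl
  refine forall₂_congr fun p hp => ?_
  exact Iff.trans ⟨fun h => h.contMDiffAt (hU.mem_nhds hp), fun h => h.contMDiffWithinAt⟩ (this p)

theorem contMDiffOn_scalar_iff {f : M → ℝ} {U : Set M} (hU : IsOpen U) :
    ContMDiffOn (𝓡 4) 𝓘(ℝ) ∞ f U ↔
      ∀ p ∈ U, ContDiffAt ℝ ∞ (f ∘ (extChartAt (𝓡 4) p).symm) (extChartAt (𝓡 4) p p) := by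
  refine forall₂_congr fun p hp => ?_
  refine Iff.trans ⟨fun h => h.contMDiffAt (hU.mem_nhds hp), fun h => h.contMDiffWithinAt⟩ ?_
  rw [contMDiffAt_iff_source,
    ModelWithCorners.range_eq_univ, contMDiffWithinAt_univ, contMDiffAt_iff_contDiffAt]

theorem metric_isInner (g : Metric M) (p : M) : IsInner (bilinAt g.inner p) :=
  ⟨g.symm p, g.pos p⟩

theorem localMetric_isInner (g : Metric M) {p : M} {y : E4}
    (hy : y ∈ (extChartAt (𝓡 4) p).target) : IsInner (localBilin g.inner p y) := by
  refine ⟨fun a b => g.symm _ _ _, fun a ha => g.pos _ _ fun h => ha ?_⟩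
  exact coordMap_injective (extChartAt_symm_mem hy) (h.trans (map_zero _).symm)

theorem eventually_localMetric_isInner (g : Metric M) (p : M) :
    ∀ᶠ y in 𝓝 (extChartAt (𝓡 4) p p), IsInner (localBilin g.inner p y) := by
  filter_upwards [extChartAt_target_mem_nhds' (mem_extChartAt_target (I := 𝓡 4) p)] with y hy
  exact localMetric_isInner g hy

/-- The standard basis of `ℝ⁴`. -/
def stdBasis : Module.Basis (Fin 4) ℝ E4 := (EuclideanSpace.basisFun (Fin 4) ℝ).toBasis

theorem stdBasis_apply (i : Fin 4) : stdBasis i = EuclideanSpace.single i (1 : ℝ) := by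
  simp [stdBasis]

/-- Raising the index of the dual basis inverts the Gram matrix. The left inverse that is verified
is the transpose of the one wanted, so symmetry of the Gram matrix enters. -/
theorem IsInner.gram_inv {B : Bil} (hB : IsInner B) (b : Module.Basis (Fin 4) ℝ E4) (i j : Fin 4) :
    (Matrix.of fun i j => B (b i) (b j))⁻¹ i j =
      b.coord i (B.inverse (LinearMap.toContinuousLinearMap (b.coord j))) := by
  have : (Matrix.of fun i j => b.coord j (B.inverse (LinearMap.toContinuousLinearMap (b.coord i))))
      * (Matrix.of fun i j => B (b i) (b j)) = 1 := by
    ext i j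
    rw [Matrix.mul_apply]
    simp only [Matrix.of_apply]
    have h := congrArg (fun f : E4 →L[ℝ] ℝ => f (b j))
      (hB.apply_inverse (LinearMap.toContinuousLinearMap (b.coord i)))
    have h' := b.sum_repr (B.inverse (LinearMap.toContinuousLinearMap (b.coord i)))
    simp only at h
    rw [← h'] at h
    simp only [map_sum, map_smul, sum_apply, smul_apply, smul_eq_mul] at h
    simp only [Module.Basis.coord_apply]
    rw [h]
    simp [Matrix.one_apply, Finsupp.single_apply, eq_comm]
  have hsymm : (Matrix.of fun i j => B (b i) (b j))ᵀ = Matrix.of fun i j => B (b i) (b j) := by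
    ext i j
    exact hB.symm _ _
  have h2 := Matrix.inv_eq_left_inv this
  rw [← hsymm, ← Matrix.transpose_nonsing_inv, h2]
  rfl

theorem invMetric_eq (g : Metric M) (p : M) (k l : Fin 4) : invMetric g p k l = stdBasis.coord k
    ((bilinAt g.inner p).inverse (LinearMap.toContinuousLinearMap (stdBasis.coord l))) := by
  rw [← (metric_isInner g p).gram_inv]
  simp only [stdBasis_apply]
  rfl

theorem sum_coord_inverse (L : (E4 →L[ℝ] ℝ) →L[ℝ] E4) (f : E4 →L[ℝ] ℝ) :
    ∑ k, ∑ l, (stdBasis.coord k (L (LinearMap.toContinuousLinearMap (stdBasis.coord l))) *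
      f (stdBasis l)) • stdBasis k = L f := by
  have h2 : f = ∑ l, f (stdBasis l) • LinearMap.toContinuousLinearMap (stdBasis.coord l) := by
    ext1 c
    conv_lhs => rw [← stdBasis.sum_repr c]
    simp only [map_sum, map_smul, sum_apply, smul_apply, smul_eq_mul]
    simp [mul_comm]
  conv_rhs => rw [← stdBasis.sum_repr (L f)]
  refine Finset.sum_congr rfl fun k _ => ?_
  rw [← Finset.sum_smul]
  congr 1
  rw [← Module.Basis.coord_apply]
  conv_rhs => rw [h2]
  simp [mul_comm]

theorem christoffel_eq_chr (g : Metric M) (p : M) (a b : E4) :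
    (christoffel g p a b : E4) = chr (localBilin g.inner p) (extChartAt (𝓡 4) p p) a b := by
  rw [chr, localBilin_self, ← sum_coord_inverse]
  simp only [← invMetric_eq, chrLower_apply, stdBasis_apply]
  rfl

/-- Brings the inverse-matrix formula for `covDeriv` into the basis-free form used in all later
computations. -/
theorem covDeriv_eq_chcov (g : Metric M) (T : BilinField M) (p : M) (a b c : E4) :
    covDeriv g T p a b c = chcov (localBilin g.inner p) (localBilin T p) (extChartAt (𝓡 4) p p)
      a b c := by
  rw [chcov, localBilin_self, ← christoffel_eq_chr g, ← christoffel_eq_chr g]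
  rfl

/-- The covariant derivative at `q`, read in the preferred chart at `p`. -/
theorem covDeriv_coordMap (g : Metric M) {T : BilinField M} (hT : SmoothBilin T) {p q : M}
    (hq : q ∈ (chartAt E4 p).source) (a b c : E4) :
    covDeriv g T q (coordMap p q a) (coordMap p q b) (coordMap p q c) =
      chcov (localBilin g.inner p) (localBilin T p) (extChartAt (𝓡 4) p q) a b c := by
  have hq' := mem_chart_source E4 q
  have hψ := contDiffAt_transition hq hq'
  have hψ1 : transition q p (extChartAt (𝓡 4) q q) = extChartAt (𝓡 4) p q := by
    rw [transition, Function.comp_apply, (extChartAt (𝓡 4) q).left_inv (by simp)]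
  have hd : ∀ v, fderiv ℝ (transition q p) (extChartAt (𝓡 4) q q) (coordMap p q v) = v := by
    intro v
    rw [fderiv_transition hq hq']
    refine coordMap_injective hq ?_
    rw [coordMap_comp hq hq', coordMap_self]; rfl
  have hg : SmoothBilin g.inner := g.contMDiff
  have hn : (∞ : WithTop ℕ∞) ≠ 0 := by simp
  refine (covDeriv_eq_chcov g T q _ _ _).trans ?_
  rw [chcov_pullback (G := localBilin g.inner p) (T := localBilin T p) (ψ := transition q p)
    (hψ.of_le (WithTop.coe_le_coe.2 le_top))
    (hψ1 ▸ (hg.contDiffAt hq).differentiableAt hn) (hψ1 ▸ (hT.contDiffAt hq).differentiableAt hn)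
    ((hg.contDiffAt hq').differentiableAt hn) ((hT.contDiffAt hq').differentiableAt hn)
    (eventually_transition hq hq' fun r hr hr' => localBilin_change _ hr hr')
    (eventually_transition hq hq' fun r hr hr' => localBilin_change _ hr hr')
    (hψ1 ▸ localMetric_isInner g ((extChartAt (𝓡 4) p).map_source (by simpa using hq)))
    (localMetric_isInner g (mem_extChartAt_target q)) (fun v => ⟨_, hd v⟩), hd, hd, hd, hψ1]

/-! ### Linear algebra of 2-forms in an oriented Euclidean 4-space -/

/-- Orthonormal bases for a bilinear form on `ℝ⁴`. -/
def IsFrame (B : Bil) (e : Fin 4 → E4) : Prop := ∀ i j, B (e i) (e j) = if i = j then 1 else 0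

/-- Fewer than four linear functionals on `ℝ⁴` have a common nonzero kernel vector, which is then
normalized. -/
theorem IsInner.exists_unit {B : Bil} (hB : IsInner B) {k : ℕ} (hk : k < 4) (v : Fin k → E4) :
    ∃ u, B u u = 1 ∧ ∀ i, B (v i) u = 0 := by
  obtain ⟨w, hw, hw0⟩ : ∃ w : E4, (∀ i, B (v i) w = 0) ∧ w ≠ 0 := by
    have := LinearMap.ker_ne_bot_of_finrank_lt
      (f := LinearMap.pi fun i => (B (v i) : E4 →ₗ[ℝ] ℝ)) (by simpa using hk)
    obtain ⟨w, hw, hw0⟩ := Submodule.exists_mem_ne_zero_of_ne_bot this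
    refine ⟨w, fun i => ?_, hw0⟩
    have := congrFun (LinearMap.mem_ker.1 hw) i
    simpa using this
  have hpos := hB.pos w hw0
  refine ⟨(Real.sqrt (B w w))⁻¹ • w, ?_, fun i => by simp [hw]⟩
  have h := Real.mul_self_sqrt hpos.le
  have h0 : Real.sqrt (B w w) ≠ 0 := (Real.sqrt_pos.2 hpos).ne'
  simp only [map_smul, smul_apply, smul_eq_mul]
  field_simp
  rw [pow_two, h]

theorem IsFrame.exists_basis {B : Bil} {e : Fin 4 → E4} (he : IsFrame B e) :
    ∃ b : Module.Basis (Fin 4) ℝ E4, ⇑b = e := by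
  have hli : LinearIndependent ℝ e := by
    rw [Fintype.linearIndependent_iff]
    intro c hc i
    have := congrArg (fun x => B x (e i)) hc
    simpa [he _ i] using this
  exact ⟨basisOfLinearIndependentOfCardEqFinrank hli (by simp), by simp⟩

theorem IsFrame.expand {B : Bil} {e : Module.Basis (Fin 4) ℝ E4} (he : IsFrame B e) (v : E4) :
    v = ∑ i, B (e i) v • e i := by
  have h : ∀ i, B (e i) v = e.repr v i := fun i => by
    conv_lhs => rw [← e.sum_repr v]
    simp only [map_sum, map_smul, smul_eq_mul, he i]
    simp
  simp only [h]
  exact (e.sum_repr v).symm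

/-- The change between orthonormal bases is orthogonal (`hδ`), so traces do not depend on the basis.
-/
theorem IsFrame.sum_eq {B : Bil} {e f : Module.Basis (Fin 4) ℝ E4} (hB : IsInner B)
    (he : IsFrame B e) (hf : IsFrame B f) (T : E4 → E4 → ℝ)
    (h1 : ∀ b, IsLinearMap ℝ fun a => T a b) (h2 : ∀ a, IsLinearMap ℝ fun b => T a b) :
    ∑ i, T (e i) (e i) = ∑ i, T (f i) (f i) := by
  have hT : ∀ a b, T a b = ∑ j, ∑ k, B (f j) a * B (f k) b * T (f j) (f k) := by
    intro a b
    have e1 : ∀ b, T a b = ∑ j, B (f j) a * T (f j) b := fun b => by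
      conv_lhs => rw [hf.expand a]
      have := map_sum (h1 b).mk' (fun j => B (f j) a • f j) Finset.univ
      simp only [IsLinearMap.mk'_apply, (h1 b).map_smul, smul_eq_mul] at this
      exact this
    rw [e1]
    refine Finset.sum_congr rfl fun j _ => ?_
    conv_lhs => rw [hf.expand b]
    have := map_sum (h2 (f j)).mk' (fun k => B (f k) b • f k) Finset.univ
    simp only [IsLinearMap.mk'_apply, (h2 (f j)).map_smul, smul_eq_mul] at this
    rw [this, Finset.mul_sum]
    simp [mul_assoc]
  have hδ : ∀ j k, ∑ i, B (f j) (e i) * B (f k) (e i) = if j = k then 1 else 0 := by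
    intro j k
    rw [← hf j k]
    conv_rhs => rw [he.expand (f k)]
    simp [hB.symm (f k), mul_comm]
  calc ∑ i, T (e i) (e i)
      = ∑ i, ∑ j, ∑ k, B (f j) (e i) * B (f k) (e i) * T (f j) (f k) :=
        Finset.sum_congr rfl fun i _ => hT _ _
    _ = ∑ j, ∑ k, (∑ i, B (f j) (e i) * B (f k) (e i)) * T (f j) (f k) := by
        rw [Finset.sum_comm]
        refine Finset.sum_congr rfl fun j _ => ?_
        rw [Finset.sum_comm]
        simp [Finset.sum_mul]
    _ = ∑ i, T (f i) (f i) := by simp [hδ]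

/-! ### Hodge duality of 2-forms and its independence of the frame. -/

theorem skew_of_alternating {F : Bil} (h : ∀ v, F v v = 0) (a b : E4) : F a b = - F b a := by
  have := h (a + b)
  simp [h] at this
  linarith

/-- The wedge product of two 2-forms on `ℝ⁴`. -/
def wedge (F F' : Bil) (h : ∀ v, F v v = 0) (h' : ∀ v, F' v v = 0) :
    E4 [⋀^Fin 4]→ₗ[ℝ] ℝ where
  toFun v := F (v 0) (v 1) * F' (v 2) (v 3) + F (v 2) (v 3) * F' (v 0) (v 1)
    - F (v 0) (v 2) * F' (v 1) (v 3) - F (v 1) (v 3) * F' (v 0) (v 2)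
    + F (v 0) (v 3) * F' (v 1) (v 2) + F (v 1) (v 2) * F' (v 0) (v 3)
  map_update_add' := by
    intro inst v i x y
    obtain rfl : inst = instDecidableEqFin 4 := Subsingleton.elim _ _
    fin_cases i <;> simp [Function.update] <;> ring
  map_update_smul' := by
    intro inst v i c x
    obtain rfl : inst = instDecidableEqFin 4 := Subsingleton.elim _ _
    fin_cases i <;> simp [Function.update] <;> ring
  map_eq_zero_of_eq' := by
    intro v i j hv hne
    have key : ∀ i j, i < j → v i = v j → F (v 0) (v 1) * F' (v 2) (v 3)
        + F (v 2) (v 3) * F' (v 0) (v 1)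
        - F (v 0) (v 2) * F' (v 1) (v 3) - F (v 1) (v 3) * F' (v 0) (v 2)
        + F (v 0) (v 3) * F' (v 1) (v 2) + F (v 1) (v 2) * F' (v 0) (v 3) = 0 := by
      intro i j hij hv
      have s := skew_of_alternating h
      have s' := skew_of_alternating h'
      have e1 := s (v 3) (v 1)
      have e2 := s (v 3) (v 2)
      have e3 := s (v 2) (v 1)
      have e1' := s' (v 3) (v 1)
      have e2' := s' (v 3) (v 2)
      have e3' := s' (v 2) (v 1)
      fin_cases i <;> fin_cases j <;> simp at hij hv <;> rw [hv] <;>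
        simp only [h, h', e1, e2, e3, e1', e2', e3'] <;> ring
    rcases lt_or_gt_of_ne hne with h1 | h1
    · exact key i j h1 hv
    · exact key j i h1 hv.symm

/-- The change of basis is orthogonal, so its determinant squares to one; equal orientations make it
positive. -/
theorem IsFrame.det_eq_one {B : Bil} (hB : IsInner B) {e f : Module.Basis (Fin 4) ℝ E4}
    (he : IsFrame B e) (hf : IsFrame B f) (ho : e.orientation = f.orientation) :
    e.det f = 1 := by
  have hpos := (Module.Basis.orientation_eq_iff_det_pos e f).1 ho
  have hA : (e.toMatrix f).transpose * e.toMatrix f = 1 := by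
    ext i j
    have h : ∀ i k, e.toMatrix f k i = B (e k) (f i) := fun i k => by
      rw [Module.Basis.toMatrix_apply]
      conv_rhs => rw [← e.sum_repr (f i)]
      simp only [map_sum, map_smul, smul_eq_mul, he k]
      simp
    rw [Matrix.mul_apply, Matrix.one_apply, ← hf i j]
    conv_rhs => rw [he.expand (f j)]
    simp [h, hB.symm (f i), mul_comm]
  have := congrArg Matrix.det hA
  rw [Matrix.det_mul, Matrix.det_transpose, Matrix.det_one, ← Module.Basis.det_apply] at this
  nlinarith

/-- `F` satisfies `*F = s F` in the frame `e`. -/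
def DualIn (s : ℝ) (F : Bil) (e : Fin 4 → E4) : Prop :=
  F (e 0) (e 1) = s * F (e 2) (e 3) ∧ F (e 0) (e 2) = s * F (e 3) (e 1) ∧
    F (e 0) (e 3) = s * F (e 1) (e 2)

/-- The 2-form `u♭ ∧ v♭`. -/
def flatWedge (B : Bil) (u v : E4) : Bil :=
  (B u).smulRight (B v) - (B v).smulRight (B u)

theorem flatWedge_apply (B : Bil) (u v a b : E4) :
    flatWedge B u v a b = B u a * B v b - B v a * B u b := by
  simp [flatWedge]

/-- Duality means `F ∧ F' = s ⟨F, F'⟩ vol` for all 2-forms `F'`. The inner product is a double trace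
and the volume form has value one on both frames, so this form of the condition is invariant. -/
theorem DualIn.of_frame {B : Bil} (hB : IsInner B) {e f : Module.Basis (Fin 4) ℝ E4}
    (he : IsFrame B e) (hf : IsFrame B f) (ho : e.orientation = f.orientation) {s : ℝ} {F : Bil}
    (hF : ∀ v, F v v = 0) (h : DualIn s F e) (hs : s ^ 2 = 1) : DualIn s F f := by
  have key : ∀ F' : Bil, ∀ h' : ∀ v, F' v v = 0, wedge F F' hF h' f =
      s / 2 * ∑ i, ∑ j, F (f i) (f j) * F' (f i) (f j) := by
    intro F' h'
    have h1 : ∑ i, ∑ j, F (f i) (f j) * F' (f i) (f j) =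
        ∑ i, ∑ j, F (e i) (e j) * F' (e i) (e j) := by
      rw [hf.sum_eq hB he (fun a b => ∑ j, F a (f j) * F' b (f j))
        (fun b => ⟨fun x y => by simp [add_mul, Finset.sum_add_distrib],
          fun c x => by simp [Finset.mul_sum, mul_assoc]⟩)
        (fun b => ⟨fun x y => by simp [mul_add, Finset.sum_add_distrib],
          fun c x => by simp [Finset.mul_sum, mul_left_comm]⟩)]
      refine Finset.sum_congr rfl fun i _ => ?_
      exact hf.sum_eq hB he (fun a b => F (e i) a * F' (e i) b)
        (fun b => ⟨fun x y => by simp [add_mul], fun c x => by simp [mul_assoc]⟩)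
        (fun b => ⟨fun x y => by simp [mul_add], fun c x => by simp [mul_left_comm]⟩)
    have h2 : wedge F F' hF h' f = wedge F F' hF h' e := by
      conv_lhs => rw [AlternatingMap.eq_smul_basis_det e (wedge F F' hF h')]
      simp [he.det_eq_one hB hf ho]
    rw [h1, h2]
    obtain ⟨a1, a2, a3⟩ := h
    have t := skew_of_alternating hF
    have t' := skew_of_alternating h'
    simp only [Fin.sum_univ_four, hF, h', t (e 1) (e 0), t (e 2) (e 0), t (e 3) (e 0),
      t (e 2) (e 1), t (e 3) (e 1), t (e 3) (e 2), t' (e 1) (e 0), t' (e 2) (e 0), t' (e 3) (e 0),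
      t' (e 2) (e 1), t' (e 3) (e 1), t' (e 3) (e 2)] at a1 a2 a3 ⊢
    simp only [wedge, AlternatingMap.coe_mk, MultilinearMap.coe_mk, a1, a2, a3]
    linear_combination (-(F (e 2) (e 3) * F' (e 0) (e 1)) + F (e 1) (e 3) * F' (e 0) (e 2)
      - F (e 1) (e 2) * F' (e 0) (e 3)) * hs
  have hw : ∀ i j : Fin 4, ∀ v, flatWedge B (f i) (f j) v v = 0 := fun i j v => by
    rw [flatWedge_apply]; ring
  have t := skew_of_alternating hF
  -- Testing against `f₂ ∧ f₃`, `f₃ ∧ f₁` and `f₁ ∧ f₂` reads off the three component equations.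
  refine ⟨?_, ?_, ?_⟩
  · have := key _ (hw 2 3)
    simp [wedge, flatWedge_apply, hf _ _, Fin.sum_univ_four] at this
    rw [t (f 3) (f 2)] at this
    linarith
  · have := key _ (hw 3 1)
    simp [wedge, flatWedge_apply, hf _ _, Fin.sum_univ_four] at this
    rw [t (f 1) (f 3)] at this
    linarith
  · have := key _ (hw 1 2)
    simp [wedge, flatWedge_apply, hf _ _, Fin.sum_univ_four] at this
    rw [t (f 2) (f 1)] at this
    linarith

theorem bil_ext (e : Module.Basis (Fin 4) ℝ E4) {F F' : Bil}
    (h : ∀ i j, F (e i) (e j) = F' (e i) (e j)) : F = F' := by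
  have h1 : (F : E4 →ₗ[ℝ] (E4 →L[ℝ] ℝ)) = F' := e.ext fun i => by
    have h2 : (F (e i) : E4 →ₗ[ℝ] ℝ) = F' (e i) := e.ext fun j => h i j
    ext v
    exact congrArg (fun f : E4 →ₗ[ℝ] ℝ => f v) h2
  ext u v
  exact congrArg (fun f : E4 →ₗ[ℝ] (E4 →L[ℝ] ℝ) => f u v) h1

theorem alternating_ext (e : Module.Basis (Fin 4) ℝ E4) {F F' : Bil} (hF : ∀ v, F v v = 0)
    (hF' : ∀ v, F' v v = 0) (h01 : F (e 0) (e 1) = F' (e 0) (e 1))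
    (h02 : F (e 0) (e 2) = F' (e 0) (e 2)) (h03 : F (e 0) (e 3) = F' (e 0) (e 3))
    (h12 : F (e 1) (e 2) = F' (e 1) (e 2)) (h13 : F (e 1) (e 3) = F' (e 1) (e 3))
    (h23 : F (e 2) (e 3) = F' (e 2) (e 3)) : F = F' := by
  have t := skew_of_alternating hF
  have t' := skew_of_alternating hF'
  refine bil_ext e fun i j => ?_
  fin_cases i <;> fin_cases j <;> simp only [Fin.zero_eta, Fin.mk_one, Fin.reduceFinMk, hF, hF'] <;>
    first
    | assumption
    | (rw [t, t']; simpa only [neg_inj])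

/-- The Hodge star of a 2-form, computed in the orthonormal frame `e`. -/
def starIn (B : Bil) (e : Fin 4 → E4) (F : Bil) : Bil :=
  F (e 2) (e 3) • flatWedge B (e 0) (e 1) + F (e 3) (e 1) • flatWedge B (e 0) (e 2)
    + F (e 1) (e 2) • flatWedge B (e 0) (e 3) + F (e 0) (e 1) • flatWedge B (e 2) (e 3)
    + F (e 0) (e 2) • flatWedge B (e 3) (e 1) + F (e 0) (e 3) • flatWedge B (e 1) (e 2)

/-- The part of a 2-form on which the Hodge star is multiplication by `s`. -/
def dualPart (B : Bil) (e : Fin 4 → E4) (s : ℝ) (F : Bil) : Bil :=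
  (1 / 2 : ℝ) • (F + s • starIn B e F)

theorem dualPart_apply (B : Bil) (e : Fin 4 → E4) (s : ℝ) (F : Bil) (a b : E4) :
    dualPart B e s F a b = (F a b + s * (
      F (e 2) (e 3) * (B (e 0) a * B (e 1) b - B (e 1) a * B (e 0) b)
      + F (e 3) (e 1) * (B (e 0) a * B (e 2) b - B (e 2) a * B (e 0) b)
      + F (e 1) (e 2) * (B (e 0) a * B (e 3) b - B (e 3) a * B (e 0) b)
      + F (e 0) (e 1) * (B (e 2) a * B (e 3) b - B (e 3) a * B (e 2) b)
      + F (e 0) (e 2) * (B (e 3) a * B (e 1) b - B (e 1) a * B (e 3) b)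
      + F (e 0) (e 3) * (B (e 1) a * B (e 2) b - B (e 2) a * B (e 1) b))) / 2 := by
  simp only [dualPart, starIn, smul_apply, add_apply, flatWedge_apply, smul_eq_mul]
  ring

theorem dualPart_alternating (B : Bil) (e : Fin 4 → E4) (s : ℝ) {F : Bil} (hF : ∀ v, F v v = 0)
    (v : E4) : dualPart B e s F v v = 0 := by
  rw [dualPart_apply, hF]
  ring

theorem dualPart_dualIn {B : Bil} {e : Fin 4 → E4} (he : IsFrame B e) {s : ℝ} (hs : s ^ 2 = 1)
    {F : Bil} (hF : ∀ v, F v v = 0) : DualIn s (dualPart B e s F) e := by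
  have t := skew_of_alternating hF
  refine ⟨?_, ?_, ?_⟩ <;>
    simp [dualPart_apply, he _ _]
  · linear_combination -(1 / 2 * F (e 0) (e 1)) * hs
  · linear_combination -(1 / 2 * F (e 0) (e 2)) * hs
  · linear_combination -(1 / 2 * F (e 0) (e 3)) * hs

theorem dualPart_add (B : Bil) (e : Fin 4 → E4) (F : Bil) :
    dualPart B e 1 F + dualPart B e (-1) F = F := by
  ext a b
  rw [add_apply, add_apply, dualPart_apply, dualPart_apply]
  ring

theorem DualIn.eq_zero {e : Module.Basis (Fin 4) ℝ E4} {F : Bil} (hF : ∀ v, F v v = 0)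
    (h1 : DualIn 1 F e) (h2 : DualIn (-1) F e) : F = 0 := by
  obtain ⟨a1, a2, a3⟩ := h1
  obtain ⟨b1, b2, b3⟩ := h2
  have t := skew_of_alternating hF (e 3) (e 1)
  apply alternating_ext e hF (by simp) <;> simp only [zero_apply] <;> linarith

theorem DualIn.add {s : ℝ} {F F' : Bil} {e : Fin 4 → E4} (h : DualIn s F e) (h' : DualIn s F' e) :
    DualIn s (F + F') e := by
  obtain ⟨a1, a2, a3⟩ := h
  obtain ⟨b1, b2, b3⟩ := h'
  refine ⟨?_, ?_, ?_⟩ <;> simp only [add_apply] <;> linarith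

theorem DualIn.smul {s : ℝ} {F : Bil} {e : Fin 4 → E4} (h : DualIn s F e) (c : ℝ) :
    DualIn s (c • F) e := by
  obtain ⟨a1, a2, a3⟩ := h
  refine ⟨?_, ?_, ?_⟩ <;> simp only [smul_apply, smul_eq_mul, a1, a2, a3] <;> ring

/-- Uniqueness of the decomposition into dual parts. -/
theorem DualIn.unique {e : Module.Basis (Fin 4) ℝ E4} {P P' Q Q' : Bil} (hP : ∀ v, P v v = 0)
    (hP' : ∀ v, P' v v = 0) (h1 : DualIn 1 P e) (h1' : DualIn 1 P' e) (h2 : DualIn (-1) Q e)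
    (h2' : DualIn (-1) Q' e) (h : P + Q = P' + Q') : P = P' ∧ Q = Q' := by
  have h0 : ∀ a b, P a b + Q a b = P' a b + Q' a b := fun a b =>
    congrArg (fun F : Bil => F a b) h
  -- The difference lies in both eigenspaces of the Hodge star, which meet only in zero.
  have h4 : P + (-1 : ℝ) • P' = Q' + (-1 : ℝ) • Q := by
    ext a b
    simp only [add_apply, smul_apply, smul_eq_mul]
    linarith [h0 a b]
  have h5 : P + (-1 : ℝ) • P' = 0 := by
    refine DualIn.eq_zero (e := e) (fun v => by simp only [add_apply, smul_apply, hP, hP']; simp)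
      (h1.add (h1'.smul (-1))) ?_
    rw [h4]
    exact h2'.add (h2.smul (-1))
  have h6 : ∀ a b, P a b = P' a b := fun a b => by
    have := congrArg (fun F : Bil => F a b) h5
    simp only [add_apply, smul_apply, smul_eq_mul, zero_apply] at this
    linarith
  refine ⟨by ext a b; exact h6 a b, ?_⟩
  ext a b
  linarith [h0 a b, h6 a b]

/-! ### Orthonormal frames adapted to an orthogonal complex structure. -/

/-- An orthonormal frame adapted to an orthogonal complex structure. -/
structure Adapted (B : Bil) (J : E4 →L[ℝ] E4) (s : ℝ) (e : Fin 4 → E4) : Prop where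
  frame : IsFrame B e
  map0 : J (e 0) = e 1
  map1 : J (e 1) = - e 0
  map2 : J (e 2) = s • e 3
  map3 : J (e 3) = -s • e 2

theorem IsInner.skew_of_compatible {B : Bil} {J : E4 →L[ℝ] E4} (hJ : ∀ v, J (J v) = -v)
    (hc : ∀ v w, B (J v) (J w) = B v w) (v w : E4) : B (J v) w = - B v (J w) := by
  have := hc v (J w)
  rw [hJ] at this
  simp at this
  linarith

/-- For a unit vector `u` and a unit `w` orthogonal to `u` and `Ju`, the vectors `u, Ju, w, ±Jw` are
orthonormal. The orientation selects the sign, and the duality of `κ` forces this sign to be `s`. -/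
theorem exists_adapted {B : Bil} (hB : IsInner B) {J : E4 →L[ℝ] E4} (hJ : ∀ v, J (J v) = -v)
    (hc : ∀ v w, B (J v) (J w) = B v w) {s : ℝ} (hs : s = 1 ∨ s = -1)
    (o : Orientation ℝ E4 (Fin 4))
    (hd : ∀ e : Module.Basis (Fin 4) ℝ E4, IsFrame B e → e.orientation = o →
      DualIn s (B.comp J) e) :
    ∃ e : Module.Basis (Fin 4) ℝ E4, Adapted B J s e ∧ e.orientation = o := by
  have hsk := IsInner.skew_of_compatible hJ hc
  obtain ⟨u, hu, -⟩ := hB.exists_unit (k := 0) (by norm_num) Fin.elim0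
  obtain ⟨w, hw, huw⟩ := hB.exists_unit (k := 2) (by norm_num) ![u, J u]
  have h0 : B u w = 0 := huw 0
  have h1 : B (J u) w = 0 := huw 1
  have h2 : B u (J w) = 0 := by have := hsk u w; linarith
  have h3 : B (J u) (J w) = 0 := by rw [hc, h0]
  have hself : ∀ v, B v (J v) = 0 := fun v => by
    have := hsk v v
    have := hB.symm v (J v)
    linarith
  have hfr : ∀ t : ℝ, t ^ 2 = 1 → IsFrame B ![u, J u, w, t • J w] := by
    intro t ht i j
    have ht' : t * t = 1 := by rw [← ht]; ring
    fin_cases i <;> fin_cases j <;>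
      simp [hu, hw, h0, h1, h2, h3, hself, hc, hB.symm (J _) u, hB.symm w u, hB.symm w (J u),
        hB.symm (J w) w, ht']
  obtain ⟨b, hb⟩ := (hfr 1 (by norm_num)).exists_basis
  obtain ⟨b', hb'⟩ := (hfr (-1) (by norm_num)).exists_basis
  have had : ∀ t : ℝ, t ^ 2 = 1 → ∀ b : Module.Basis (Fin 4) ℝ E4, ⇑b = ![u, J u, w, t • J w] →
      b.orientation = o → ∃ e : Module.Basis (Fin 4) ℝ E4, Adapted B J s e ∧ e.orientation = o := by
    intro t ht b hb hbo
    have hf : IsFrame B b := hb ▸ hfr t ht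
    obtain ⟨h, -, -⟩ := hd b hf hbo
    simp [hb, hc, hu, hw] at h
    have hts : t = s := by
      rcases hs with rfl | rfl
      · linarith
      · linarith
    subst hts
    refine ⟨b, ⟨hf, ?_, ?_, ?_, ?_⟩, hbo⟩
    · simp [hb]
    · simp [hb, hJ]
    · simp only [hb]; simp [smul_smul, ← pow_two, ht]
    · simp [hb, hJ]
  -- Changing the sign of the last vector reverses the orientation, so one of the two frames has the
  -- required one.
  have hor : b.orientation = o ∨ b'.orientation = o := by
    have hne : b.orientation ≠ b'.orientation := by
      intro h
      rw [Module.Basis.orientation_eq_iff_det_pos] at h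
      have hu : (b' : Fin 4 → E4) = Function.update (⇑b) 3 ((-1 : ℝ) • b 3) := by
        ext1 i
        fin_cases i <;> simp [hb, hb', Function.update]
      rw [hu, AlternatingMap.map_update_smul, Function.update_eq_self, Module.Basis.det_self] at h
      norm_num at h
    rcases b.orientation_eq_or_eq_neg o with h | h
    · exact Or.inl h.symm
    · rcases b'.orientation_eq_or_eq_neg o with h' | h'
      · exact Or.inr h'.symm
      · exact absurd (neg_injective (h.symm.trans h')) hne
  rcases hor with h | h
  · exact had 1 (by norm_num) b hb h
  · exact had (-1) (by norm_num) b' hb' h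

/-! ### The twistor equation at a point -/

/-- Trilinear forms on `ℝ⁴`. -/
structure IsTrilin (f : E4 → E4 → E4 → ℝ) : Prop where
  fst : ∀ b c, IsLinearMap ℝ fun a => f a b c
  snd : ∀ a c, IsLinearMap ℝ fun b => f a b c
  trd : ∀ a b, IsLinearMap ℝ fun c => f a b c

theorem isLinearMap_eq_zero {f : E4 → ℝ} (hf : IsLinearMap ℝ f) (e : Module.Basis (Fin 4) ℝ E4)
    (h : ∀ i, f (e i) = 0) (v : E4) : f v = 0 := by
  have : hf.mk' f = 0 := e.ext fun i => by simpa using h i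
  simpa using congrArg (fun L : E4 →ₗ[ℝ] ℝ => L v) this

theorem IsTrilin.eq_zero {f : E4 → E4 → E4 → ℝ} (hf : IsTrilin f)
    (e : Module.Basis (Fin 4) ℝ E4) (h : ∀ i j k, f (e i) (e j) (e k) = 0) (a b c : E4) :
    f a b c = 0 :=
  isLinearMap_eq_zero (hf.trd a b) e (fun k => isLinearMap_eq_zero (hf.snd a _) e
    (fun j => isLinearMap_eq_zero (hf.fst _ _) e (fun i => h i j k) a) b) c

/-- The conformal Killing–Yano (twistor) equation on the values `z` of a covariant derivative. -/
def IsTwistor (B : Bil) (z : E4 → E4 → E4 → ℝ) : Prop :=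
  ∃ τ : E4 → ℝ, IsLinearMap ℝ τ ∧ ∀ a b c,
    z a b c + z b a c = 2 * B a b * τ c - B a c * τ b - B b c * τ a

/-- The trace of a trilinear form in its first two arguments. -/
theorem IsTwistor.trace {B : Bil} {z : E4 → E4 → E4 → ℝ} {τ : E4 → ℝ} (hτ : IsLinearMap ℝ τ)
    (h : ∀ a b c, z a b c + z b a c = 2 * B a b * τ c - B a c * τ b - B b c * τ a)
    {e : Module.Basis (Fin 4) ℝ E4} (he : IsFrame B e) (c : E4) :
    ∑ i, z (e i) (e i) c = 3 * τ c := by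
  have h1 : ∀ i, z (e i) (e i) c = τ c - B (e i) c * τ (e i) := fun i => by
    have := h (e i) (e i) c
    rw [he i i, if_pos rfl] at this
    linarith
  have h2 : τ c = ∑ i, B (e i) c * τ (e i) := by
    conv_lhs => rw [he.expand c]
    have := map_sum hτ.mk' (fun i => B (e i) c • e i) Finset.univ
    simp only [IsLinearMap.mk'_apply, hτ.map_smul, smul_eq_mul] at this
    exact this
  -- Four copies of `τ c` minus one: the constant 3.
  simp only [h1, Finset.sum_sub_distrib, ← h2]
  simp
  ring

/-- The algebraic properties of the covariant derivative `d a b c = g(∇_a J b, c)` of an orthogonal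
almost complex structure. -/
structure IsHermitianJet (J : E4 →L[ℝ] E4) (d : E4 → E4 → E4 → ℝ) : Prop where
  trilin : IsTrilin d
  skew : ∀ a b c, d a b c = - d a c b
  anti : ∀ a b c, d a (J b) c = d a b (J c)

/-- The Nijenhuis tensor in terms of the covariant derivative of the almost complex structure. -/
def nijenhuisForm (J : E4 →L[ℝ] E4) (d : E4 → E4 → E4 → ℝ) (a b c : E4) : ℝ :=
  d (J a) b c - d (J b) a c - d b a (J c) + d a b (J c)

/-- The exterior derivative of `Ω² κ` divided by `Ω²`, where `w = dΩ / Ω`. -/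
def closedForm (B : Bil) (J : E4 →L[ℝ] E4) (d : E4 → E4 → E4 → ℝ) (w : E4 → ℝ)
    (a b c : E4) : ℝ :=
  (2 * w a * B (J b) c + d a b c) + (2 * w b * B (J c) a + d b c a)
    + (2 * w c * B (J a) b + d c a b)

/-- The covariant derivative of `Ω⁻¹ κ` multiplied by `Ω`, where `w = dΩ / Ω`. -/
def killingJet (B : Bil) (J : E4 →L[ℝ] E4) (d : E4 → E4 → E4 → ℝ) (w : E4 → ℝ)
    (a b c : E4) : ℝ :=
  d a b c - w a * B (J b) c

section

variable {B : Bil} {J : E4 →L[ℝ] E4} {d : E4 → E4 → E4 → ℝ} {w : E4 → ℝ} {s : ℝ}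
  {e : Module.Basis (Fin 4) ℝ E4}

theorem IsHermitianJet.isTrilin_nijenhuisForm (hd : IsHermitianJet J d) :
    IsTrilin (nijenhuisForm J d) := by
  obtain ⟨⟨h1, h2, h3⟩, -, -⟩ := hd
  refine ⟨fun b c => ⟨fun x y => ?_, fun r x => ?_⟩, fun a c => ⟨fun x y => ?_, fun r x => ?_⟩,
    fun a b => ⟨fun x y => ?_, fun r x => ?_⟩⟩ <;>
  simp only [nijenhuisForm, map_add, map_smul, (h1 _ _).map_add, (h2 _ _).map_add,
    (h3 _ _).map_add, (h1 _ _).map_smul, (h2 _ _).map_smul, (h3 _ _).map_smul, smul_eq_mul] <;>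
  ring

theorem IsHermitianJet.isTrilin_closedForm (hd : IsHermitianJet J d) (hw : IsLinearMap ℝ w) :
    IsTrilin (closedForm B J d w) := by
  obtain ⟨⟨h1, h2, h3⟩, -, -⟩ := hd
  refine ⟨fun b c => ⟨fun x y => ?_, fun r x => ?_⟩, fun a c => ⟨fun x y => ?_, fun r x => ?_⟩,
    fun a b => ⟨fun x y => ?_, fun r x => ?_⟩⟩ <;>
  simp only [closedForm, map_add, map_smul, (h1 _ _).map_add, (h2 _ _).map_add,
    (h3 _ _).map_add, (h1 _ _).map_smul, (h2 _ _).map_smul, (h3 _ _).map_smul, hw.map_add,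
    hw.map_smul, add_apply, smul_apply, smul_eq_mul] <;>
  ring

/-- The components of a Hermitian jet in an adapted frame. -/
theorem IsHermitianJet.components (hd : IsHermitianJet J d) (ha : Adapted B J s e)
    (hs : s ^ 2 = 1) :
    (∀ a v, d a v v = 0) ∧ (∀ a, d a (e 0) (e 1) = 0) ∧ (∀ a, d a (e 1) (e 0) = 0) ∧
      (∀ a, d a (e 2) (e 3) = 0) ∧ (∀ a, d a (e 3) (e 2) = 0) ∧
      (∀ a, d a (e 2) (e 0) = - d a (e 0) (e 2)) ∧
      (∀ a, d a (e 3) (e 0) = - d a (e 0) (e 3)) ∧ (∀ a, d a (e 1) (e 2) = s * d a (e 0) (e 3)) ∧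
      (∀ a, d a (e 2) (e 1) = -s * d a (e 0) (e 3)) ∧
      (∀ a, d a (e 1) (e 3) = -s * d a (e 0) (e 2)) ∧
      ∀ a, d a (e 3) (e 1) = s * d a (e 0) (e 2) := by
  obtain ⟨⟨h1, h2, h3⟩, hsk, han⟩ := hd
  have h0 : ∀ a v, d a v v = 0 := fun a v => by have := hsk a v v; linarith
  rw [and_iff_right h0]
  simp only [← forall_and]
  intro a
  have k1 := han a (e 0) (e 0)
  have k2 := han a (e 0) (e 2)
  have k3 := han a (e 0) (e 3)
  have k4 := han a (e 2) (e 2)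
  have s1 := hsk a (e 0) (e 1)
  have s2 := hsk a (e 2) (e 3)
  have s3 := hsk a (e 1) (e 2)
  have s4 := hsk a (e 1) (e 3)
  have s5 := hsk a (e 0) (e 2)
  have s6 := hsk a (e 0) (e 3)
  simp only [ha.map0, ha.map2, ha.map3, (h2 _ _).map_smul, (h3 _ _).map_smul, smul_eq_mul]
    at k1 k2 k3 k4
  -- The relation `k4` carries a factor `s`, removed by `s² = 1`. Altogether only `d a e₀ e₂` and `d
  -- a e₀ e₃` stay free for each `a`: eight numbers in all.
  have k5 : s * (s * (d a (e 3) (e 2) - d a (e 2) (e 3))) = 0 := by rw [mul_sub, k4]; ring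
  rw [← mul_assoc, ← pow_two, hs] at k5
  refine ⟨?_, ?_, ?_, ?_, ?_, ?_, ?_, ?_, ?_, ?_⟩ <;> linarith

/-- The twistor equation in an adapted frame, solved for `∇J`. -/
def TwistorRelations (d : E4 → E4 → E4 → ℝ) (w : E4 → ℝ) (s : ℝ) (e : Fin 4 → E4) : Prop :=
  (d (e 0) (e 0) (e 2) = s * w (e 3) ∧ d (e 1) (e 0) (e 2) = w (e 2) ∧
    d (e 2) (e 0) (e 2) = - w (e 1) ∧ d (e 3) (e 0) (e 2) = -s * w (e 0)) ∧
  d (e 0) (e 0) (e 3) = -s * w (e 2) ∧ d (e 1) (e 0) (e 3) = w (e 3) ∧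
    d (e 2) (e 0) (e 3) = s * w (e 0) ∧ d (e 3) (e 0) (e 3) = - w (e 1)

-- The Nijenhuis tensor of an almost complex structure in dimension four has four independent
-- components, and so has a 3-form. Together they give eight linear equations for the eight free
-- components of `∇J`, solved by `TwistorRelations`.
set_option maxHeartbeats 1000000 in
theorem IsHermitianJet.relations_iff (hd : IsHermitianJet J d) (hw : IsLinearMap ℝ w)
    (ha : Adapted B J s e) (hs : s = 1 ∨ s = -1) :
    ((∀ a b c, nijenhuisForm J d a b c = 0) ∧ ∀ a b c, closedForm B J d w a b c = 0) ↔
      TwistorRelations d w s e := by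
  have hs2 : s ^ 2 = 1 := by rcases hs with rfl | rfl <;> norm_num
  have hf := ha.frame
  have l1 : ∀ b c r x, d (r • x) b c = r * d x b c := fun b c r x => (hd.trilin.fst b c).map_smul r x
  have l3 : ∀ b c r x, d b c (r • x) = r * d b c x := fun b c r x => (hd.trilin.trd b c).map_smul r x
  have n1 : ∀ b c x, d (-x) b c = - d x b c := fun b c x => (hd.trilin.fst b c).map_neg x
  have n3 : ∀ b c x, d b c (-x) = - d b c x := fun b c x => (hd.trilin.trd b c).map_neg x
  obtain ⟨cd, c01, c10, c23, c32, c20, c30, c12, c21, c13, c31⟩ := hd.components ha hs2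
  constructor
  · rintro ⟨hN, hC⟩
    -- `N(Ja, b) = -J N(a, b)` leaves only the vector `N(e₀, e₂)` to be examined.
    have N1 := hN (e 0) (e 2) (e 0)
    have N2 := hN (e 0) (e 2) (e 1)
    have N3 := hN (e 0) (e 2) (e 2)
    have N4 := hN (e 0) (e 2) (e 3)
    have C1 := hC (e 0) (e 1) (e 2)
    have C2 := hC (e 0) (e 1) (e 3)
    have C3 := hC (e 0) (e 2) (e 3)
    have C4 := hC (e 1) (e 2) (e 3)
    simp only [nijenhuisForm, closedForm, ha.map0, ha.map1, ha.map2, ha.map3, l1, l3, n3, map_smul,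
      map_neg, smul_apply, neg_apply, smul_eq_mul, hf _ _, cd, c01, c23, c20, c30, c12, c21, c13,
      c31, Fin.reduceEq, if_true, if_false]
      at N1 N2 N3 N4 C1 C2 C3 C4
    rcases hs with rfl | rfl <;> refine ⟨⟨?_, ?_, ?_, ?_⟩, ?_, ?_, ?_, ?_⟩ <;> linarith
  · rintro ⟨⟨R1, R2, R3, R4⟩, R5, R6, R7, R8⟩
    constructor
    · refine hd.isTrilin_nijenhuisForm.eq_zero e fun i j k => ?_
      fin_cases i <;> fin_cases j <;> fin_cases k <;>
      simp only [Fin.zero_eta, Fin.mk_one, Fin.reduceFinMk, nijenhuisForm, ha.map0, ha.map1,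
        ha.map2, ha.map3, l1, l3, n1, n3, cd, c01, c10, c23, c32, c20, c30, c12, c21, c13, c31, R1, R2, R3, R4, R5, R6,
        R7, R8] <;>
      rcases hs with rfl | rfl <;> ring
    · refine (hd.isTrilin_closedForm hw).eq_zero e fun i j k => ?_
      fin_cases i <;> fin_cases j <;> fin_cases k <;>
      simp only [Fin.zero_eta, Fin.mk_one, Fin.reduceFinMk, closedForm, ha.map0, ha.map1,
        ha.map2, ha.map3, map_smul, map_neg, smul_apply, neg_apply, smul_eq_mul, hf _ _,
        cd, c01, c10, c23, c32, c20, c30, c12, c21, c13, c31, R1, R2, R3, R4, R5, R6,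
        R7, R8, Fin.reduceEq, if_true, if_false] <;>
      rcases hs with rfl | rfl <;> ring

theorem IsHermitianJet.isTrilin_killingJet (hd : IsHermitianJet J d) (hw : IsLinearMap ℝ w) :
    IsTrilin (killingJet B J d w) := by
  obtain ⟨⟨h1, h2, h3⟩, -, -⟩ := hd
  refine ⟨fun b c => ⟨fun x y => ?_, fun r x => ?_⟩, fun a c => ⟨fun x y => ?_, fun r x => ?_⟩,
    fun a b => ⟨fun x y => ?_, fun r x => ?_⟩⟩ <;>
  simp only [killingJet, map_add, map_smul, (h1 _ _).map_add, (h2 _ _).map_add,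
    (h3 _ _).map_add, (h1 _ _).map_smul, (h2 _ _).map_smul, (h3 _ _).map_smul, hw.map_add,
    hw.map_smul, add_apply, smul_apply, smul_eq_mul] <;>
  ring

-- The right-hand side is the one of `relations_iff`; this coincidence is the pointwise heart of the
-- correspondence.
set_option maxHeartbeats 1000000 in
theorem IsHermitianJet.twistor_iff (hd : IsHermitianJet J d) (hw : IsLinearMap ℝ w)
    (ha : Adapted B J s e) (hs : s = 1 ∨ s = -1) :
    IsTwistor B (killingJet B J d w) ↔ TwistorRelations d w s e := by
  have hs2 : s ^ 2 = 1 := by rcases hs with rfl | rfl <;> norm_num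
  have hf := ha.frame
  obtain ⟨cd, c01, c10, c23, c32, c20, c30, c12, c21, c13, c31⟩ := hd.components ha hs2
  constructor
  · rintro ⟨τ, hτ, h⟩
    -- The twelve equations with equal first two arguments suffice: eliminating the four components
    -- of `τ` leaves eight.
    have K1 := h (e 0) (e 0) (e 1)
    have K2 := h (e 0) (e 0) (e 2)
    have K3 := h (e 0) (e 0) (e 3)
    have K4 := h (e 1) (e 1) (e 0)
    have K5 := h (e 1) (e 1) (e 2)
    have K6 := h (e 1) (e 1) (e 3)
    have K7 := h (e 2) (e 2) (e 0)
    have K8 := h (e 2) (e 2) (e 1)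
    have K9 := h (e 2) (e 2) (e 3)
    have K10 := h (e 3) (e 3) (e 0)
    have K11 := h (e 3) (e 3) (e 1)
    have K12 := h (e 3) (e 3) (e 2)
    simp only [killingJet, ha.map0, ha.map1, ha.map2, ha.map3,
      map_smul, map_neg, smul_apply, neg_apply, smul_eq_mul, hf _ _, c01, c10, c23, c32, c20, c30,
      c12, c21, c13, c31, Fin.reduceEq, if_true, if_false]
      at K1 K2 K3 K4 K5 K6 K7 K8 K9 K10 K11 K12
    rcases hs with rfl | rfl <;> refine ⟨⟨?_, ?_, ?_, ?_⟩, ?_, ?_, ?_, ?_⟩ <;> linarith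
  · rintro ⟨⟨R1, R2, R3, R4⟩, R5, R6, R7, R8⟩
    -- A third of the divergence: the term with `w` contributes `w (J c)` to the trace, and `∇J`
    -- contributes `2 w (J c)` by the relations.
    refine ⟨fun c => w (J c), ⟨fun x y => ?_, fun r x => ?_⟩, fun a b c => ?_⟩
    · rw [map_add, hw.map_add]
    · rw [map_smul, hw.map_smul]
    rw [← sub_eq_zero]
    have ht := hd.isTrilin_killingJet (B := B) hw
    have wn : ∀ r x, w (r • x) = r * w x := fun r x => hw.map_smul r x
    have wm : ∀ x, w (-x) = - w x := fun x => hw.map_neg x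
    refine IsTrilin.eq_zero (f := fun a b c => killingJet B J d w a b c + killingJet B J d w b a c -
      (2 * B a b * w (J c) - B a c * w (J b) - B b c * w (J a))) ?_ e ?_ a b c
    · obtain ⟨h1, h2, h3⟩ := ht
      refine ⟨fun b c => ⟨fun x y => ?_, fun r x => ?_⟩, fun a c => ⟨fun x y => ?_, fun r x => ?_⟩,
        fun a b => ⟨fun x y => ?_, fun r x => ?_⟩⟩ <;>
      simp only [map_add, map_smul, (h1 _ _).map_add, (h2 _ _).map_add,
        (h3 _ _).map_add, (h1 _ _).map_smul, (h2 _ _).map_smul, (h3 _ _).map_smul, hw.map_add,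
        hw.map_smul, add_apply, smul_apply, smul_eq_mul] <;>
      ring
    · intro i j k
      fin_cases i <;> fin_cases j <;> fin_cases k <;>
      simp only [Fin.zero_eta, Fin.mk_one, Fin.reduceFinMk, killingJet, ha.map0, ha.map1,
        ha.map2, ha.map3, map_smul, map_neg, smul_apply, neg_apply, smul_eq_mul, hf _ _, wn, wm,
        cd, c01, c10, c23, c32, c20, c30, c12, c21, c13, c31, R1, R2, R3, R4, R5, R6,
        R7, R8, Fin.reduceEq, if_true, if_false] <;>
      rcases hs with rfl | rfl <;> ring

/-- The derivative of `Ω⁻¹ κ` has the duality of `κ`. -/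
theorem IsHermitianJet.killingJet_dual (hd : IsHermitianJet J d)
    (ha : Adapted B J s e) (hs : s = 1 ∨ s = -1) (a : E4) :
    killingJet B J d w a (e 0) (e 1) = s * killingJet B J d w a (e 2) (e 3) ∧
    killingJet B J d w a (e 0) (e 2) = s * killingJet B J d w a (e 3) (e 1) ∧
    killingJet B J d w a (e 0) (e 3) = s * killingJet B J d w a (e 1) (e 2) := by
  have hs2 : s ^ 2 = 1 := by rcases hs with rfl | rfl <;> norm_num
  have hf := ha.frame
  obtain ⟨cd, c01, c10, c23, c32, c20, c30, c12, c21, c13, c31⟩ := hd.components ha hs2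
  simp only [killingJet, ha.map0, ha.map1, ha.map2, ha.map3, hf _ _, map_smul, map_neg, smul_apply,
      neg_apply, smul_eq_mul, c01, c23, c12, c31, Fin.reduceEq, if_true, if_false]
  rcases hs with rfl | rfl <;> refine ⟨?_, ?_, ?_⟩ <;> ring

end

/-! ### Hermitian structures in a chart -/

/-- The covariant derivative `(∇_a J) b` of a field of endomorphisms. -/
def chcovEnd (G : E4 → Bil) (J : E4 → E4 →L[ℝ] E4) (y a b : E4) : E4 :=
  fderiv ℝ J y a b + chr G y a (J y b) - J y (chr G y a b)

/-- `g((∇_a J) b, c)`. -/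
def chJet (G : E4 → Bil) (J : E4 → E4 →L[ℝ] E4) (y a b c : E4) : ℝ :=
  G y (chcovEnd G J y a b) c

theorem chr_isLinearMap_left (G : E4 → Bil) (y b : E4) : IsLinearMap ℝ fun a => chr G y a b := by
  refine ⟨fun u v => ?_, fun r u => ?_⟩
  · rw [chr, chr, chr, ← map_add]
    congr 1
    ext c
    simp only [add_apply, chrLower_apply, map_add]
    ring
  · rw [chr, chr, ← map_smul]
    congr 1
    ext c
    simp only [smul_apply, chrLower_apply, map_smul, smul_eq_mul]
    ring

theorem chr_isLinearMap_right (G : E4 → Bil) (y a : E4) : IsLinearMap ℝ fun b => chr G y a b := by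
  refine ⟨fun u v => ?_, fun r u => ?_⟩
  · rw [chr, chr, chr, ← map_add]
    congr 1
    ext c
    simp only [add_apply, chrLower_apply, map_add]
    ring
  · rw [chr, chr, ← map_smul]
    congr 1
    ext c
    simp only [smul_apply, chrLower_apply, map_smul, smul_eq_mul]
    ring

theorem isTrilin_chcov (G T : E4 → Bil) (y : E4) : IsTrilin (chcov G T y) := by
  have h1 := chr_isLinearMap_left G y
  have h2 := chr_isLinearMap_right G y
  refine ⟨fun b c => ⟨fun x y => ?_, fun r x => ?_⟩, fun a c => ⟨fun x y => ?_, fun r x => ?_⟩,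
    fun a b => ⟨fun x y => ?_, fun r x => ?_⟩⟩ <;>
  simp only [chcov, map_add, map_smul, (h1 _).map_add, (h2 _).map_add, (h1 _).map_smul,
    (h2 _).map_smul, add_apply, smul_apply, smul_eq_mul] <;>
  ring

theorem isTrilin_chJet (G : E4 → Bil) (J : E4 → E4 →L[ℝ] E4) (y : E4) :
    IsTrilin (chJet G J y) := by
  have h1 := chr_isLinearMap_left G y
  have h2 := chr_isLinearMap_right G y
  refine ⟨fun b c => ⟨fun x y => ?_, fun r x => ?_⟩, fun a c => ⟨fun x y => ?_, fun r x => ?_⟩,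
    fun a b => ⟨fun x y => ?_, fun r x => ?_⟩⟩ <;>
  simp only [chJet, chcovEnd, map_add, map_sub, map_smul, (h1 _).map_add, (h2 _).map_add,
    (h1 _).map_smul, (h2 _).map_smul, add_apply, sub_apply, smul_apply, smul_eq_mul] <;>
  ring

section

variable {G : E4 → Bil} {J : E4 → E4 →L[ℝ] E4} {y : E4}

/-- Derivative of `f κ`. -/
theorem fderiv_smul_fundamental (hG : DifferentiableAt ℝ G y) (hs : ∀ᶠ z in 𝓝 y, IsInner (G z))
    (hJ : DifferentiableAt ℝ J y) {f : E4 → ℝ} (hf : DifferentiableAt ℝ f y) {F : E4 → Bil}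
    (hF : ∀ᶠ z in 𝓝 y, F z = f z • (G z).comp (J z)) (a b c : E4) :
    fderiv ℝ F y a b c = fderiv ℝ f y a * G y (J y b) c + f y * (chJet G J y a b c +
      G y (J y (chr G y a b)) c + G y (J y b) (chr G y a c)) := by
  have h1 := (hf.hasFDerivAt.fun_smul (hG.hasFDerivAt.clm_comp hJ.hasFDerivAt))
  have h2 := (h1.congr_of_eventuallyEq hF).fderiv
  rw [h2]
  have h3 := fderiv_metric hG hs a (J y b) c
  simp [chJet, chcovEnd, h3]
  ring

/-- Metricity absorbs the Christoffel terms, and the derivative of `Ω⁻¹` contributes `-Ω⁻¹ d log Ω`;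
what remains is the algebraic `killingJet`. -/
theorem chcov_smul_fundamental (hG : DifferentiableAt ℝ G y) (hs : ∀ᶠ z in 𝓝 y, IsInner (G z))
    (hJ : DifferentiableAt ℝ J y) {f : E4 → ℝ} (hf : DifferentiableAt ℝ f y) (hf0 : f y ≠ 0)
    {F : E4 → Bil}
    (hF : ∀ᶠ z in 𝓝 y, F z = (f z)⁻¹ • (G z).comp (J z)) (a b c : E4) :
    chcov G F y a b c =
      (f y)⁻¹ * killingJet (G y) (J y) (chJet G J y) (fun v => fderiv ℝ f y v / f y) a b c := by
  have hfi : HasFDerivAt (fun z => (f z)⁻¹) (-((f y) ^ 2)⁻¹ • fderiv ℝ f y) y :=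
    (hasDerivAt_inv hf0).comp_hasFDerivAt y hf.hasFDerivAt
  rw [chcov, fderiv_smul_fundamental hG hs hJ hfi.differentiableAt hF, hfi.fderiv,
    hF.self_of_nhds, killingJet]
  simp
  field_simp
  ring

/-- For a torsion-free connection the Christoffel terms cancel in the cyclic sum, so partial
derivatives may be replaced by covariant ones. -/
theorem extDeriv_smul_fundamental (hG : DifferentiableAt ℝ G y) (hs : ∀ᶠ z in 𝓝 y, IsInner (G z))
    (hJ : DifferentiableAt ℝ J y) {f : E4 → ℝ} (hf : DifferentiableAt ℝ f y) (hf0 : f y ≠ 0)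
    (hsk : ∀ b c, G y (J y b) c = - G y b (J y c)) {F : E4 → Bil}
    (hF : ∀ᶠ z in 𝓝 y, F z = (f z ^ 2) • (G z).comp (J z)) (a b c : E4) :
    fderiv ℝ F y a b c + fderiv ℝ F y b c a + fderiv ℝ F y c a b =
      f y ^ 2 * closedForm (G y) (J y) (chJet G J y) (fun v => fderiv ℝ f y v / f y) a b c := by
  have hfi : HasFDerivAt (fun z => f z ^ 2) ((2 * f y) • fderiv ℝ f y) y :=
    (hf.hasFDerivAt.pow 2).congr_fderiv (by ext; simp)
  have hsym := hs.self_of_nhds.symm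
  have hc := chr_symm hG (hs.mono fun z hz => hz.symm)
  have hsk' : ∀ b c, G y (J y b) c = - G y (J y c) b := fun b c => by rw [hsk, hsym]
  rw [fderiv_smul_fundamental hG hs hJ hfi.differentiableAt hF,
    fderiv_smul_fundamental hG hs hJ hfi.differentiableAt hF,
    fderiv_smul_fundamental hG hs hJ hfi.differentiableAt hF, hfi.fderiv, closedForm,
    hsk' (chr G y a b), hsk' (chr G y b c), hsk' (chr G y c a), hc b a, hc c b, hc a c]
  simp only [smul_apply, smul_eq_mul]
  field_simp
  ring

/-- Differentiating `J² = -1` and `g(Jv, w) = -g(v, Jw)`, with `∇g = 0`, gives the two algebraic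
identities. -/
theorem isHermitianJet_chJet (hG : DifferentiableAt ℝ G y) (hs : ∀ᶠ z in 𝓝 y, IsInner (G z))
    (hJ : DifferentiableAt ℝ J y) (hsq : ∀ᶠ z in 𝓝 y, ∀ v, J z (J z v) = -v)
    (hc : ∀ᶠ z in 𝓝 y, ∀ v w, G z (J z v) (J z w) = G z v w) :
    IsHermitianJet (J y) (chJet G J y) := by
  have hi := hs.self_of_nhds
  have hsk : ∀ᶠ z in 𝓝 y, ∀ v w, G z (J z v) w = - G z v (J z w) := by
    filter_upwards [hsq, hc] with z h1 h2
    exact IsInner.skew_of_compatible h1 h2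
  have hd1 : ∀ a b, fderiv ℝ J y a (J y b) + J y (fderiv ℝ J y a b) = 0 := by
    intro a b
    have e1 := hJ.hasFDerivAt.clm_apply (hJ.hasFDerivAt.clm_apply (hasFDerivAt_const b y))
    have e2 := (hasFDerivAt_const (𝕜 := ℝ) (-b) y).congr_of_eventuallyEq (hsq.mono fun z hz => hz b)
    have := congrArg (fun L : E4 →L[ℝ] E4 => L a) (e1.unique e2)
    simp at this
    rw [add_comm]
    exact this
  have hd2 : ∀ a b c, fderiv ℝ G y a (J y b) c + G y (fderiv ℝ J y a b) c =
      - (fderiv ℝ G y a b (J y c) + G y b (fderiv ℝ J y a c)) := by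
    intro a b c
    have e1 : HasFDerivAt (fun z => G z (J z b) c) _ y :=
      (hG.hasFDerivAt.clm_apply (hJ.hasFDerivAt.clm_apply (hasFDerivAt_const b y))).clm_apply
        (hasFDerivAt_const c y)
    have e2 : HasFDerivAt (fun z => - G z b (J z c)) _ y :=
      ((hG.hasFDerivAt.clm_apply (hasFDerivAt_const b y)).clm_apply
        (hJ.hasFDerivAt.clm_apply (hasFDerivAt_const c y))).neg
    have := congrArg (fun L : E4 →L[ℝ] ℝ => L a)
      (e1.unique (e2.congr_of_eventuallyEq (hsk.mono fun z hz => hz b c)))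
    simp at this
    linarith
  refine ⟨isTrilin_chJet G J y, fun a b c => ?_, fun a b c => ?_⟩
  · have h1 := hd2 a b c
    rw [fderiv_metric hG hs, fderiv_metric hG hs] at h1
    have h2 := hsk.self_of_nhds (chr G y a b) c
    have h3 := hsk.self_of_nhds b (chr G y a c)
    simp only [chJet, chcovEnd, map_add, map_sub, add_apply, sub_apply]
    rw [hi.symm (fderiv ℝ J y a c), hi.symm (chr G y a (J y c)), hi.symm (J y (chr G y a c)) b]
    linarith
  · have h1 := congrArg (fun v => G y v c) (hd1 a b)
    simp only [map_add, add_apply, map_zero, zero_apply] at h1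
    have h2 := hsk.self_of_nhds (fderiv ℝ J y a b) c
    have h3 := hsk.self_of_nhds (chr G y a (J y b)) c
    have h4 := hsk.self_of_nhds (J y (chr G y a b)) c
    have h5 := hsq.self_of_nhds
    have h6 := (chr_isLinearMap_right G y a).map_neg b
    simp only [chJet, chcovEnd, h6, map_add, map_sub, add_apply, sub_apply, h5, map_neg, neg_apply]
      at h4 ⊢
    linarith

/-- Symmetry of the Christoffel symbols makes them cancel when `∂J` is replaced by `∇J`. -/
theorem nijenhuis_chJet (hG : DifferentiableAt ℝ G y) (hs : ∀ᶠ z in 𝓝 y, IsInner (G z))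
    (hsk : ∀ v w, G y (J y v) w = - G y v (J y w)) (a b c : E4) :
    G y (fderiv ℝ J y (J y a) b - fderiv ℝ J y (J y b) a + J y (fderiv ℝ J y b a)
      - J y (fderiv ℝ J y a b)) c = nijenhuisForm (J y) (chJet G J y) a b c := by
  have hc := chr_symm hG (hs.mono fun z hz => hz.symm)
  have h1 := hsk (chr G y b (J y a)) c
  have h2 := hsk (chr G y a (J y b)) c
  have h4 := hsk (fderiv ℝ J y b a) c
  have h5 := hsk (fderiv ℝ J y a b) c
  simp only [nijenhuisForm, chJet, chcovEnd, map_add, map_sub, add_apply, sub_apply]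
  rw [hc (J y a) b, hc (J y b) a, hc b a, hc (J y b) (J y a)]
  linarith

end

/-! ### Conformal almost Hermitian structures -/

theorem hodgeDual_iff {g : Metric M} {o : ManifoldOrientation M} {s : ℝ} {p : M} {F : Bil} :
    HodgeDual g o s p F ↔ ∀ e : Module.Basis (Fin 4) ℝ E4, IsFrame (bilinAt g.inner p) e →
      e.orientation = o.orient p → DualIn s F e := Iff.rfl

theorem continuousAt_symm_chart (p : M) :
    ContinuousAt (extChartAt (𝓡 4) p).symm (extChartAt (𝓡 4) p p) :=
  continuousAt_extChartAt_symm p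

theorem eventually_chart {p : M} {P : M → Prop} (h : ∀ᶠ q in 𝓝 p, P q) :
    ∀ᶠ z in 𝓝 (extChartAt (𝓡 4) p p), P ((extChartAt (𝓡 4) p).symm z) := by
  have := continuousAt_symm_chart p
  unfold ContinuousAt at this
  rw [(extChartAt (𝓡 4) p).left_inv (mem_extChartAt_source p)] at this
  exact this.eventually h

theorem eventually_chart_source (p : M) : ∀ᶠ z in 𝓝 (extChartAt (𝓡 4) p p),
    (extChartAt (𝓡 4) p).symm z ∈ (chartAt E4 p).source :=
  eventually_chart ((chartAt E4 p).open_source.mem_nhds (mem_chart_source E4 p))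

theorem coordMap_localEnd (J : EndField M) {p : M} {y : E4}
    (hy : (extChartAt (𝓡 4) p).symm y ∈ (chartAt E4 p).source) (v : E4) :
    coordMap p ((extChartAt (𝓡 4) p).symm y) (localEnd J p y v) =
      endAt J ((extChartAt (𝓡 4) p).symm y) (coordMap p ((extChartAt (𝓡 4) p).symm y) v) := by
  set q := (extChartAt (𝓡 4) p).symm y with hq
  have hb : q ∈ (trivializationAt E4 (fun x : M => TangentSpace (𝓡 4) x) p).baseSet := hy
  exact Bundle.Trivialization.symmL_continuousLinearMapAt (R := ℝ)
    (trivializationAt E4 (fun x : M => TangentSpace (𝓡 4) x) p) hb (J q (coordVec p q v))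

theorem localEnd_self (J : EndField M) (p : M) :
    localEnd J p (extChartAt (𝓡 4) p p) = endAt J p := by
  ext1 v
  have h := coordMap_localEnd J (p := p) (y := extChartAt (𝓡 4) p p)
    (by rw [(extChartAt (𝓡 4) p).left_inv (mem_extChartAt_source p)]; exact mem_chart_source E4 p) v
  rw [(extChartAt (𝓡 4) p).left_inv (mem_extChartAt_source p), coordMap_self] at h
  exact h

/-- A nowhere zero function and an orthogonal almost complex structure, of the orientation given by
`s`, on an open set. -/
structure IsConformalHermitianOn (g : Metric M) (o : ManifoldOrientation M) (s : ℝ)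
    (U : Set M) (Ω : M → ℝ) (J : EndField M) : Prop where
  isOpen : IsOpen U
  smooth : ContMDiffOn (𝓡 4) 𝓘(ℝ) ∞ Ω U
  ne_zero : ∀ p ∈ U, Ω p ≠ 0
  smoothEnd : SmoothEndOn J U
  sq : ∀ p ∈ U, ∀ v : E4, endAt J p (endAt J p v) = -v
  compatible : ∀ p ∈ U, ∀ v w : E4,
    bilinAt g.inner p (endAt J p v) (endAt J p w) = bilinAt g.inner p v w
  oriented : ∀ p ∈ U, HodgeDual g o s p (fundamentalForm g.inner J p)

theorem IsConformallyKahlerOn.isConformalHermitianOn {g : Metric M} {o : ManifoldOrientation M}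
    {s : ℝ} {U : Set M} {Ω : M → ℝ} {J : EndField M} (h : IsConformallyKahlerOn g o s U Ω J)
    (hU : IsOpen U) : IsConformalHermitianOn g o s U Ω J := by
  refine ⟨hU, h.smooth, h.ne_zero, h.kahler.smooth, h.kahler.sq, fun p hp v w => ?_, h.oriented⟩
  have h1 : Ω p ^ 2 * bilinAt g.inner p (endAt J p v) (endAt J p w) =
    Ω p ^ 2 * bilinAt g.inner p v w := h.kahler.compatible p hp v w
  exact mul_left_cancel₀ (pow_ne_zero 2 (h.ne_zero p hp)) h1

/-- The covariant derivative `∇_a T` as a bilinear form. -/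
def covBil (g : Metric M) (T : BilinField M) (p : M) (a : E4) : Bil :=
  LinearMap.toContinuousLinearMap
    ((LinearMap.toContinuousLinearMap : (E4 →ₗ[ℝ] ℝ) ≃ₗ[ℝ] (E4 →L[ℝ] ℝ)).toLinearMap ∘ₗ
      LinearMap.mk₂ ℝ (fun b c : E4 => chcov (localBilin g.inner p) (localBilin T p)
        (extChartAt (𝓡 4) p p) a b c)
        (fun _ _ _ => ((isTrilin_chcov _ _ _).snd _ _).map_add _ _)
        (fun _ _ _ => ((isTrilin_chcov _ _ _).snd _ _).map_smul _ _)
        (fun _ _ _ => ((isTrilin_chcov _ _ _).trd _ _).map_add _ _)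
        (fun _ _ _ => ((isTrilin_chcov _ _ _).trd _ _).map_smul _ _))

theorem covBil_apply (g : Metric M) (T : BilinField M) (p : M) (a b c : E4) :
    covBil g T p a b c = covDeriv g T p a b c := by
  rw [covDeriv_eq_chcov]
  rfl

theorem isTrilin_covBil (g : Metric M) (T : BilinField M) (p : M) :
    IsTrilin fun a b c => covBil g T p a b c := by
  simp only [covBil_apply, covDeriv_eq_chcov]
  exact isTrilin_chcov _ _ _

theorem smooth_differentiableAt {F : Type*} [NormedAddCommGroup F] [NormedSpace ℝ F] {f : E4 → F}
    {y : E4} (h : ContDiffAt ℝ ∞ f y) : DifferentiableAt ℝ f y :=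
  h.differentiableAt (by simp)

theorem localMetric_differentiableAt (g : Metric M) (p : M) :
    DifferentiableAt ℝ (localBilin g.inner p) (extChartAt (𝓡 4) p p) :=
  smooth_differentiableAt (smoothBilin_iff.1 g.contMDiff p)

/-- Conformal Hermitian structures at a point: the Kähler conditions amount to the twistor equation
of the Killing form, and the derivative of the Killing form has the duality of `κ`. -/
theorem IsConformalHermitianOn.twistor_iff {g : Metric M} {o : ManifoldOrientation M} {s : ℝ}
    {U : Set M} {Ω : M → ℝ} {J : EndField M} (h : IsConformalHermitianOn g o s U Ω J)
    (hs : s = 1 ∨ s = -1) {Z : BilinField M} (hZ : ∀ p ∈ U, Z p = killingForm g Ω J p) {p : M}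
    (hp : p ∈ U) :
    (((∀ v w, nijenhuis J p v w = 0) ∧
      ∀ u v w, extDeriv2 (fundamentalForm (conformalMetric g Ω) J) p u v w = 0) ↔
      IsTwistor (bilinAt g.inner p) fun a b c => covBil g Z p a b c) ∧
    ∃ e : Module.Basis (Fin 4) ℝ E4, IsFrame (bilinAt g.inner p) e ∧ e.orientation = o.orient p ∧
      ∀ a, DualIn s (covBil g Z p a) e := by
  set y := extChartAt (𝓡 4) p p with hy
  set G := localBilin g.inner p with hGdef
  set Jl := localEnd J p with hJl
  set Om := Ω ∘ (extChartAt (𝓡 4) p).symm with hOm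
  have hG : DifferentiableAt ℝ G y := localMetric_differentiableAt g p
  have hi : ∀ᶠ z in 𝓝 y, IsInner (G z) := eventually_localMetric_isInner g p
  have hJ : DifferentiableAt ℝ Jl y :=
    smooth_differentiableAt ((smoothEndOn_iff h.isOpen).1 h.smoothEnd p hp)
  have hΩ : DifferentiableAt ℝ Om y :=
    smooth_differentiableAt ((contMDiffOn_scalar_iff h.isOpen).1 h.smooth p hp)
  have hsource := eventually_chart_source p
  have hU : ∀ᶠ z in 𝓝 y, (extChartAt (𝓡 4) p).symm z ∈ U :=
    eventually_chart (h.isOpen.mem_nhds hp)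
  have hyp : (extChartAt (𝓡 4) p).symm y = p :=
    (extChartAt (𝓡 4) p).left_inv (mem_extChartAt_source p)
  have hOmy : Om y = Ω p := by rw [hOm, Function.comp_apply, hyp]
  have hΩ0 : Om y ≠ 0 := hOmy ▸ h.ne_zero p hp
  have hsq : ∀ᶠ z in 𝓝 y, ∀ v, Jl z (Jl z v) = -v := by
    filter_upwards [hsource, hU] with z hz hzU v
    refine coordMap_injective hz ?_
    rw [coordMap_localEnd J hz, coordMap_localEnd J hz, h.sq _ hzU, map_neg]
  have hc : ∀ᶠ z in 𝓝 y, ∀ v w, G z (Jl z v) (Jl z w) = G z v w := by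
    filter_upwards [hsource, hU] with z hz hzU v w
    rw [hGdef, localBilin_apply, localBilin_apply, coordMap_localEnd J hz, coordMap_localEnd J hz,
      h.compatible _ hzU]
  have hGy : G y = bilinAt g.inner p := localBilin_self _ p
  have hJy : Jl y = endAt J p := localEnd_self J p
  have hd := isHermitianJet_chJet hG hi hJ hsq hc
  have hsk : ∀ v w, G y (Jl y v) w = - G y v (Jl y w) :=
    IsInner.skew_of_compatible hsq.self_of_nhds hc.self_of_nhds
  set w : E4 → ℝ := fun v => fderiv ℝ Om y v / Om y with hw
  have hwl : IsLinearMap ℝ w := ⟨fun u v => by rw [hw]; simp only [map_add]; ring,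
    fun r u => by rw [hw]; simp only [map_smul, smul_eq_mul]; ring⟩
  obtain ⟨e, ha, heo⟩ := exists_adapted (metric_isInner g p) (h.sq p hp) (h.compatible p hp) hs
    (o.orient p) (hodgeDual_iff.1 (h.oriented p hp))
  have ha' : Adapted (G y) (Jl y) s e := by rw [hGy, hJy]; exact ha
  have hZl : ∀ᶠ z in 𝓝 y, localBilin Z p z = (Om z)⁻¹ • (G z).comp (Jl z) := by
    filter_upwards [hsource, hU] with z hz hzU
    ext a b
    rw [localBilin_apply, bilinAt, hZ _ hzU]
    simp only [smul_apply, ContinuousLinearMap.comp_apply]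
    rw [hGdef, localBilin_apply, coordMap_localEnd J hz]
    rfl
  have hFl : ∀ᶠ z in 𝓝 y, localBilin (fundamentalForm (conformalMetric g Ω) J) p z =
      (Om z ^ 2) • (G z).comp (Jl z) := by
    filter_upwards [hsource, hU] with z hz hzU
    ext a b
    rw [localBilin_apply]
    simp only [smul_apply, ContinuousLinearMap.comp_apply]
    rw [hGdef, localBilin_apply, coordMap_localEnd J hz]
    rfl
  have hcov : ∀ a b c, covBil g Z p a b c =
      (Om y)⁻¹ * killingJet (G y) (Jl y) (chJet G Jl y) w a b c := fun a b c => by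
    rw [covBil_apply, covDeriv_eq_chcov]
    exact chcov_smul_fundamental hG hi hJ hΩ hΩ0 hZl a b c
  have hext : ∀ a b c : E4, extDeriv2 (fundamentalForm (conformalMetric g Ω) J) p a b c =
      Om y ^ 2 * closedForm (G y) (Jl y) (chJet G Jl y) w a b c := fun a b c =>
    extDeriv_smul_fundamental hG hi hJ hΩ hΩ0 hsk hFl a b c
  have hnij : ∀ a b c : E4, G y (nijenhuis J p a b) c =
      nijenhuisForm (Jl y) (chJet G Jl y) a b c := fun a b c => by
    rw [← nijenhuis_chJet hG hi hsk a b c, hJy]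
    rfl
  refine ⟨?_, e, ha.frame, heo, fun a => ?_⟩
  · have e1 : (∀ v w, nijenhuis J p v w = 0) ↔
        ∀ a b c, nijenhuisForm (Jl y) (chJet G Jl y) a b c = 0 := by
      constructor
      · intro hN a b c
        rw [← hnij, show nijenhuis J p a b = (0 : E4) from hN a b]
        simp
      · intro hN a b
        refine hi.self_of_nhds.ext fun c => ?_
        refine (hnij a b c).trans ((hN a b c).trans ?_)
        exact (congrArg (fun L : E4 →L[ℝ] ℝ => L c) (map_zero (G y))).symm
    have e2 : (∀ u v w, extDeriv2 (fundamentalForm (conformalMetric g Ω) J) p u v w = 0) ↔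
        ∀ a b c, closedForm (G y) (Jl y) (chJet G Jl y) w a b c = 0 := by
      constructor
      · intro hC a b c
        have := hext a b c
        rw [hC a b c] at this
        exact (mul_eq_zero.1 this.symm).resolve_left (pow_ne_zero 2 hΩ0)
      · intro hC a b c
        exact (hext a b c).trans (by rw [hC a b c, mul_zero])
    -- The twistor equation is homogeneous, so the nonzero factor `Ω⁻¹` only rescales `τ`.
    have e3 : (IsTwistor (bilinAt g.inner p) fun a b c => covBil g Z p a b c) ↔
        IsTwistor (G y) (killingJet (G y) (Jl y) (chJet G Jl y) w) := by
      rw [← hGy]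
      constructor
      · rintro ⟨τ, hτ, h1⟩
        refine ⟨fun c => Om y * τ c, ⟨fun u v => by rw [hτ.map_add]; ring,
          fun r u => by rw [hτ.map_smul]; simp only [smul_eq_mul]; ring⟩, fun a b c => ?_⟩
        have h2 := h1 a b c
        simp only [hcov] at h2
        field_simp at h2
        linarith
      · rintro ⟨τ, hτ, h1⟩
        refine ⟨fun c => (Om y)⁻¹ * τ c, ⟨fun u v => by rw [hτ.map_add]; ring,
          fun r u => by rw [hτ.map_smul]; simp only [smul_eq_mul]; ring⟩, fun a b c => ?_⟩
        have h2 := h1 a b c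
        simp only [hcov]
        linear_combination (Om y)⁻¹ * h2
    rw [e1, e2, e3, hd.relations_iff hwl ha' hs, hd.twistor_iff hwl ha' hs]
  · obtain ⟨d1, d2, d3⟩ := hd.killingJet_dual (w := w) ha' hs a
    simp only [DualIn, hcov, d1, d2, d3]
    refine ⟨?_, ?_, ?_⟩ <;> ring

instance : NormedAddCommGroup Bil := ContinuousLinearMap.toNormedAddCommGroup

instance : NormedSpace ℝ Bil := ContinuousLinearMap.toNormedSpace

instance : NormedAddCommGroup (E4 →L[ℝ] Bil) := ContinuousLinearMap.toNormedAddCommGroup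

instance : NormedSpace ℝ (E4 →L[ℝ] Bil) := ContinuousLinearMap.toNormedSpace

/-! ### Smoothness of covariant derivatives -/

theorem contDiffAt_inverse {G : E4 → Bil} {y : E4} (hG : ContDiffAt ℝ ∞ G y) (hi : IsInner (G y)) :
    ContDiffAt ℝ ∞ (fun z => (G z).inverse) y := by
  obtain ⟨e, he⟩ := hi.isInvertible
  have := contDiffAt_map_inverse (n := ∞) (𝕜 := ℝ) e
  rw [he] at this
  exact this.comp y hG

theorem contDiffAt_chr {G : E4 → Bil} {y : E4} (hG : ContDiffAt ℝ ∞ G y) (hi : IsInner (G y))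
    (a b : E4) : ContDiffAt ℝ ∞ (fun z => chr G z a b) y := by
  have h1 : ContDiffAt ℝ ∞ (fderiv ℝ G) y := hG.fderiv_right (by simp)
  have h2 : ContDiffAt ℝ ∞ (fun z => (G z).inverse) y := contDiffAt_inverse hG hi
  have h3 : ContDiffAt ℝ ∞ (fun z => ((fderiv ℝ G z).flip a).flip b) y := by
    have e1 : ContDiffAt ℝ ∞ (fun z => (fderiv ℝ G z).flip a) y :=
      ((ContinuousLinearMap.flipₗᵢ ℝ E4 E4 (E4 →L[ℝ] ℝ)).contDiff.contDiffAt.comp y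
        h1).clm_apply contDiffAt_const
    exact ((ContinuousLinearMap.flipₗᵢ ℝ E4 E4 ℝ).contDiff.contDiffAt.comp y
        e1).clm_apply contDiffAt_const
  have h4 : ∀ u v, ContDiffAt ℝ ∞ (fun z => fderiv ℝ G z u v) y := fun u v =>
    (h1.clm_apply contDiffAt_const).clm_apply contDiffAt_const
  have h5 : ContDiffAt ℝ ∞ (fun z => chrLower G z a b) y :=
    (((h4 a b).add (h4 b a)).sub h3).const_smul (1 / 2 : ℝ)
  exact h2.clm_apply h5

theorem contDiffAt_chcov {G T : E4 → Bil} {y : E4} (hG : ContDiffAt ℝ ∞ G y) (hi : IsInner (G y))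
    (hT : ContDiffAt ℝ ∞ T y) (a b c : E4) : ContDiffAt ℝ ∞ (fun z => chcov G T z a b c) y := by
  have h1 : ContDiffAt ℝ ∞ (fderiv ℝ T) y := hT.fderiv_right (by simp)
  refine ContDiffAt.sub (ContDiffAt.sub ?_ ?_) ?_
  · exact ((h1.clm_apply contDiffAt_const).clm_apply contDiffAt_const).clm_apply contDiffAt_const
  · exact (hT.clm_apply (contDiffAt_chr hG hi a b)).clm_apply contDiffAt_const
  · exact (hT.clm_apply contDiffAt_const).clm_apply (contDiffAt_chr hG hi a c)

/-- Linear first-order conditions extend from dense sets. -/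
theorem covDeriv_eq_zero_of_dense (g : Metric M) {T : BilinField M} (hT : SmoothBilin T) (r : ℝ)
    {D : Set M} (hD : Dense D)
    (h : ∀ q ∈ D, ∀ a b c, covBil g T q a b c + r * covBil g T q b a c = 0) (p : M) (a b c : E4) :
    covBil g T p a b c + r * covBil g T p b a c = 0 := by
  -- Read in one fixed chart with constant `a, b, c`, the condition is the vanishing of a continuous
  -- function. The cases `r = 1` (Killing–Yano) and `r = 0` (parallel) are the ones needed.
  set f : E4 → ℝ := fun z => chcov (localBilin g.inner p) (localBilin T p) z a b c +
    r * chcov (localBilin g.inner p) (localBilin T p) z b a c with hf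
  have hfc : ContinuousAt f (extChartAt (𝓡 4) p p) := by
    have hG := smoothBilin_iff.1 g.contMDiff p
    have hi := (eventually_localMetric_isInner g p).self_of_nhds
    have hT' := smoothBilin_iff.1 hT p
    exact (contDiffAt_chcov hG hi hT' a b c).continuousAt.add
      (continuousAt_const.mul (contDiffAt_chcov hG hi hT' b a c).continuousAt)
  have hc : ContinuousAt (fun q => f (extChartAt (𝓡 4) p q)) p :=
    ContinuousAt.comp (g := f) hfc (continuousAt_extChartAt p)
  have hfreq : ∃ᶠ q in 𝓝 p, f (extChartAt (𝓡 4) p q) ∈ ({0} : Set ℝ) := by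
    have h1 : ∃ᶠ q in 𝓝 p, q ∈ D := mem_closure_iff_frequently.1 (hD p)
    have h2 : ∀ᶠ q in 𝓝 p, q ∈ (chartAt E4 p).source :=
      (chartAt E4 p).open_source.mem_nhds (mem_chart_source E4 p)
    refine (h1.and_eventually h2).mono ?_
    rintro q ⟨hq, hq'⟩
    have := h q hq (coordMap p q a) (coordMap p q b) (coordMap p q c)
    rw [covBil_apply, covBil_apply, covDeriv_coordMap g hT hq', covDeriv_coordMap g hT hq'] at this
    exact this
  have h0 : f (extChartAt (𝓡 4) p p) = 0 :=
    isClosed_singleton.mem_of_frequently_of_tendsto hfreq hc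
  rw [covBil_apply, covBil_apply, covDeriv_eq_chcov, covDeriv_eq_chcov]
  exact h0

theorem localBilin_sub (T S : BilinField M) (p : M) :
    localBilin (fun q => T q - S q) p = fun y => localBilin T p y - localBilin S p y := by
  ext y a b
  rfl

theorem covBil_sub (g : Metric M) {T S : BilinField M} (hT : SmoothBilin T) (hS : SmoothBilin S)
    (p : M) (a b c : E4) :
    covBil g (fun q => T q - S q) p a b c = covBil g T p a b c - covBil g S p a b c := by
  have h1 := smooth_differentiableAt (smoothBilin_iff.1 hT p)
  have h2 := smooth_differentiableAt (smoothBilin_iff.1 hS p)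
  simp only [covBil_apply, covDeriv_eq_chcov, localBilin_sub, chcov, fderiv_fun_sub h1 h2,
    sub_apply]
  ring

theorem SmoothBilin.sub {T S : BilinField M} (hT : SmoothBilin T) (hS : SmoothBilin S) :
    SmoothBilin fun q => T q - S q := by
  rw [smoothBilin_iff] at *
  intro p
  rw [localBilin_sub]
  exact (hT p).sub (hS p)

theorem IsTwoForm.sub {T S : BilinField M} (hT : IsTwoForm T) (hS : IsTwoForm S) :
    IsTwoForm fun q => T q - S q := by
  refine ⟨fun p v => ?_, hT.smooth.sub hS.smooth⟩
  have h1 := hT.alternating p v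
  have h2 := hS.alternating p v
  rw [sub_apply, sub_apply, h1, h2, sub_zero]

/-- The derivative of a field with a symmetry has the same symmetry. -/
theorem covBil_alternating (g : Metric M) {T : BilinField M} (hT : IsTwoForm T) (p : M) (a v : E4) :
    covBil g T p a v v = 0 := by
  have h1 := smooth_differentiableAt (smoothBilin_iff.1 hT.smooth p)
  have hs : ∀ z, ∀ a b, localBilin T p z a b = (-1) * localBilin T p z b a := by
    intro z a b
    rw [neg_one_mul]
    exact skew_of_alternating (F := localBilin T p z) (fun v => hT.alternating _ _) a b
  have h2 := fderiv_symm_of_eventually h1 (Filter.Eventually.of_forall hs) a v v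
  have h3 := hs (extChartAt (𝓡 4) p p) v (chr (localBilin g.inner p) (extChartAt (𝓡 4) p p) a v)
  rw [covBil_apply, covDeriv_eq_chcov, chcov, h3]
  linarith

/-! ### The trace of a covariant derivative -/

/-- Contraction with the inverse metric is the trace over any orthonormal frame, since `∑ gⁱʲ
(e_k)_i (e_l)_j = δ_kl` (`hinv`). -/
theorem hamiltonian_frame (g : Metric M) (Z : BilinField M) (p : M)
    {e : Module.Basis (Fin 4) ℝ E4} (he : IsFrame (bilinAt g.inner p) e) (c : E4) :
    hamiltonian g Z p c = -(1 / 3) * ∑ i, covBil g Z p (e i) (e i) c := by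
  set B := bilinAt g.inner p with hB
  have hi := metric_isInner g p
  have htri := isTrilin_covBil g Z p
  have hexp : ∀ u v, covBil g Z p u v c =
      ∑ k, ∑ l, B (e k) u * B (e l) v * covBil g Z p (e k) (e l) c := by
    intro u v
    have e1 : covBil g Z p u v c = ∑ k, B (e k) u * covBil g Z p (e k) v c := by
      conv_lhs => rw [he.expand u]
      have := map_sum (htri.fst v c).mk' (fun j => B (e j) u • e j) Finset.univ
      simp only [IsLinearMap.mk'_apply, (htri.fst v c).map_smul, smul_eq_mul] at this
      exact this
    rw [e1]
    refine Finset.sum_congr rfl fun k _ => ?_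
    conv_lhs => rw [he.expand v]
    simp only [map_sum, map_smul, sum_apply, smul_apply, smul_eq_mul, Finset.mul_sum]
    exact Finset.sum_congr rfl fun l _ => by ring
  have hinv : ∀ k l, ∑ i, ∑ j, invMetric g p i j * (B (e k) (stdBasis i) * B (e l) (stdBasis j)) =
      if k = l then 1 else 0 := by
    intro k l
    have h1 := sum_coord_inverse (bilinAt g.inner p).inverse (B (e l))
    have h2 : (bilinAt g.inner p).inverse (B (e l)) = e l :=
      hi.ext fun c => by rw [hi.apply_inverse]
    rw [h2] at h1
    rw [← he k l]
    conv_rhs => rw [← h1]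
    simp only [map_sum, map_smul, smul_eq_mul, ← invMetric_eq]
    exact Finset.sum_congr rfl fun i _ => Finset.sum_congr rfl fun j _ => by ring
  have hham : hamiltonian g Z p c = -(1 / 3) * ∑ i, ∑ j, invMetric g p i j *
      covBil g Z p (stdBasis i) (stdBasis j) c := by
    simp only [covBil_apply, stdBasis_apply]
    rfl
  rw [hham]
  congr 1
  calc ∑ i, ∑ j, invMetric g p i j * covBil g Z p (stdBasis i) (stdBasis j) c
      = ∑ i, ∑ j, ∑ k, ∑ l, invMetric g p i j * (B (e k) (stdBasis i) * B (e l) (stdBasis j)) *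
          covBil g Z p (e k) (e l) c := by
        refine Finset.sum_congr rfl fun i _ => Finset.sum_congr rfl fun j _ => ?_
        rw [hexp, Finset.mul_sum]
        refine Finset.sum_congr rfl fun k _ => ?_
        rw [Finset.mul_sum]
        exact Finset.sum_congr rfl fun l _ => by ring
    _ = ∑ k, ∑ l, (∑ i, ∑ j, invMetric g p i j * (B (e k) (stdBasis i) * B (e l) (stdBasis j))) *
          covBil g Z p (e k) (e l) c := by
        simp only [Fin.sum_univ_four]
        ring
    _ = ∑ i, covBil g Z p (e i) (e i) c := by simp [hinv]

/-- Unit vectors are chosen successively orthogonal to the previous ones; the sign of the last one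
adjusts the orientation. -/
theorem IsInner.exists_frame {B : Bil} (hB : IsInner B) (o : Orientation ℝ E4 (Fin 4)) :
    ∃ e : Module.Basis (Fin 4) ℝ E4, IsFrame B e ∧ e.orientation = o := by
  obtain ⟨u, hu, -⟩ := hB.exists_unit (k := 0) (by norm_num) Fin.elim0
  obtain ⟨v, hv, huv⟩ := hB.exists_unit (k := 1) (by norm_num) ![u]
  obtain ⟨w, hw, huw⟩ := hB.exists_unit (k := 2) (by norm_num) ![u, v]
  obtain ⟨x, hx, hux⟩ := hB.exists_unit (k := 3) (by norm_num) ![u, v, w]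
  have h1 : B u v = 0 := huv 0
  have h2 : B u w = 0 := huw 0
  have h3 : B v w = 0 := huw 1
  have h4 : B u x = 0 := hux 0
  have h5 : B v x = 0 := hux 1
  have h6 : B w x = 0 := hux 2
  have hfr : ∀ t : ℝ, t * t = 1 → IsFrame B ![u, v, w, t • x] := by
    intro t ht i j
    fin_cases i <;> fin_cases j <;>
      simp [hu, hv, hw, hx, h1, h2, h3, h4, h5, h6, ht, hB.symm v u, hB.symm w u, hB.symm w v,
        hB.symm x u, hB.symm x v, hB.symm x w]
  obtain ⟨b, hb⟩ := (hfr 1 (by norm_num)).exists_basis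
  obtain ⟨b', hb'⟩ := (hfr (-1) (by norm_num)).exists_basis
  have hne : b.orientation ≠ b'.orientation := by
    intro h
    rw [Module.Basis.orientation_eq_iff_det_pos] at h
    have hu : (b' : Fin 4 → E4) = Function.update (⇑b) 3 ((-1 : ℝ) • b 3) := by
      ext1 i
      fin_cases i <;> simp [hb, hb', Function.update]
    rw [hu, AlternatingMap.map_update_smul, Function.update_eq_self, Module.Basis.det_self] at h
    norm_num at h
  rcases b.orientation_eq_or_eq_neg o with h | h
  · exact ⟨b, hb ▸ hfr 1 (by norm_num), h.symm⟩
  · rcases b'.orientation_eq_or_eq_neg o with h' | h'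
    · exact ⟨b', hb' ▸ hfr (-1) (by norm_num), h'.symm⟩
    · exact absurd (neg_injective (h.symm.trans h')) hne

theorem exists_frame (g : Metric M) (o : ManifoldOrientation M) (p : M) :
    ∃ e : Module.Basis (Fin 4) ℝ E4, IsFrame (bilinAt g.inner p) e ∧ e.orientation = o.orient p :=
  (metric_isInner g p).exists_frame (o.orient p)

/-- The trace of the equation is `3τ` and the Hamiltonian field carries the factor `-1/3`, so it is
`-τ`. -/
theorem isTwistor_hamiltonian {g : Metric M} {Z : BilinField M} {p : M}
    {e : Module.Basis (Fin 4) ℝ E4} (he : IsFrame (bilinAt g.inner p) e)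
    (h : IsTwistor (bilinAt g.inner p) fun a b c => covBil g Z p a b c) (a b c : E4) :
    covBil g Z p a b c + covBil g Z p b a c = - (2 * bilinAt g.inner p a b * hamiltonian g Z p c
      - bilinAt g.inner p a c * hamiltonian g Z p b
      - bilinAt g.inner p b c * hamiltonian g Z p a) := by
  obtain ⟨τ, hτ, h⟩ := h
  have h1 : ∀ c : E4, hamiltonian g Z p c = - τ c := fun c => by
    rw [hamiltonian_frame g Z p he, IsTwistor.trace hτ h he]
    ring
  rw [h a b c, h1, h1, h1]
  ring

/-! ### From conformal Kähler pairs to Killing–Yano forms -/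

/-- Equal Hamiltonian fields mean equal trace terms in the two twistor equations, so these cancel in
the difference. -/
theorem exists_killingYano_of_conformallyKahler {g : Metric M} {o : ManifoldOrientation M}
    {U₁ U₂ : Set M} {Ω₁ Ω₂ : M → ℝ} {J₁ J₂ : EndField M} {Z₁ Z₂ : BilinField M}
    (h₁ : IsConformallyKahlerWithPoles g o 1 U₁ Ω₁ J₁ Z₁)
    (h₂ : IsConformallyKahlerWithPoles g o (-1) U₂ Ω₂ J₂ Z₂)
    (h : ∀ p c, hamiltonian g Z₁ p c = hamiltonian g Z₂ p c)
    (h0 : ∃ p c, hamiltonian g Z₁ p c ≠ 0) :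
    IsKillingYano g (fun p => Z₁ p - Z₂ p) ∧ ¬ IsParallel g fun p => Z₁ p - Z₂ p := by
  have hs₁ := h₁.isTwoForm.smooth
  have h' : ∀ (p : M) (c : E4), hamiltonian g Z₁ p c = hamiltonian g Z₂ p c := h
  have hs₂ := h₂.isTwoForm.smooth
  have hD : Dense (U₁ ∩ U₂) := h₁.dense.inter_of_isOpen_left h₂.dense h₁.isOpen
  have ht₁ : ∀ p ∈ U₁, (IsTwistor (bilinAt g.inner p) fun a b c => covBil g Z₁ p a b c) ∧
      ∀ e : Module.Basis (Fin 4) ℝ E4, IsFrame (bilinAt g.inner p) e →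
        e.orientation = o.orient p → ∀ a, DualIn 1 (covBil g Z₁ p a) e := by
    intro p hp
    obtain ⟨e1, e, he, heo, hd⟩ := (h₁.conformallyKahler.isConformalHermitianOn
      h₁.isOpen).twistor_iff (Or.inl rfl) h₁.eq_on hp
    refine ⟨e1.1 ⟨h₁.conformallyKahler.kahler.integrable p hp,
      h₁.conformallyKahler.kahler.closed p hp⟩, fun f hf hfo a => ?_⟩
    exact (hd a).of_frame (metric_isInner g p) he hf (heo.trans hfo.symm)
      (covBil_alternating g h₁.isTwoForm p a) (by norm_num)
  have ht₂ : ∀ p ∈ U₂, (IsTwistor (bilinAt g.inner p) fun a b c => covBil g Z₂ p a b c) ∧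
      ∀ e : Module.Basis (Fin 4) ℝ E4, IsFrame (bilinAt g.inner p) e →
        e.orientation = o.orient p → ∀ a, DualIn (-1) (covBil g Z₂ p a) e := by
    intro p hp
    obtain ⟨e1, e, he, heo, hd⟩ := (h₂.conformallyKahler.isConformalHermitianOn
      h₂.isOpen).twistor_iff (Or.inr rfl) h₂.eq_on hp
    refine ⟨e1.1 ⟨h₂.conformallyKahler.kahler.integrable p hp,
      h₂.conformallyKahler.kahler.closed p hp⟩, fun f hf hfo a => ?_⟩
    exact (hd a).of_frame (metric_isInner g p) he hf (heo.trans hfo.symm)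
      (covBil_alternating g h₂.isTwoForm p a) (by norm_num)
  refine ⟨⟨h₁.isTwoForm.sub h₂.isTwoForm, fun p a b c => ?_⟩, fun hpar => ?_⟩
  · have key : ∀ a b c : E4, covDeriv g (fun p => Z₁ p - Z₂ p) p a b c +
        covDeriv g (fun p => Z₁ p - Z₂ p) p b a c = 0 := fun a b c => by
      rw [← covBil_apply, ← covBil_apply]
      have := covDeriv_eq_zero_of_dense g (hs₁.sub hs₂) 1 hD (fun q hq a b c => by
        obtain ⟨e, he, -⟩ := exists_frame g o q
        have e1 := isTwistor_hamiltonian he (ht₁ q hq.1).1 a b c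
        have e2 := isTwistor_hamiltonian he (ht₂ q hq.2).1 a b c
        rw [covBil_sub g hs₁ hs₂, covBil_sub g hs₁ hs₂]
        rw [← h' q a, ← h' q b, ← h' q c] at e2
        linarith) p a b c
      rwa [one_mul] at this
    exact key a b c
  · obtain ⟨p, c, hpc⟩ := h0
    refine hpc ?_
    obtain ⟨e, he, -⟩ := exists_frame g o p
    have hz := covDeriv_eq_zero_of_dense g hs₁ 0 hD (fun q hq a b c => by
      obtain ⟨f, hf, hfo⟩ := exists_frame g o q
      -- If the difference is parallel, the common value is self-dual as a derivative of `Z₁` and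
      -- anti-self-dual as one of `Z₂`, hence zero.
      have e0 : covBil g Z₁ q a = covBil g Z₂ q a := by
        ext u v
        have := hpar q a u v
        rw [← covBil_apply, covBil_sub g hs₁ hs₂] at this
        linarith
      have e1 := (ht₁ q hq.1).2 f hf hfo a
      have e2 := (ht₂ q hq.2).2 f hf hfo a
      rw [← e0] at e2
      rw [DualIn.eq_zero (covBil_alternating g h₁.isTwoForm q a) e1 e2]
      simp) p
    refine (hamiltonian_frame g Z₁ p he c).trans ?_
    have : ∀ i, covBil g Z₁ p (e i) (e i) c = 0 := fun i => by
      have := hz (e i) (e i) c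
      rwa [zero_mul, add_zero] at this
    simp [this]

/-! ### Killing forms of structures without poles. -/

theorem IsConformalHermitianOn.localBilin_killingForm {g : Metric M} {o : ManifoldOrientation M}
    {s : ℝ} {U : Set M} {Ω : M → ℝ} {J : EndField M} (h : IsConformalHermitianOn g o s U Ω J)
    {p : M} (hp : p ∈ U) : ∀ᶠ z in 𝓝 (extChartAt (𝓡 4) p p),
      localBilin (killingForm g Ω J) p z =
        ((Ω ∘ (extChartAt (𝓡 4) p).symm) z)⁻¹ • (localBilin g.inner p z).comp (localEnd J p z) := by
  filter_upwards [eventually_chart_source p, eventually_chart (h.isOpen.mem_nhds hp)] with z hz hzU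
  ext a b
  rw [localBilin_apply, bilinAt]
  simp only [smul_apply, ContinuousLinearMap.comp_apply]
  rw [localBilin_apply, coordMap_localEnd J hz]
  rfl

theorem IsConformalHermitianOn.isTwoForm_killingForm {g : Metric M} {o : ManifoldOrientation M}
    {s : ℝ} {Ω : M → ℝ} {J : EndField M} (h : IsConformalHermitianOn g o s Set.univ Ω J) :
    IsTwoForm (killingForm g Ω J) := by
  refine ⟨fun p v => ?_, smoothBilin_iff.2 fun p => ?_⟩
  · have h1 := IsInner.skew_of_compatible (B := bilinAt g.inner p) (h.sq p trivial)
      (h.compatible p trivial) v v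
    rw [(metric_isInner g p).symm v] at h1
    have h2 : bilinAt g.inner p (endAt J p v) v = 0 := by linarith
    have h3 : (Ω p)⁻¹ * bilinAt g.inner p (endAt J p v) v = 0 := by rw [h2, mul_zero]
    exact h3
  · have hp : p ∈ Set.univ := trivial
    refine ContDiffAt.congr_of_eventuallyEq ?_ (h.localBilin_killingForm hp)
    have hΩ := (contMDiffOn_scalar_iff h.isOpen).1 h.smooth p hp
    refine (hΩ.inv ?_).smul ((smoothBilin_iff.1 g.contMDiff p).clm_comp
      ((smoothEndOn_iff h.isOpen).1 h.smoothEnd p hp))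
    rw [Function.comp_apply, (extChartAt (𝓡 4) p).left_inv (mem_extChartAt_source p)]
    exact h.ne_zero p hp

theorem IsConformallyKahlerOn.withPoles {g : Metric M} {o : ManifoldOrientation M}
    {s : ℝ} {Ω : M → ℝ} {J : EndField M} (h : IsConformallyKahlerOn g o s Set.univ Ω J) :
    IsConformallyKahlerWithPoles g o s Set.univ Ω J (killingForm g Ω J) :=
  ⟨isOpen_univ, dense_univ, h, (h.isConformalHermitianOn isOpen_univ).isTwoForm_killingForm,
    fun _ _ => rfl, fun _ hp => (hp trivial).elim⟩

theorem IsConformalHermitianOn.killingForm_ne_zero {g : Metric M} {o : ManifoldOrientation M}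
    {s : ℝ} {U : Set M} {Ω : M → ℝ} {J : EndField M} (h : IsConformalHermitianOn g o s U Ω J)
    {p : M} (hp : p ∈ U) : bilinAt (killingForm g Ω J) p ≠ 0 := by
  intro h0
  obtain ⟨e, he, -⟩ := exists_frame g o p
  have h1 : (Ω p)⁻¹ * bilinAt g.inner p (endAt J p (e 0)) (endAt J p (e 0)) =
      bilinAt (killingForm g Ω J) p (e 0) (endAt J p (e 0)) := rfl
  rw [h0, h.compatible p hp, he 0 0] at h1
  simp [h.ne_zero p hp] at h1

theorem IsConformalHermitianOn.hodgeDual_killingForm {g : Metric M} {o : ManifoldOrientation M}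
    {s : ℝ} {U : Set M} {Ω : M → ℝ} {J : EndField M} (h : IsConformalHermitianOn g o s U Ω J)
    {p : M} (hp : p ∈ U) : HodgeDual g o s p (killingForm g Ω J p) :=
  hodgeDual_iff.2 fun e he ho => (hodgeDual_iff.1 (h.oriented p hp) e he ho).smul _

/-- The difference of a self-dual and an anti-self-dual form is dual only if one of them
vanishes. -/
theorem not_hodgeDual_sub {g : Metric M} {o : ManifoldOrientation M} {p : M} {F G : Bil}
    (hF : ∀ v, F v v = 0) (hG : ∀ v, G v v = 0) (h₁ : HodgeDual g o 1 p F)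
    (h₂ : HodgeDual g o (-1) p G) (hF0 : F ≠ 0) (hG0 : G ≠ 0) :
    ¬ HodgeDual g o 1 p (F - G) ∧ ¬ HodgeDual g o (-1) p (F - G) := by
  obtain ⟨e, he, ho⟩ := exists_frame g o p
  have e1 := hodgeDual_iff.1 h₁ e he ho
  have e2 := hodgeDual_iff.1 h₂ e he ho
  constructor
  · intro h
    refine hG0 (DualIn.eq_zero hG ?_ e2)
    have e3 := (hodgeDual_iff.1 h e he ho).add (e1.smul (-1))
    have := e3.smul (-1)
    convert this using 1
    module
  · intro h
    refine hF0 (DualIn.eq_zero hF e1 ?_)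
    have e3 := (hodgeDual_iff.1 h e he ho).add e2
    convert e3 using 1
    module

/-! ### Smooth orthonormal frames -/

/-- Gram–Schmidt applied to the constant extensions of the `e i`. These are orthonormal at `y`, so
the procedure does not change their values there. The induction is on the number of vectors already
treated. -/
theorem exists_smooth_frame {G : E4 → Bil} {y : E4} (hG : ContDiffAt ℝ ∞ G y)
    (hi : ∀ᶠ z in 𝓝 y, IsInner (G z)) {e : Fin 4 → E4} (he : IsFrame (G y) e) :
    ∃ E : Fin 4 → E4 → E4, (∀ i, ContDiffAt ℝ ∞ (E i) y) ∧ (∀ i, E i y = e i) ∧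
      ∀ᶠ z in 𝓝 y, IsFrame (G z) fun i => E i z := by
  have hGc : ∀ {u v : E4 → E4}, ContDiffAt ℝ ∞ u y → ContDiffAt ℝ ∞ v y →
      ContDiffAt ℝ ∞ (fun z => G z (u z) (v z)) y := fun hu hv =>
    (hG.clm_apply hu).clm_apply hv
  have key : ∀ k : ℕ, k ≤ 4 → ∃ E : Fin 4 → E4 → E4, (∀ i, ContDiffAt ℝ ∞ (E i) y) ∧
      (∀ i, E i y = e i) ∧ ∀ᶠ z in 𝓝 y, ∀ i j : Fin 4, (i : ℕ) < k → (j : ℕ) < k →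
        G z (E i z) (E j z) = if i = j then 1 else 0 := by
    intro k
    induction k with
    | zero =>
      exact fun _ => ⟨fun i _ => e i, fun i => contDiffAt_const, fun i => rfl,
        Filter.Eventually.of_forall fun z i j hi => absurd hi (Nat.not_lt_zero _)⟩
    | succ k ih =>
      intro hk
      obtain ⟨E, h1, h2, h3⟩ := ih (by omega)
      set l : Fin 4 := ⟨k, by omega⟩ with hl
      set s : Finset (Fin 4) := Finset.univ.filter fun i => (i : ℕ) < k with hs
      have hls : ∀ i ∈ s, i ≠ l := fun i hi h => by
        have h5 := (Finset.mem_filter.1 hi).2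
        rw [h, hl] at h5
        exact absurd h5 (lt_irrefl k)
      -- Only the vectors before `l` are projected out. At `y` all the coefficients vanish, and near
      -- `y` the length stays positive.
      set W : E4 → E4 := fun z => e l - ∑ i ∈ s, G z (E i z) (e l) • E i z with hW
      have hWs : ContDiffAt ℝ ∞ W y := by
        refine contDiffAt_const.sub (ContDiffAt.sum fun i _ => ?_)
        exact (hGc (h1 i) contDiffAt_const).smul (h1 i)
      have hWy : W y = e l := by
        simp only [hW, h2, he _ _]
        rw [Finset.sum_eq_zero, sub_zero]
        intro i hi
        rw [if_neg (hls i hi), zero_smul]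
      have hWW : ContDiffAt ℝ ∞ (fun z => G z (W z) (W z)) y := hGc hWs hWs
      have hWW1 : G y (W y) (W y) = 1 := by rw [hWy, he, if_pos rfl]
      have hpos : ∀ᶠ z in 𝓝 y, 0 < G z (W z) (W z) :=
        hWW.continuousAt.eventually (lt_mem_nhds (by simp only [hWW1]; norm_num))
      set V : E4 → E4 := fun z => (Real.sqrt (G z (W z) (W z)))⁻¹ • W z with hV
      have hVs : ContDiffAt ℝ ∞ V y := by
        refine ((hWW.sqrt ?_).inv ?_).smul hWs <;> rw [hWW1]
        · norm_num
        · simp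
      have hVy : V y = e l := by
        simp only [hV]
        rw [hWW1, hWy]
        simp
      refine ⟨Function.update E l V, fun i => ?_, fun i => ?_, ?_⟩
      · by_cases h : i = l
        · rw [h, Function.update_self]
          exact hVs
        · rw [Function.update_of_ne h]
          exact h1 i
      · by_cases h : i = l
        · rw [h, Function.update_self, hVy]
        · rw [Function.update_of_ne h, h2]
      · filter_upwards [h3, hpos, hi] with z hz hzp hzi
        have hlt : ∀ i : Fin 4, (i : ℕ) < k + 1 → i ≠ l → (i : ℕ) < k := fun i hi hne => by
          have : (i : ℕ) ≠ k := fun h => hne (Fin.ext h)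
          omega
        have horth : ∀ i : Fin 4, (i : ℕ) < k → G z (E i z) (V z) = 0 := by
          intro i hik
          have : G z (E i z) (W z) = 0 := by
            simp only [hW, map_sub, map_sum, map_smul, smul_eq_mul]
            rw [Finset.sum_eq_single i, hz i i hik hik, if_pos rfl, mul_one, sub_self]
            · intro j hj hji
              rw [hz i j hik (Finset.mem_filter.1 hj).2, if_neg (Ne.symm hji), mul_zero]
            · intro h
              exact absurd (Finset.mem_filter.2 ⟨Finset.mem_univ i, hik⟩) h
          simp only [hV, map_smul, this, smul_zero]
        have hunit : G z (V z) (V z) = 1 := by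
          have h6 := Real.mul_self_sqrt hzp.le
          have h7 : Real.sqrt (G z (W z) (W z)) ≠ 0 := (Real.sqrt_pos.2 hzp).ne'
          simp only [hV, map_smul, smul_apply, smul_eq_mul]
          rw [← mul_assoc, ← mul_inv, h6]
          exact inv_mul_cancel₀ hzp.ne'
        intro i j hi hj
        by_cases hil : i = l <;> by_cases hjl : j = l
        · rw [hil, hjl, Function.update_self, hunit, if_pos rfl]
        · rw [hil, Function.update_self, Function.update_of_ne hjl, hzi.symm,
            horth j (hlt j hj hjl), if_neg (Ne.symm hjl)]
        · rw [hjl, Function.update_self, Function.update_of_ne hil, horth i (hlt i hi hil),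
            if_neg hil]
        · rw [Function.update_of_ne hil, Function.update_of_ne hjl,
            hz i j (hlt i hi hil) (hlt j hj hjl)]
  obtain ⟨E, h1, h2, h3⟩ := key 4 le_rfl
  exact ⟨E, h1, h2, h3.mono fun z hz i j => hz i j i.2 j.2⟩

theorem eventually_det_pos {e : Module.Basis (Fin 4) ℝ E4} {E : Fin 4 → E4 → E4} {y : E4}
    (hE : ∀ i, ContinuousAt (E i) y) (hEy : ∀ i, E i y = e i) :
    ∀ᶠ z in 𝓝 y, 0 < e.det fun i => E i z := by
  have hc : ContinuousAt (fun z => e.det fun i => E i z) y := by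
    simp only [Module.Basis.det_apply]
    refine ContinuousAt.comp (g := Matrix.det) (continuous_id.matrix_det.continuousAt) ?_
    refine continuousAt_pi.2 fun i => continuousAt_pi.2 fun j => ?_
    exact ContinuousAt.comp (g := e.coord i)
      (LinearMap.continuous_of_finiteDimensional (e.coord i)).continuousAt (hE j)
  refine hc.eventually (lt_mem_nhds ?_)
  simp only [hEy]
  rw [Module.Basis.det_self]
  norm_num

/-- Frames that depend continuously on the point stay oriented. -/
theorem eventually_oriented (o : ManifoldOrientation M) {p : M}
    {e : Module.Basis (Fin 4) ℝ E4} (ho : e.orientation = o.orient p) {E : Fin 4 → E4 → E4}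
    (hE : ∀ i, ContinuousAt (E i) (extChartAt (𝓡 4) p p))
    (hEy : ∀ i, E i (extChartAt (𝓡 4) p p) = e i) :
    ∀ᶠ z in 𝓝 (extChartAt (𝓡 4) p p), ∀ b : Module.Basis (Fin 4) ℝ E4,
      (∀ i, b i = coordMap p ((extChartAt (𝓡 4) p).symm z) (E i z)) →
        b.orientation = o.orient ((extChartAt (𝓡 4) p).symm z) := by
  obtain ⟨c, hc⟩ := o.locally_constant p
  have key : ∀ (q : M) (b : Module.Basis (Fin 4) ℝ E4) (hq : q ∈ (chartAt E4 p).source)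
      (v : Fin 4 → E4), (∀ i, b i = coordMap p q (v i)) →
      ∃ f : Module.Basis (Fin 4) ℝ E4, (∀ i, f i = v i) ∧ (Orientation.map (Fin 4)
        ((trivializationAt E4 (fun x : M => TangentSpace (𝓡 4) x) p).continuousLinearEquivAt
          ℝ q hq).toLinearEquiv) b.orientation = f.orientation := by
    intro q b hq v hbv
    refine ⟨b.map ((trivializationAt E4 (fun x : M => TangentSpace (𝓡 4)
      x) p).continuousLinearEquivAt ℝ q hq).toLinearEquiv, fun i => ?_, ?_⟩
    · refine (congrArg ((trivializationAt E4 (fun x : M => TangentSpace (𝓡 4)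
        x) p).continuousLinearEquivAt ℝ q hq) (hbv i)).trans ?_
      exact (congrFun (Bundle.Trivialization.coe_continuousLinearEquivAt_eq (R := ℝ)
        (trivializationAt E4 (fun x : M => TangentSpace (𝓡 4) x) p) hq) _).trans
        (Bundle.Trivialization.continuousLinearMapAt_symmL (R := ℝ)
          (trivializationAt E4 (fun x : M => TangentSpace (𝓡 4) x) p) hq (v i))
    · exact (Module.Basis.orientation_map b _).symm
  have hp : (Orientation.map (Fin 4)
        ((trivializationAt E4 (fun x : M => TangentSpace (𝓡 4) x) p).continuousLinearEquivAt
          ℝ p (mem_chart_source E4 p)).toLinearEquiv) (o.orient p) = e.orientation := by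
    obtain ⟨f, hf, hfo⟩ := key p e (mem_chart_source E4 p) e fun i => by
      rw [coordMap_self]; rfl
    rw [ho] at hfo
    exact hfo.trans (by rw [Module.Basis.eq_of_apply_eq hf])
  -- Evaluation at `p` itself identifies the locally constant orientation; a positive determinant
  -- carries it to nearby frames.
  have hce : c = e.orientation := (hc.self_of_nhds (mem_chart_source E4 p)).symm.trans hp
  filter_upwards [eventually_chart hc, eventually_chart_source p, eventually_det_pos hE hEy]
    with z hz hzs hzd b hb
  obtain ⟨f, hf, hfo⟩ := key _ b hzs _ hb
  have h1 : f.orientation = e.orientation := by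
    rw [eq_comm, Module.Basis.orientation_eq_iff_det_pos]
    have : (⇑f : Fin 4 → E4) = fun i => E i z := funext hf
    rw [this]
    exact hzd
  have h2 := hz hzs
  rw [hce, ← h1, ← hfo] at h2
  exact ((Orientation.map (Fin 4) _).injective h2).symm

/-- A smooth oriented orthonormal frame near a point, in the coordinates of the preferred chart. -/
theorem exists_oriented_frame (g : Metric M) (o : ManifoldOrientation M) {p : M}
    {e : Module.Basis (Fin 4) ℝ E4} (he : IsFrame (bilinAt g.inner p) e)
    (ho : e.orientation = o.orient p) :
    ∃ E : Fin 4 → E4 → E4, (∀ i, ContDiffAt ℝ ∞ (E i) (extChartAt (𝓡 4) p p)) ∧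
      (∀ i, E i (extChartAt (𝓡 4) p p) = e i) ∧
      ∀ᶠ z in 𝓝 (extChartAt (𝓡 4) p p), IsFrame (localBilin g.inner p z) (fun i => E i z) ∧
        ∃ b : Module.Basis (Fin 4) ℝ E4,
          (∀ i, b i = coordMap p ((extChartAt (𝓡 4) p).symm z) (E i z)) ∧
          IsFrame (bilinAt g.inner ((extChartAt (𝓡 4) p).symm z)) b ∧
          b.orientation = o.orient ((extChartAt (𝓡 4) p).symm z) := by
  obtain ⟨E, h1, h2, h3⟩ := exists_smooth_frame (smoothBilin_iff.1 g.contMDiff p)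
    (eventually_localMetric_isInner g p) (e := e) (by rw [localBilin_self]; exact he)
  refine ⟨E, h1, h2, ?_⟩
  filter_upwards [h3, eventually_oriented o ho (fun i => (h1 i).continuousAt) h2] with z hz hzo
  have hf : IsFrame (bilinAt g.inner ((extChartAt (𝓡 4) p).symm z))
      (fun i => coordMap p ((extChartAt (𝓡 4) p).symm z) (E i z)) := hz
  obtain ⟨b, hb⟩ := hf.exists_basis
  exact ⟨hz, b, fun i => congrFun hb i, hb ▸ hf, hzo b fun i => congrFun hb i⟩

/-! ### The Levi-Civita connection preserves duality -/

theorem fderiv_frame_components {F : E4 → Bil} {y : E4} {E : Fin 4 → E4 → E4}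
    (hF : DifferentiableAt ℝ F y) (hE : ∀ i, DifferentiableAt ℝ (E i) y) (a : E4) (i j : Fin 4) :
    fderiv ℝ (fun z => F z (E i z) (E j z)) y a = fderiv ℝ F y a (E i y) (E j y) +
      F y (fderiv ℝ (E i) y a) (E j y) + F y (E i y) (fderiv ℝ (E j) y a) := by
  have h := (hF.hasFDerivAt.clm_apply (hE i).hasFDerivAt).clm_apply (hE j).hasFDerivAt
  rw [h.fderiv]
  simp
  ring

/-- Connection coefficients of an orthonormal frame. -/
theorem exists_connection_coefficients {G : E4 → Bil} {y : E4} (hG : DifferentiableAt ℝ G y)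
    (hi : ∀ᶠ z in 𝓝 y, IsInner (G z)) {E : Fin 4 → E4 → E4}
    (hE : ∀ i, DifferentiableAt ℝ (E i) y) (hfr : ∀ᶠ z in 𝓝 y, IsFrame (G z) fun i => E i z)
    (a : E4) : ∃ A : Fin 4 → Fin 4 → ℝ, (∀ i j, A i j = - A j i) ∧
      ∀ F : E4 → Bil, DifferentiableAt ℝ F y → ∀ i j,
        fderiv ℝ (fun z => F z (E i z) (E j z)) y a = chcov G F y a (E i y) (E j y) +
          ∑ k, A i k * F y (E k y) (E j y) + ∑ k, A j k * F y (E i y) (E k y) := by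
  -- `w i` is `∇_a E_i`, and `A i k = g(∇_a E_i, E_k)`; skewness is the derivative of the constant
  -- `g(E_i, E_j)`.
  set w : Fin 4 → E4 := fun i => fderiv ℝ (E i) y a + chr G y a (E i y) with hw
  have hf := hfr.self_of_nhds
  have hin := hi.self_of_nhds
  obtain ⟨b, hb⟩ := hf.exists_basis
  have hexp : ∀ i, w i = ∑ k, G y (w i) (E k y) • E k y := fun i => by
    have h1 : ∀ k, b k = E k y := fun k => congrFun hb k
    have h2 : IsFrame (G y) b := hb ▸ hf
    conv_lhs => rw [h2.expand (w i)]
    exact Finset.sum_congr rfl fun k _ => by rw [hin.symm (w i), h1]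
  refine ⟨fun i k => G y (w i) (E k y), fun i j => ?_, fun F hF i j => ?_⟩
  · have h1 := fderiv_frame_components hG hE a i j
    have h2 : (fun z => G z (E i z) (E j z)) =ᶠ[𝓝 y] fun _ => if i = j then 1 else 0 := by
      filter_upwards [hfr] with z hz using hz i j
    rw [h2.fderiv_eq, fderiv_metric hG hi, (hasFDerivAt_const (𝕜 := ℝ) _ y).fderiv] at h1
    simp only [zero_apply, hw, map_add, add_apply] at h1 ⊢
    linarith [hin.symm (fderiv ℝ (E j) y a) (E i y), hin.symm (chr G y a (E j y)) (E i y)]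
  · rw [fderiv_frame_components hF hE]
    have h1 : F y (w i) (E j y) = ∑ k, G y (w i) (E k y) * F y (E k y) (E j y) := by
      conv_lhs => rw [hexp i]
      simp only [map_sum, map_smul, sum_apply, smul_apply, smul_eq_mul]
    have h2 : F y (E i y) (w j) = ∑ k, G y (w j) (E k y) * F y (E i y) (E k y) := by
      conv_lhs => rw [hexp j]
      simp only [map_sum, map_smul, smul_eq_mul]
    rw [← h1, ← h2, chcov]
    simp only [hw, map_add, add_apply]
    ring

/-- In an orthonormal frame the connection matrix is skew, and infinitesimal rotations commute with
the Hodge star. Differentiating the duality relations therefore leaves the same relations for `∇F`.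
-/
theorem chcov_dualIn {G F : E4 → Bil} {y : E4} (hG : DifferentiableAt ℝ G y)
    (hi : ∀ᶠ z in 𝓝 y, IsInner (G z)) (hF : DifferentiableAt ℝ F y) (hFa : ∀ v, F y v v = 0)
    {E : Fin 4 → E4 → E4}
    (hE : ∀ i, DifferentiableAt ℝ (E i) y) (hfr : ∀ᶠ z in 𝓝 y, IsFrame (G z) fun i => E i z)
    {s : ℝ} (hs : s = 1 ∨ s = -1) (hd : ∀ᶠ z in 𝓝 y, DualIn s (F z) fun i => E i z) (a : E4) :
    chcov G F y a (E 0 y) (E 1 y) = s * chcov G F y a (E 2 y) (E 3 y) ∧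
    chcov G F y a (E 0 y) (E 2 y) = s * chcov G F y a (E 3 y) (E 1 y) ∧
    chcov G F y a (E 0 y) (E 3 y) = s * chcov G F y a (E 1 y) (E 2 y) := by
  obtain ⟨A, hA, h⟩ := exists_connection_coefficients hG hi hE hfr a
  have hdiff : ∀ i j, DifferentiableAt ℝ (fun z => F z (E i z) (E j z)) y := fun i j =>
    (hF.clm_apply (hE i)).clm_apply (hE j)
  have key : ∀ i j k l : Fin 4, (∀ᶠ z in 𝓝 y, F z (E i z) (E j z) = s * F z (E k z) (E l z)) →
      fderiv ℝ (fun z => F z (E i z) (E j z)) y a =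
        s * fderiv ℝ (fun z => F z (E k z) (E l z)) y a := by
    intro i j k l hev
    have h1 : (fun z => F z (E i z) (E j z)) =ᶠ[𝓝 y] fun z => s * F z (E k z) (E l z) := hev
    rw [h1.fderiv_eq, fderiv_const_mul (hdiff k l)]
    rfl
  have k1 := key 0 1 2 3 (hd.mono fun z hz => hz.1)
  have k2 := key 0 2 3 1 (hd.mono fun z hz => hz.2.1)
  have k3 := key 0 3 1 2 (hd.mono fun z hz => hz.2.2)
  obtain ⟨d1, d2, d3⟩ := hd.self_of_nhds
  have t := skew_of_alternating hFa
  have A0 : ∀ i, A i i = 0 := fun i => by linarith [hA i i]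
  rw [h F hF, h F hF] at k1 k2 k3
  simp only [Fin.sum_univ_four, A0, hFa, t (E 1 y) (E 0 y), t (E 2 y) (E 0 y), t (E 3 y) (E 0 y),
    t (E 2 y) (E 1 y), t (E 1 y) (E 3 y), t (E 3 y) (E 2 y), hA 1 0, hA 2 0, hA 3 0, hA 2 1,
    hA 3 1, hA 3 2, d1, d2, d3] at k1 k2 k3
  rcases hs with rfl | rfl
  · refine ⟨?_, ?_, ?_⟩
    · linear_combination k1
    · linear_combination k2
    · linear_combination k3
  · refine ⟨?_, ?_, ?_⟩
    · linear_combination k1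
    · linear_combination k2
    · linear_combination k3

theorem covBil_dualIn {g : Metric M} {o : ManifoldOrientation M} {s : ℝ} (hs : s = 1 ∨ s = -1)
    {T : BilinField M} (hT : IsTwoForm T) (hd : ∀ p, HodgeDual g o s p (T p)) {p : M}
    {e : Module.Basis (Fin 4) ℝ E4} (he : IsFrame (bilinAt g.inner p) e)
    (ho : e.orientation = o.orient p) (a : E4) : DualIn s (covBil g T p a) e := by
  obtain ⟨E, h1, h2, h3⟩ := exists_oriented_frame g o he ho
  have h4 := chcov_dualIn (F := localBilin T p) (localMetric_differentiableAt g p)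
    (eventually_localMetric_isInner g p) (smooth_differentiableAt (smoothBilin_iff.1 hT.smooth p))
    (fun v => hT.alternating _ _) (fun i => smooth_differentiableAt (h1 i)) (h3.mono fun z hz => hz.1)
    hs (h3.mono fun z hz => by
      obtain ⟨-, b, hb, hbf, hbo⟩ := hz
      have h5 : DualIn s (bilinAt T ((extChartAt (𝓡 4) p).symm z)) b :=
        hodgeDual_iff.1 (hd _) b hbf hbo
      simpa only [DualIn, localBilin_apply, hb] using h5) a
  simp only [h2] at h4
  simpa only [DualIn, covBil_apply, covDeriv_eq_chcov] using h4

/-! ### The self-dual part of a 2-form -/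

/-- The self-dual part of a 2-form. -/
def selfDualPart (g : Metric M) (o : ManifoldOrientation M) (F : BilinField M) : BilinField M :=
  fun p => dualPart (bilinAt g.inner p) (exists_frame g o p).choose 1 (bilinAt F p)

/-- Uniqueness of the decomposition into dual parts makes the arbitrary frame chosen in
`selfDualPart` immaterial. -/
theorem dualPart_frame {B : Bil} (hB : IsInner B) {e f : Module.Basis (Fin 4) ℝ E4}
    (he : IsFrame B e) (hf : IsFrame B f) (ho : e.orientation = f.orientation) {F : Bil}
    (hF : ∀ v, F v v = 0) : dualPart B e 1 F = dualPart B f 1 F := by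
  have a1 := dualPart_alternating B e 1 hF
  have a2 := dualPart_alternating B e (-1) hF
  refine (DualIn.unique (e := f) a1 (dualPart_alternating B f 1 hF)
    ((dualPart_dualIn he (by norm_num) hF).of_frame hB he hf ho a1 (by norm_num))
    (dualPart_dualIn hf (by norm_num) hF)
    ((dualPart_dualIn he (by norm_num) hF).of_frame hB he hf ho a2 (by norm_num))
    (dualPart_dualIn hf (by norm_num) hF) ?_).1
  rw [dualPart_add, dualPart_add]

theorem selfDualPart_frame (g : Metric M) (o : ManifoldOrientation M) {F : BilinField M}
    (hF : IsTwoForm F) {p : M} {e : Module.Basis (Fin 4) ℝ E4}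
    (he : IsFrame (bilinAt g.inner p) e) (ho : e.orientation = o.orient p) :
    bilinAt (selfDualPart g o F) p = dualPart (bilinAt g.inner p) e 1 (bilinAt F p) :=
  dualPart_frame (metric_isInner g p) (exists_frame g o p).choose_spec.1 he
    ((exists_frame g o p).choose_spec.2.trans ho.symm) (hF.alternating p)

theorem contDiffAt_dualPart {G F : E4 → Bil} {y : E4} {E : Fin 4 → E4 → E4}
    (hG : ContDiffAt ℝ ∞ G y) (hF : ContDiffAt ℝ ∞ F y) (hE : ∀ i, ContDiffAt ℝ ∞ (E i) y) (s : ℝ) :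
    ContDiffAt ℝ ∞ (fun z => dualPart (G z) (fun i => E i z) s (F z)) y := by
  have h1 : ∀ i j, ContDiffAt ℝ ∞ (fun z => F z (E i z) (E j z)) y := fun i j =>
    (hF.clm_apply (hE i)).clm_apply (hE j)
  have h2 : ∀ i j, ContDiffAt ℝ ∞ (fun z => flatWedge (G z) (E i z) (E j z)) y := fun i j =>
    ((hG.clm_apply (hE i)).smulRight (hG.clm_apply (hE j))).sub
      ((hG.clm_apply (hE j)).smulRight (hG.clm_apply (hE i)))
  have h3 : ∀ i j k l, ContDiffAt ℝ ∞
      (fun z => F z (E i z) (E j z) • flatWedge (G z) (E k z) (E l z)) y := fun i j k l =>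
    (h1 i j).smul (h2 k l)
  exact (hF.add (((((((h3 _ _ _ _).add (h3 _ _ _ _)).add (h3 _ _ _ _)).add (h3 _ _ _ _)).add
    (h3 _ _ _ _)).add (h3 _ _ _ _)).const_smul s)).const_smul (1 / 2 : ℝ)

/-- The chosen frames need not vary continuously; near each point they are exchanged for a smooth
oriented frame without changing the form. -/
theorem isTwoForm_selfDualPart (g : Metric M) (o : ManifoldOrientation M) {F : BilinField M}
    (hF : IsTwoForm F) : IsTwoForm (selfDualPart g o F) := by
  refine ⟨fun p v => dualPart_alternating _ _ _ (hF.alternating p) v, smoothBilin_iff.2 fun p => ?_⟩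
  obtain ⟨e, he, ho⟩ := exists_frame g o p
  obtain ⟨E, h1, h2, h3⟩ := exists_oriented_frame g o he ho
  refine ContDiffAt.congr_of_eventuallyEq (contDiffAt_dualPart (smoothBilin_iff.1 g.contMDiff p)
    (smoothBilin_iff.1 hF.smooth p) h1 1) ?_
  filter_upwards [h3] with z hz
  obtain ⟨-, b, hb, hbf, hbo⟩ := hz
  ext u v
  rw [localBilin_apply, selfDualPart_frame g o hF hbf hbo]
  simp only [dualPart_apply, localBilin_apply, hb]

theorem hodgeDual_selfDualPart (g : Metric M) (o : ManifoldOrientation M) {F : BilinField M}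
    (hF : IsTwoForm F) (p : M) : HodgeDual g o 1 p (selfDualPart g o F p) := by
  refine hodgeDual_iff.2 fun e he ho => ?_
  have := dualPart_dualIn he (s := 1) (by norm_num) (hF.alternating p)
  have h : DualIn 1 (bilinAt (selfDualPart g o F) p) e := by
    rw [selfDualPart_frame g o hF he ho]
    exact this
  exact h

theorem hodgeDual_selfDualPart_sub (g : Metric M) (o : ManifoldOrientation M) {F : BilinField M}
    (hF : IsTwoForm F) (p : M) : HodgeDual g o (-1) p (selfDualPart g o F p - F p) := by
  refine hodgeDual_iff.2 fun e he ho => ?_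
  have h1 := dualPart_dualIn he (s := -1) (F := bilinAt F p) (by norm_num) (hF.alternating p)
  have h2 := dualPart_add (bilinAt g.inner p) e (bilinAt F p)
  rw [← selfDualPart_frame g o hF he ho] at h2
  have h3 := h1.smul (-1)
  have h4 : (bilinAt (selfDualPart g o F) p - bilinAt F p : Bil) =
      (-1 : ℝ) • dualPart (bilinAt g.inner p) e (-1) (bilinAt F p) := by
    refine eq_of_sub_eq_zero ?_
    rw [← sub_eq_zero] at h2
    rw [← h2]
    module
  have h5 : DualIn (-1) (bilinAt (selfDualPart g o F) p - bilinAt F p) e := by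
    rw [h4]
    exact h3
  exact h5

/-! ### From Killing–Yano forms to twistor forms -/

section

variable {B : Bil} {e : Module.Basis (Fin 4) ℝ E4} {D : E4 → Bil}

/-- Half of the Hodge dual of a 3-form. -/
def torsionCovector (B : Bil) (e : Fin 4 → E4) (D : E4 → Bil) (c : E4) : ℝ :=
  (- D (e 1) (e 2) (e 3) * B (e 0) c + D (e 0) (e 2) (e 3) * B (e 1) c
    - D (e 0) (e 1) (e 3) * B (e 2) c + D (e 0) (e 1) (e 2) * B (e 3) c) / 2

theorem isLinearMap_torsionCovector (B : Bil) (e : Fin 4 → E4) (D : E4 → Bil) :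
    IsLinearMap ℝ (torsionCovector B e D) :=
  ⟨fun u v => by simp only [torsionCovector, map_add]; ring,
    fun r v => by simp only [torsionCovector, map_smul, smul_eq_mul]; ring⟩

/-- The self-dual part of `D a` is half of `D a + *D a`. The first term drops out under
symmetrization. Writing the 3-form as the Hodge dual of a covector turns the second into `B a b τ c
- B a c τ b`. -/
theorem dualPart_twistor (he : IsFrame B e) (hD : IsTrilin fun a b c => D a b c)
    (h1 : ∀ a b c, D a b c = - D b a c) (h2 : ∀ a b c, D a b c = - D a c b) (a b c : E4) :
    dualPart B e 1 (D a) b c + dualPart B e 1 (D b) a c = 2 * B a b * torsionCovector B e D c -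
      B a c * torsionCovector B e D b - B b c * torsionCovector B e D a := by
  have hz1 : ∀ a b, D a b b = 0 := fun a b => by linarith [h2 a b b]
  have hz2 : ∀ a b, D a a b = 0 := fun a b => by linarith [h1 a a b]
  rw [← sub_eq_zero]
  refine IsTrilin.eq_zero (f := fun a b c => dualPart B e 1 (D a) b c + dualPart B e 1 (D b) a c -
    (2 * B a b * torsionCovector B e D c - B a c * torsionCovector B e D b -
      B b c * torsionCovector B e D a)) ?_ e ?_ a b c
  · have f1 : ∀ u v b c, D (u + v) b c = D u b c + D v b c := fun u v b c => (hD.fst b c).map_add u v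
    have f2 : ∀ (r : ℝ) u b c, D (r • u) b c = r * D u b c := fun r u b c => (hD.fst b c).map_smul r u
    refine ⟨fun b c => ⟨fun x y => ?_, fun r x => ?_⟩, fun a c => ⟨fun x y => ?_, fun r x => ?_⟩,
      fun a b => ⟨fun x y => ?_, fun r x => ?_⟩⟩ <;>
    simp only [dualPart_apply, torsionCovector, f1, f2, map_add, map_smul, add_apply, smul_apply,
      smul_eq_mul] <;> ring
  · intro i j k
    obtain ⟨d, hd⟩ : ∃ d : Fin 4 → Fin 4 → Fin 4 → ℝ, ∀ i j k, D (e i) (e j) (e k) = d i j k :=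
      ⟨_, fun _ _ _ => rfl⟩
    have s1 : ∀ i j k, d i j k = - d j i k := fun i j k => by rw [← hd, ← hd, h1]
    have s2 : ∀ i j k, d k i j = - d k j i := fun i j k => by rw [← hd, ← hd, h2]
    have z1 : ∀ i j, d i j j = 0 := fun i j => by rw [← hd, hz1]
    have z2 : ∀ i j, d i i j = 0 := fun i j => by rw [← hd, hz2]
    simp only [dualPart_apply, torsionCovector, he _ _, hd]
    clear hd he hD h1 h2 hz1 hz2
    fin_cases i <;> fin_cases j <;> fin_cases k <;>
    simp only [Fin.zero_eta, Fin.mk_one, Fin.reduceFinMk, s1 1 0, s1 2 0, s1 3 0, s1 2 1, s1 3 1,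
      s1 3 2, s2 1 0, s2 2 0, s2 3 0, s2 2 1, s2 3 1, s2 3 2, z1, z2, Fin.reduceEq, if_true,
      if_false] <;>
    ring

/-- The four components of the covector are, up to factors `±1/2`, the four components of the
3-form. -/
theorem eq_zero_of_torsionCovector (he : IsFrame B e) (hD : IsTrilin fun a b c => D a b c)
    (h1 : ∀ a b c, D a b c = - D b a c) (h2 : ∀ a b c, D a b c = - D a c b)
    (h0 : ∀ c, torsionCovector B e D c = 0) (a b c : E4) : D a b c = 0 := by
  have hz1 : ∀ a b, D a b b = 0 := fun a b => by linarith [h2 a b b]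
  have hz2 : ∀ a b, D a a b = 0 := fun a b => by linarith [h1 a a b]
  have c0 := h0 (e 0)
  have c1 := h0 (e 1)
  have c2 := h0 (e 2)
  have c3 := h0 (e 3)
  simp only [torsionCovector, he _ _, Fin.reduceEq, if_true, if_false] at c0 c1 c2 c3
  have d0 : D (e 1) (e 2) (e 3) = 0 := by linarith
  have d1 : D (e 0) (e 2) (e 3) = 0 := by linarith
  have d2 : D (e 0) (e 1) (e 3) = 0 := by linarith
  have d3 : D (e 0) (e 1) (e 2) = 0 := by linarith
  have s1 : ∀ i j : Fin 4, ∀ c, D (e i) (e j) c = - D (e j) (e i) c := fun i j c => h1 _ _ _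
  have s2 : ∀ i j : Fin 4, ∀ a, D a (e i) (e j) = - D a (e j) (e i) := fun i j a => h2 _ _ _
  refine IsTrilin.eq_zero hD e (fun i j k => ?_) a b c
  fin_cases i <;> fin_cases j <;> fin_cases k <;>
  simp only [Fin.zero_eta, Fin.mk_one, Fin.reduceFinMk,
    s1 1 0, s1 2 0, s1 3 0, s1 2 1, s1 3 1, s1 3 2, s2 1 0, s2 2 0, s2 3 0, s2 2 1, s2 3 1,
    s2 3 2, hz1, hz2, d0, d1, d2, d3, neg_zero]

end

/-- Twistor 2-forms of duality `s`. -/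
structure IsTwistorForm (g : Metric M) (o : ManifoldOrientation M) (s : ℝ) (Z : BilinField M) :
    Prop where
  isTwoForm : IsTwoForm Z
  hodgeDual : ∀ p, HodgeDual g o s p (Z p)
  twistor : ∀ p, IsTwistor (bilinAt g.inner p) fun a b c => covBil g Z p a b c

/-- A Killing–Yano form that is not parallel is the difference of a self-dual and an anti-self-dual
twistor form with the same divergence. -/
theorem IsKillingYano.exists_twistorForms {g : Metric M} (o : ManifoldOrientation M)
    {Y : BilinField M} (hY : IsKillingYano g Y) (hne : ¬ IsParallel g Y) :
    ∃ Z₁ Z₂ : BilinField M, IsTwistorForm g o 1 Z₁ ∧ IsTwistorForm g o (-1) Z₂ ∧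
      (∀ p, bilinAt Y p = bilinAt Z₁ p - bilinAt Z₂ p) ∧
      (∀ p (c : E4), hamiltonian g Z₁ p c = hamiltonian g Z₂ p c) ∧
      ∃ p, ∃ c : E4, hamiltonian g Z₁ p c ≠ 0 := by
  have hT := hY.isTwoForm
  have hT₁ := isTwoForm_selfDualPart g o hT
  have hT₂ := hT₁.sub hT
  have hd₁ := hodgeDual_selfDualPart g o hT
  have hd₂ := hodgeDual_selfDualPart_sub g o hT
  have hsub := covBil_sub g hT₁.smooth hT.smooth
  have hD2 : ∀ p a b c, covBil g Y p a b c = - covBil g Y p a c b := fun p a b c =>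
    skew_of_alternating (covBil_alternating g hT p a) b c
  have hD1 : ∀ p a b c, covBil g Y p a b c = - covBil g Y p b a c := fun p a b c => by
    have := hY.killingYano p a b c
    rw [← covBil_apply, ← covBil_apply] at this
    linarith
  -- Taking self-dual parts commutes with `∇`: both `∇Z₁` and `-∇Z₂` have definite duality and add
  -- up to `∇Y`, and such a decomposition is unique.
  have hcov : ∀ {p} {e : Module.Basis (Fin 4) ℝ E4}, IsFrame (bilinAt g.inner p) e →
      e.orientation = o.orient p → ∀ a, covBil g (selfDualPart g o Y) p a =
        dualPart (bilinAt g.inner p) e 1 (covBil g Y p a) := by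
    intro p e he ho a
    have halt := covBil_alternating g hT p a
    refine (DualIn.unique (e := e) (covBil_alternating g hT₁ p a)
      (dualPart_alternating _ _ _ halt) (covBil_dualIn (Or.inl rfl) hT₁ hd₁ he ho a)
      (dualPart_dualIn he (by norm_num) halt)
      ((covBil_dualIn (Or.inr rfl) hT₂ hd₂ he ho a).smul (-1))
      (dualPart_dualIn he (by norm_num) halt) ?_).1
    rw [dualPart_add]
    ext u v
    simp only [add_apply, smul_apply, hsub, smul_eq_mul]
    ring
  have htw : ∀ p, ∀ {e : Module.Basis (Fin 4) ℝ E4}, IsFrame (bilinAt g.inner p) e →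
      e.orientation = o.orient p → ∀ a b c, covBil g (selfDualPart g o Y) p a b c +
        covBil g (selfDualPart g o Y) p b a c =
        2 * bilinAt g.inner p a b * torsionCovector (bilinAt g.inner p) e (covBil g Y p) c -
        bilinAt g.inner p a c * torsionCovector (bilinAt g.inner p) e (covBil g Y p) b -
        bilinAt g.inner p b c * torsionCovector (bilinAt g.inner p) e (covBil g Y p) a := by
    intro p e he ho a b c
    rw [hcov he ho, hcov he ho]
    exact dualPart_twistor he (isTrilin_covBil g Y p) (hD1 p) (hD2 p) a b c
  refine ⟨selfDualPart g o Y, fun p => selfDualPart g o Y p - Y p, ⟨hT₁, hd₁, fun p => ?_⟩,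
    ⟨hT₂, hd₂, fun p => ?_⟩, fun p => ?_, fun p c => ?_, ?_⟩
  · obtain ⟨e, he, ho⟩ := exists_frame g o p
    exact ⟨_, isLinearMap_torsionCovector _ _ _, htw p he ho⟩
  · obtain ⟨e, he, ho⟩ := exists_frame g o p
    refine ⟨_, isLinearMap_torsionCovector (bilinAt g.inner p) e (covBil g Y p), fun a b c => ?_⟩
    refine Eq.trans ?_ (htw p he ho a b c)
    -- `Z₂` differs from `Z₁` by `Y`, whose symmetrized derivative vanishes, so it satisfies the
    -- same equation with the same `τ`.
    simp only [hsub]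
    linarith [hD1 p a b c]
  · exact (sub_sub_cancel (selfDualPart g o Y p : Bil) (Y p)).symm
  · obtain ⟨e, he, ho⟩ := exists_frame g o p
    rw [hamiltonian_frame g _ p he, hamiltonian_frame g _ p he]
    congr 1
    refine Finset.sum_congr rfl fun i _ => ?_
    rw [hsub]
    -- A Killing–Yano form has zero divergence, term by term.
    linarith [hD1 p (e i) (e i) c]
  · by_contra! hz
    -- Zero divergence of `Z₁` means `τ = 0`, and `τ` determines the 3-form `∇Y`.
    refine hne fun p a b c => ?_
    obtain ⟨e, he, ho⟩ := exists_frame g o p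
    refine (covBil_apply g Y p a b c).symm.trans ?_
    refine eq_zero_of_torsionCovector he (isTrilin_covBil g Y p) (hD1 p) (hD2 p) (fun c => ?_) a b c
    have h1 := hz p c
    rw [hamiltonian_frame g _ p he, IsTwistor.trace (isLinearMap_torsionCovector _ _ _)
      (htw p he ho) he] at h1
    linarith

/-! ### The conformal Hermitian structure of a dual 2-form -/

/-- The endomorphism `K` with `B(K a, b) = F(a, b)`. -/
def sharp (B F : Bil) : E4 →L[ℝ] E4 := B.inverse.comp F

theorem IsInner.apply_sharp {B : Bil} (hB : IsInner B) (F : Bil) (a b : E4) :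
    B (sharp B F a) b = F a b := by
  rw [sharp, ContinuousLinearMap.comp_apply, hB.apply_inverse]

/-- The number `r` such that `K² = -r`, for an endomorphism `K` whose square is a scalar. -/
def negSq (K : E4 →L[ℝ] E4) : ℝ := - (K (K (EuclideanSpace.single 0 1))) 0

/-- For scalar `K²` one matrix entry determines `r` in any coordinates, so a single polynomial,
hence smooth, formula serves in every chart. -/
theorem negSq_eq {K : E4 →L[ℝ] E4} {r : ℝ} (h : ∀ v, K (K v) = -r • v) : negSq K = r := by
  simp [negSq, h]

/-- The matrix of a form of definite duality is that of multiplication by an imaginary quaternion.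
Thus `K` is a similarity with factor `r` (`key`), and skewness turns `KᵀK = r` into `K² = -r`. -/
theorem IsInner.sharp_sharp {B : Bil} (hB : IsInner B) {e : Module.Basis (Fin 4) ℝ E4}
    (he : IsFrame B e) {F : Bil} (hF : ∀ v, F v v = 0) {s : ℝ} (hs : s = 1 ∨ s = -1)
    (hd : DualIn s F e) (v : E4) :
    sharp B F (sharp B F v) =
      -(F (e 0) (e 1) ^ 2 + F (e 0) (e 2) ^ 2 + F (e 0) (e 3) ^ 2) • v := by
  set r := F (e 0) (e 1) ^ 2 + F (e 0) (e 2) ^ 2 + F (e 0) (e 3) ^ 2 with hr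
  have t := skew_of_alternating hF
  have hl : ∀ a b, F a b = ∑ i, B (e i) a * F (e i) b := fun a b => by
    conv_lhs => rw [he.expand a]
    simp only [map_sum, map_smul, sum_apply, smul_apply, smul_eq_mul]
  have key : ∀ a b, B (sharp B F a) (sharp B F b) = r * B a b := by
    intro a b
    have e1 : B (sharp B F a) (sharp B F b) = ∑ k, F b (e k) * F a (e k) := by
      conv_lhs => rw [he.expand (sharp B F b)]
      simp only [map_sum, map_smul, smul_eq_mul, hB.symm (e _) (sharp B F b), hB.apply_sharp]
    have e2 : B a b = ∑ k, B (e k) b * B (e k) a := by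
      conv_lhs => rw [he.expand b]
      simp only [map_sum, map_smul, smul_eq_mul, hB.symm (e _) a]
    obtain ⟨d1, d2, d3⟩ := hd
    rw [e1, e2, hr]
    simp only [hl a, hl b, Fin.sum_univ_four, hF, t (e 1) (e 0), t (e 2) (e 0), t (e 3) (e 0),
      t (e 2) (e 1), t (e 1) (e 3), t (e 3) (e 2), d1, d2, d3]
    generalize F (e 2) (e 3) = x
    generalize F (e 3) (e 1) = y
    generalize F (e 1) (e 2) = w
    rcases hs with rfl | rfl <;> ring
  refine hB.ext fun c => ?_
  rw [hB.apply_sharp, t, ← hB.apply_sharp, key, hB.symm c v, map_smul, smul_apply, smul_eq_mul]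
  ring

theorem DualIn.eq_zero_of_sq {e : Module.Basis (Fin 4) ℝ E4} {F : Bil} (hF : ∀ v, F v v = 0) {s : ℝ}
    (hs : s = 1 ∨ s = -1) (hd : DualIn s F e)
    (h : F (e 0) (e 1) ^ 2 + F (e 0) (e 2) ^ 2 + F (e 0) (e 3) ^ 2 = 0) : F = 0 := by
  have h1 : F (e 0) (e 1) = 0 := by nlinarith [sq_nonneg (F (e 0) (e 2)), sq_nonneg (F (e 0) (e 3))]
  have h2 : F (e 0) (e 2) = 0 := by nlinarith [sq_nonneg (F (e 0) (e 1)), sq_nonneg (F (e 0) (e 3))]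
  have h3 : F (e 0) (e 3) = 0 := by nlinarith [sq_nonneg (F (e 0) (e 2)), sq_nonneg (F (e 0) (e 1))]
  obtain ⟨d1, d2, d3⟩ := hd
  have t := skew_of_alternating hF (e 3) (e 1)
  rw [h1] at d1
  rw [h2] at d2
  rw [h3] at d3
  apply alternating_ext e hF (by simp) <;> simp only [zero_apply, h1, h2, h3] <;>
    rcases hs with rfl | rfl <;> linarith

theorem contDiffAt_sharp {G F : E4 → Bil} {y : E4} (hG : ContDiffAt ℝ ∞ G y) (hi : IsInner (G y))
    (hF : ContDiffAt ℝ ∞ F y) : ContDiffAt ℝ ∞ (fun z => sharp (G z) (F z)) y :=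
  (contDiffAt_inverse hG hi).clm_comp hF

theorem contDiffAt_negSq {K : E4 → E4 →L[ℝ] E4} {y : E4} (hK : ContDiffAt ℝ ∞ K y) :
    ContDiffAt ℝ ∞ (fun z => negSq (K z)) y :=
  ((EuclideanSpace.proj (0 : Fin 4)).contDiff.contDiffAt.comp y
    (hK.clm_apply (hK.clm_apply contDiffAt_const))).neg

/-- The square of the norm of a 2-form with the duality of a complex structure. -/
def formNormSq (g : Metric M) (Z : BilinField M) (p : M) : ℝ :=
  negSq (sharp (bilinAt g.inner p) (bilinAt Z p))

/-- The conformal factor of a dual 2-form. -/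
def formFactor (g : Metric M) (Z : BilinField M) (p : M) : ℝ := (Real.sqrt (formNormSq g Z p))⁻¹

/-- The almost complex structure of a dual 2-form. -/
def formComplex (g : Metric M) (Z : BilinField M) : EndField M :=
  fun p => formFactor g Z p • sharp (bilinAt g.inner p) (bilinAt Z p)

theorem isOpen_ne_zero {Z : BilinField M} (hZ : SmoothBilin Z) : IsOpen {p | bilinAt Z p ≠ 0} := by
  refine isOpen_iff_mem_nhds.2 fun p hp => ?_
  have hc : ContinuousAt (fun q => localBilin Z p (extChartAt (𝓡 4) p q)) p :=
    ContinuousAt.comp (g := localBilin Z p) (smoothBilin_iff.1 hZ p).continuousAt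
      (continuousAt_extChartAt p)
  have hp' : localBilin Z p (extChartAt (𝓡 4) p p) ≠ 0 := by
    rw [localBilin_self]
    exact hp
  filter_upwards [hc.eventually_ne hp',
    (chartAt E4 p).open_source.mem_nhds (mem_chart_source E4 p)] with q hq hqs hq0
  refine hq ?_
  ext a b
  rw [localBilin_apply' Z hqs, hq0]
  rfl

theorem coordMap_sharp (g : Metric M) (Z : BilinField M) {p : M} {z : E4}
    (hz : z ∈ (extChartAt (𝓡 4) p).target) (v : E4) :
    coordMap p ((extChartAt (𝓡 4) p).symm z) (sharp (localBilin g.inner p z) (localBilin Z p z) v) =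
      sharp (bilinAt g.inner ((extChartAt (𝓡 4) p).symm z))
        (bilinAt Z ((extChartAt (𝓡 4) p).symm z)) (coordMap p ((extChartAt (𝓡 4) p).symm z) v) := by
  refine (metric_isInner g ((extChartAt (𝓡 4) p).symm z)).ext fun c => ?_
  obtain ⟨c, rfl⟩ := coordMap_surjective (extChartAt_symm_mem hz) c
  rw [(metric_isInner g _).apply_sharp, ← localBilin_apply, ← localBilin_apply,
    (localMetric_isInner g hz).apply_sharp]

section

variable {g : Metric M} {o : ManifoldOrientation M} {s : ℝ} {Z : BilinField M}

theorem sharp_sharp_of_hodgeDual (hs : s = 1 ∨ s = -1) (hZ : IsTwoForm Z) {p : M}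
    (hd : HodgeDual g o s p (Z p)) (v : E4) :
    sharp (bilinAt g.inner p) (bilinAt Z p) (sharp (bilinAt g.inner p) (bilinAt Z p) v) =
      -formNormSq g Z p • v := by
  obtain ⟨e, he, ho⟩ := exists_frame g o p
  have h := (metric_isInner g p).sharp_sharp he (F := bilinAt Z p) (hZ.alternating p) hs
    (hodgeDual_iff.1 hd e he ho)
  rw [h, formNormSq, negSq_eq h]

theorem formNormSq_pos (hs : s = 1 ∨ s = -1) (hZ : IsTwoForm Z) {p : M}
    (hd : HodgeDual g o s p (Z p)) (hp : bilinAt Z p ≠ 0) : 0 < formNormSq g Z p := by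
  obtain ⟨e, he, ho⟩ := exists_frame g o p
  have hd' : DualIn s (bilinAt Z p) e := hodgeDual_iff.1 hd e he ho
  have h := (metric_isInner g p).sharp_sharp he (F := bilinAt Z p) (hZ.alternating p) hs hd'
  rw [formNormSq, negSq_eq h]
  refine lt_of_le_of_ne (by positivity) fun h0 => hp ?_
  exact hd'.eq_zero_of_sq (hZ.alternating p) hs h0.symm

theorem negSq_local (hs : s = 1 ∨ s = -1) (hZ : IsTwoForm Z) (hd : ∀ p, HodgeDual g o s p (Z p))
    {p : M} {z : E4} (hz : z ∈ (extChartAt (𝓡 4) p).target) :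
    negSq (sharp (localBilin g.inner p z) (localBilin Z p z)) =
      formNormSq g Z ((extChartAt (𝓡 4) p).symm z) := by
  refine negSq_eq fun v => coordMap_injective (extChartAt_symm_mem hz) ?_
  rw [coordMap_sharp g Z hz, coordMap_sharp g Z hz, sharp_sharp_of_hodgeDual hs hZ (hd _), map_smul]

theorem contDiffAt_formFactor (hs : s = 1 ∨ s = -1) (hZ : IsTwoForm Z)
    (hd : ∀ p, HodgeDual g o s p (Z p)) {p : M} (hp : bilinAt Z p ≠ 0) :
    ContDiffAt ℝ ∞ (formFactor g Z ∘ (extChartAt (𝓡 4) p).symm) (extChartAt (𝓡 4) p p) := by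
  have hi := (eventually_localMetric_isInner g p).self_of_nhds
  have h1 := contDiffAt_negSq (contDiffAt_sharp (smoothBilin_iff.1 g.contMDiff p) hi
    (smoothBilin_iff.1 hZ.smooth p))
  have hpos : 0 < negSq (sharp (localBilin g.inner p (extChartAt (𝓡 4) p p))
      (localBilin Z p (extChartAt (𝓡 4) p p))) := by
    rw [localBilin_self, localBilin_self]
    exact formNormSq_pos hs hZ (hd p) hp
  refine ContDiffAt.congr_of_eventuallyEq
    ((h1.sqrt hpos.ne').inv (Real.sqrt_pos.2 hpos).ne') ?_
  filter_upwards [extChartAt_target_mem_nhds' (mem_extChartAt_target (I := 𝓡 4) p)] with z hz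
  exact congrArg (fun x => (Real.sqrt x)⁻¹) (negSq_local hs hZ hd hz).symm

theorem contDiffAt_formComplex (hs : s = 1 ∨ s = -1) (hZ : IsTwoForm Z)
    (hd : ∀ p, HodgeDual g o s p (Z p)) {p : M} (hp : bilinAt Z p ≠ 0) :
    ContDiffAt ℝ ∞ (localEnd (formComplex g Z) p) (extChartAt (𝓡 4) p p) := by
  have hi := (eventually_localMetric_isInner g p).self_of_nhds
  refine ContDiffAt.congr_of_eventuallyEq ((contDiffAt_formFactor hs hZ hd hp).smul
    (contDiffAt_sharp (smoothBilin_iff.1 g.contMDiff p) hi (smoothBilin_iff.1 hZ.smooth p))) ?_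
  filter_upwards [extChartAt_target_mem_nhds' (mem_extChartAt_target (I := 𝓡 4) p)] with z hz
  ext1 v
  refine coordMap_injective (extChartAt_symm_mem hz) ?_
  rw [coordMap_localEnd _ (extChartAt_symm_mem hz), Pi.smul_apply', smul_apply, map_smul,
    coordMap_sharp g Z hz]
  rfl

/-- `Z = Ω⁻¹κ` requires `J = ΩK`, and then `J² = -1` requires `Ω² r = 1`; this is where `formFactor`
comes from. Compatibility with the metric follows from `J² = -1` and skewness of `Z`. -/
theorem isConformalHermitianOn_form (hs : s = 1 ∨ s = -1) (hZ : IsTwoForm Z)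
    (hd : ∀ p, HodgeDual g o s p (Z p)) :
    IsConformalHermitianOn g o s {p | bilinAt Z p ≠ 0} (formFactor g Z) (formComplex g Z) := by
  have hU := isOpen_ne_zero hZ.smooth
  have hpos : ∀ p ∈ {p | bilinAt Z p ≠ 0}, 0 < formNormSq g Z p := fun p hp =>
    formNormSq_pos hs hZ (hd p) hp
  have hsq : ∀ p ∈ {p | bilinAt Z p ≠ 0}, formFactor g Z p * (formFactor g Z p *
      formNormSq g Z p) = 1 := fun p hp => by
    have h1 := Real.mul_self_sqrt (hpos p hp).le
    have h2 := (Real.sqrt_pos.2 (hpos p hp)).ne'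
    rw [formFactor]
    field_simp
    rw [pow_two, h1]
  have hJ : ∀ (p : M) (v : E4), endAt (formComplex g Z) p v =
      formFactor g Z p • sharp (bilinAt g.inner p) (bilinAt Z p) v := fun p v => rfl
  have hJJ : ∀ p ∈ {p | bilinAt Z p ≠ 0}, ∀ v : E4,
      endAt (formComplex g Z) p (endAt (formComplex g Z) p v) = -v := fun p hp v => by
    rw [hJ, hJ, map_smul, sharp_sharp_of_hodgeDual hs hZ (hd p), smul_smul, smul_smul,
      mul_neg, mul_assoc, hsq p hp, neg_one_smul]
  have hk : ∀ (p : M) (a b : E4), bilinAt g.inner p (endAt (formComplex g Z) p a) b =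
      formFactor g Z p * bilinAt Z p a b := fun p a b => by
    rw [hJ, map_smul, smul_apply, (metric_isInner g p).apply_sharp, smul_eq_mul]
  refine ⟨hU, (contMDiffOn_scalar_iff hU).2 fun p hp => contDiffAt_formFactor hs hZ hd hp,
    fun p hp => inv_ne_zero (Real.sqrt_pos.2 (hpos p hp)).ne',
    (smoothEndOn_iff hU).2 fun p hp => contDiffAt_formComplex hs hZ hd hp, hJJ,
    fun p hp v w => ?_, fun p hp => ?_⟩
  · have t := skew_of_alternating (F := bilinAt Z p) (hZ.alternating p)
    rw [hk, t, mul_neg, ← hk, hJJ p hp, map_neg, neg_apply, neg_neg, (metric_isInner g p).symm]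
  · have h1 : (fundamentalForm g.inner (formComplex g Z) p : Bil) =
        formFactor g Z p • bilinAt Z p := by
      ext a b
      exact hk p a b
    refine hodgeDual_iff.2 fun e he ho => ?_
    have h2 : DualIn s (bilinAt Z p) e := hodgeDual_iff.1 (hd p) e he ho
    have h3 := h2.smul (formFactor g Z p)
    rw [← h1] at h3
    exact h3

theorem killingForm_form (hs : s = 1 ∨ s = -1) (hZ : IsTwoForm Z)
    (hd : ∀ p, HodgeDual g o s p (Z p)) {p : M} (hp : bilinAt Z p ≠ 0) :
    Z p = killingForm g (formFactor g Z) (formComplex g Z) p := by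
  have h0 : formFactor g Z p ≠ 0 := (isConformalHermitianOn_form hs hZ hd).ne_zero p hp
  have h : bilinAt Z p = bilinAt (killingForm g (formFactor g Z) (formComplex g Z)) p := by
    ext a b
    have h1 : bilinAt (killingForm g (formFactor g Z) (formComplex g Z)) p a b =
      (formFactor g Z p)⁻¹ * bilinAt g.inner p (formFactor g Z p •
        sharp (bilinAt g.inner p) (bilinAt Z p) a) b := rfl
    rw [h1, map_smul, smul_apply, (metric_isInner g p).apply_sharp, smul_eq_mul,
      inv_mul_cancel_left₀ h0]
  exact h

/-- A twistor form of definite duality gives a conformal Kähler structure where it does not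
vanish. -/
theorem IsTwistorForm.isConformallyKahlerOn (hs : s = 1 ∨ s = -1) (h : IsTwistorForm g o s Z) :
    IsConformallyKahlerOn g o s {p | bilinAt Z p ≠ 0} (formFactor g Z) (formComplex g Z) := by
  have hc := isConformalHermitianOn_form hs h.isTwoForm h.hodgeDual
  have hk := fun p hp => ((hc.twistor_iff hs (fun p hp => killingForm_form hs h.isTwoForm
    h.hodgeDual hp) hp).1.2 (h.twistor p) : _)
  refine ⟨hc.smooth, hc.ne_zero, ⟨hc.smoothEnd, hc.sq, fun p hp v w => ?_,
    fun p hp => (hk p hp).1, fun p hp => (hk p hp).2⟩, hc.oriented⟩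
  exact congrArg (fun x : ℝ => formFactor g Z p ^ 2 * x) (hc.compatible p hp v w)

end

/-! ### Closed systems of linear first-order equations -/

/-- Partial derivatives in the direction of the standard basis. -/
def pd (a : Fin 4) (f : E4 → ℝ) (y : E4) : ℝ := fderiv ℝ f y (stdBasis a)

/-- Smoothness at all points of a set. -/
def SmoothAt (O : Set E4) (f : E4 → ℝ) : Prop := ∀ y ∈ O, ContDiffAt ℝ ∞ f y

/-- Combinations on `O` of the functions `s i`, with smooth coefficients. -/
def SmoothSpan {ι : Type*} [Fintype ι] (O : Set E4) (s : ι → E4 → ℝ) (f : E4 → ℝ) : Prop :=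
  ∃ c : ι → E4 → ℝ, (∀ i, SmoothAt O (c i)) ∧ ∀ y ∈ O, f y = ∑ i, c i y * s i y

section

variable {O : Set E4} {f f' : E4 → ℝ} {ι κ : Type*} [Fintype ι] [Fintype κ] {s : ι → E4 → ℝ}
  {s' : κ → E4 → ℝ}

theorem SmoothAt.differentiableAt (h : SmoothAt O f) {y : E4} (hy : y ∈ O) :
    DifferentiableAt ℝ f y := (h y hy).differentiableAt (by simp)

theorem smoothAt_const (r : ℝ) : SmoothAt O fun _ => r := fun _ _ => contDiffAt_const

theorem SmoothAt.add (h : SmoothAt O f) (h' : SmoothAt O f') : SmoothAt O fun y => f y + f' y :=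
  fun y hy => (h y hy).add (h' y hy)

theorem SmoothAt.sub (h : SmoothAt O f) (h' : SmoothAt O f') : SmoothAt O fun y => f y - f' y :=
  fun y hy => (h y hy).sub (h' y hy)

theorem SmoothAt.mul (h : SmoothAt O f) (h' : SmoothAt O f') : SmoothAt O fun y => f y * f' y :=
  fun y hy => (h y hy).mul (h' y hy)

theorem smoothAt_sum {F : ι → E4 → ℝ} (h : ∀ i, SmoothAt O (F i)) :
    SmoothAt O fun y => ∑ i, F i y := fun y hy => ContDiffAt.sum fun i _ => h i y hy

theorem SmoothAt.pd (h : SmoothAt O f) (a : Fin 4) : SmoothAt O (pd a f) := fun y hy =>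
  ((h y hy).fderiv_right (m := ∞) (by simp)).clm_apply contDiffAt_const

theorem pd_congr (hO : IsOpen O) (h : ∀ y ∈ O, f y = f' y) (a : Fin 4) {y : E4} (hy : y ∈ O) :
    pd a f y = pd a f' y := by
  have : f =ᶠ[𝓝 y] f' := by
    filter_upwards [hO.mem_nhds hy] with z hz using h z hz
  rw [pd, this.fderiv_eq, pd]

theorem pd_add (h : SmoothAt O f) (h' : SmoothAt O f') (a : Fin 4) {y : E4} (hy : y ∈ O) :
    pd a (fun y => f y + f' y) y = pd a f y + pd a f' y := by
  simp only [pd]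
  rw [fderiv_fun_add (h.differentiableAt hy) (h'.differentiableAt hy), add_apply]

theorem pd_sub (h : SmoothAt O f) (h' : SmoothAt O f') (a : Fin 4) {y : E4} (hy : y ∈ O) :
    pd a (fun y => f y - f' y) y = pd a f y - pd a f' y := by
  simp only [pd]
  rw [fderiv_fun_sub (h.differentiableAt hy) (h'.differentiableAt hy), sub_apply]

theorem pd_mul (h : SmoothAt O f) (h' : SmoothAt O f') (a : Fin 4) {y : E4} (hy : y ∈ O) :
    pd a (fun y => f y * f' y) y = pd a f y * f' y + f y * pd a f' y := by
  simp only [pd]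
  rw [fderiv_fun_mul (h.differentiableAt hy) (h'.differentiableAt hy)]
  simp only [add_apply, smul_apply, smul_eq_mul]
  ring

theorem pd_sum {F : ι → E4 → ℝ} (h : ∀ i, SmoothAt O (F i)) (a : Fin 4) {y : E4} (hy : y ∈ O) :
    pd a (fun y => ∑ i, F i y) y = ∑ i, pd a (F i) y := by
  simp only [pd]
  rw [fderiv_fun_sum fun i _ => (h i).differentiableAt hy, sum_apply]

theorem pd_comm (h : SmoothAt O f) (a b : Fin 4) {y : E4} (hy : y ∈ O) :
    pd a (pd b f) y = pd b (pd a f) y := by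
  have hd : DifferentiableAt ℝ (fderiv ℝ f) y :=
    ((h y hy).fderiv_right (m := ∞) (by simp)).differentiableAt (by simp)
  have key : ∀ a b, pd a (pd b f) y = fderiv ℝ (fderiv ℝ f) y (stdBasis a) (stdBasis b) := by
    intro a b
    have h1 := hd.hasFDerivAt.clm_apply (hasFDerivAt_const (𝕜 := ℝ) (stdBasis b) y)
    have h2 : HasFDerivAt (pd b f) _ y := h1
    rw [pd, h2.fderiv]
    simp
  rw [key, key]
  exact (h y hy).isSymmSndFDerivAt (by
    rw [minSmoothness_of_isRCLikeNormedField]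
    exact WithTop.coe_le_coe.2 (le_top : (2 : ℕ∞) ≤ ⊤)) _ _

theorem SmoothSpan.congr (h : SmoothSpan O s f) (he : ∀ y ∈ O, f' y = f y) : SmoothSpan O s f' := by
  obtain ⟨c, hc, h⟩ := h
  exact ⟨c, hc, fun y hy => (he y hy).trans (h y hy)⟩

theorem smoothSpan_self (s : ι → E4 → ℝ) (i : ι) : SmoothSpan O s (s i) := by
  classical
  exact ⟨fun j _ => if j = i then 1 else 0, fun j => smoothAt_const _, fun y _ => by simp⟩

theorem smoothSpan_zero : SmoothSpan O s fun _ => 0 :=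
  ⟨fun _ _ => 0, fun _ => smoothAt_const _, fun y _ => by simp⟩

theorem SmoothSpan.add (h : SmoothSpan O s f) (h' : SmoothSpan O s f') :
    SmoothSpan O s fun y => f y + f' y := by
  obtain ⟨c, hc, h⟩ := h
  obtain ⟨c', hc', h'⟩ := h'
  refine ⟨fun i y => c i y + c' i y, fun i => (hc i).add (hc' i), fun y hy => ?_⟩
  beta_reduce
  rw [h y hy, h' y hy, ← Finset.sum_add_distrib]
  exact Finset.sum_congr rfl fun i _ => by ring

theorem SmoothSpan.mul (h : SmoothSpan O s f) (hf : SmoothAt O f') :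
    SmoothSpan O s fun y => f' y * f y := by
  obtain ⟨c, hc, h⟩ := h
  refine ⟨fun i y => f' y * c i y, fun i => hf.mul (hc i), fun y hy => ?_⟩
  beta_reduce
  rw [h y hy, Finset.mul_sum]
  exact Finset.sum_congr rfl fun i _ => by ring

theorem SmoothSpan.const_mul (h : SmoothSpan O s f) (r : ℝ) : SmoothSpan O s fun y => r * f y :=
  h.mul (smoothAt_const r)

theorem SmoothSpan.sub (h : SmoothSpan O s f) (h' : SmoothSpan O s f') :
    SmoothSpan O s fun y => f y - f' y :=
  (h.add (h'.const_mul (-1))).congr fun y _ => by ring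

theorem smoothSpan_sum {F : κ → E4 → ℝ} (h : ∀ i, SmoothSpan O s (F i)) :
    SmoothSpan O s fun y => ∑ i, F i y := by
  classical
  have : ∀ t : Finset κ, SmoothSpan O s fun y => ∑ i ∈ t, F i y := by
    intro t
    induction t using Finset.induction_on with
    | empty => exact smoothSpan_zero.congr fun y _ => by simp
    | insert i t hi ih => exact ((h i).add ih).congr fun y _ => by rw [Finset.sum_insert hi]
  exact this Finset.univ

theorem SmoothSpan.trans (h : SmoothSpan O s f) (hs : ∀ i, SmoothSpan O s' (s i)) :
    SmoothSpan O s' f := by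
  obtain ⟨c, hc, h⟩ := h
  exact (smoothSpan_sum fun i => (hs i).mul (hc i)).congr h

/-- Leibniz rule. The target family may be larger than the original one, as happens when derivatives
raise the order of the jet. -/
theorem SmoothSpan.pd (hO : IsOpen O) (h : SmoothSpan O s f) (hs : ∀ i, SmoothAt O (s i))
    (hs' : ∀ i, SmoothSpan O s' (s i)) (a : Fin 4)
    (hp : ∀ i, SmoothSpan O s' (pd a (s i))) : SmoothSpan O s' (pd a f) := by
  obtain ⟨c, hc, h⟩ := h
  refine (smoothSpan_sum fun i => ((hs' i).mul ((hc i).pd a)).add ((hp i).mul (hc i))).congr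
    fun y hy => ?_
  rw [pd_congr hO h a hy, pd_sum (fun i => (hc i).mul (hs i)) a hy]
  exact Finset.sum_congr rfl fun i _ => pd_mul (hc i) (hs i) a hy

/-- A solution of a closed linear system on a convex set vanishes if it vanishes at a point. -/
theorem eq_zero_of_smoothSpan (hO : Convex ℝ O) (hs : ∀ i, SmoothAt O (s i))
    (hp : ∀ a i, SmoothSpan O s (pd a (s i))) {y₀ y₁ : E4} (h₀ : y₀ ∈ O) (h₁ : y₁ ∈ O)
    (hz : ∀ i, s i y₀ = 0) (i : ι) : s i y₁ = 0 := by
  choose c hc hpc using hp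
  set v := y₁ - y₀ with hv
  set γ : ℝ → E4 := fun t => y₀ + t • v with hγ
  have hγO : ∀ t ∈ Set.Icc (0 : ℝ) 1, γ t ∈ O := fun t ht => hO.add_smul_sub_mem h₀ h₁ ht
  have hγd : ∀ t, HasDerivAt γ v t := fun t =>
    (((hasDerivAt_id t).smul_const v).const_add y₀).congr_deriv (one_smul ℝ v)
  set u : ℝ → ι → ℝ := fun t i => s i (γ t) with hu
  have hud : ∀ t ∈ Set.Icc (0 : ℝ) 1, HasDerivAt u
      (fun i => ∑ a, v a * ∑ j, c a i j (γ t) * s j (γ t)) t := by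
    intro t ht
    refine hasDerivAt_pi.2 fun i => ?_
    have h1 := ((hs i).differentiableAt (hγO t ht)).hasFDerivAt.comp_hasDerivAt t (hγd t)
    refine h1.congr_deriv ?_
    have h2 : v = ∑ a, v a • stdBasis a := by
      conv_lhs => rw [← stdBasis.sum_repr v]
      simp [stdBasis]
    conv_lhs => rw [h2]
    rw [map_sum]
    refine Finset.sum_congr rfl fun a _ => ?_
    rw [map_smul, smul_eq_mul, ← hpc a i (γ t) (hγO t ht)]
    rfl
  -- A continuous bound for the coefficient matrix of the linear ODE along the segment; compactness
  -- provides the Grönwall constant `K`.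
  set k : ℝ → ℝ := fun t => ∑ i, ∑ a, |v a| * ∑ j, |c a i j (γ t)| with hk
  have hkc : ContinuousOn k (Set.Icc 0 1) := by
    refine continuousOn_finsetSum _ fun i _ => continuousOn_finsetSum _ fun a _ =>
      continuousOn_const.mul (continuousOn_finsetSum _ fun j _ => ?_)
    intro t ht
    exact ((ContinuousAt.comp (g := c a i j) (hc a i j _ (hγO t ht)).continuousAt
      (hγd t).continuousAt).abs).continuousWithinAt
  obtain ⟨K, hK⟩ := (isCompact_Icc.image_of_continuousOn hkc).bddAbove
  have hbound : ∀ t ∈ Set.Ico (0 : ℝ) 1,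
      ‖fun i => ∑ a, v a * ∑ j, c a i j (γ t) * s j (γ t)‖ ≤ K * ‖u t‖ + 0 := by
    intro t ht
    have ht' := Set.Ico_subset_Icc_self ht
    have hkK : k t ≤ K := hK ⟨t, ht', rfl⟩
    rw [add_zero]
    have hterm : ∀ i, 0 ≤ ∑ a, |v a| * ∑ j, |c a i j (γ t)| := fun i => by positivity
    refine (pi_norm_le_iff_of_nonneg (mul_nonneg
      ((Finset.sum_nonneg fun i _ => hterm i).trans hkK) (norm_nonneg _))).2 fun i => ?_
    calc ‖∑ a, v a * ∑ j, c a i j (γ t) * s j (γ t)‖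
        ≤ ∑ a, |v a| * ∑ j, |c a i j (γ t)| * ‖u t‖ := by
          refine (norm_sum_le _ _).trans (Finset.sum_le_sum fun a _ => ?_)
          rw [norm_mul, Real.norm_eq_abs]
          refine mul_le_mul_of_nonneg_left ?_ (abs_nonneg _)
          refine (norm_sum_le _ _).trans (Finset.sum_le_sum fun j _ => ?_)
          rw [norm_mul, Real.norm_eq_abs]
          exact mul_le_mul_of_nonneg_left (norm_le_pi_norm (u t) j) (abs_nonneg _)
      _ = (∑ a, |v a| * ∑ j, |c a i j (γ t)|) * ‖u t‖ := by
          rw [Finset.sum_mul]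
          exact Finset.sum_congr rfl fun a _ => by rw [← Finset.sum_mul, mul_assoc]
      _ ≤ K * ‖u t‖ := by
          refine mul_le_mul_of_nonneg_right (le_trans ?_ hkK) (norm_nonneg _)
          exact Finset.single_le_sum (f := fun i => ∑ a, |v a| * ∑ j, |c a i j (γ t)|)
            (fun i _ => hterm i) (Finset.mem_univ i)
  have hu0 : ‖u 0‖ ≤ 0 := by
    have : u 0 = 0 := by
      ext i
      simp [hu, hγ, hz]
    rw [this, norm_zero]
  have h := norm_le_gronwallBound_of_norm_deriv_right_le
    (fun t ht => (hud t ht).continuousAt.continuousWithinAt)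
    (fun t ht => (hud t (Set.Ico_subset_Icc_self ht)).hasDerivWithinAt) hu0 hbound 1
    (Set.right_mem_Icc.2 zero_le_one)
  rw [gronwallBound_ε0_δ0] at h
  have h2 : u 1 = 0 := norm_le_zero_iff.1 h
  have h3 : u 1 i = 0 := congrFun h2 i
  simpa [hu, hγ, hv] using h3

end

/-! ### Prolongation of the twistor equation -/

theorem pd_neg (f : E4 → ℝ) (a : Fin 4) (y : E4) : pd a (fun y => -f y) y = -pd a f y := by
  simp only [pd]
  rw [fderiv_fun_neg, neg_apply]

/-- The twistor equation in coordinates: `∂_a z_{bc}` is, up to Christoffel terms,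
`g_{ab} τ_c - g_{ac} τ_b + T_{abc}` with `T` totally skew. -/
structure IsTwistorSystem (O : Set E4) (g H : Fin 4 → Fin 4 → E4 → ℝ)
    (Γ : Fin 4 → Fin 4 → Fin 4 → E4 → ℝ) (z : Fin 4 → Fin 4 → E4 → ℝ) (τ : Fin 4 → E4 → ℝ)
    (T : Fin 4 → Fin 4 → Fin 4 → E4 → ℝ) : Prop where
  isOpen : IsOpen O
  smooth_g : ∀ a b, SmoothAt O (g a b)
  smooth_H : ∀ a b, SmoothAt O (H a b)
  smooth_Γ : ∀ a b c, SmoothAt O (Γ a b c)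
  smooth_z : ∀ a b, SmoothAt O (z a b)
  smooth_τ : ∀ a, SmoothAt O (τ a)
  smooth_T : ∀ a b c, SmoothAt O (T a b c)
  g_symm : ∀ a b, ∀ y ∈ O, g a b y = g b a y
  H_symm : ∀ a b, ∀ y ∈ O, H a b y = H b a y
  inv : ∀ b c, ∀ y ∈ O, ∑ a, H a b y * g a c y = if b = c then 1 else 0
  skew₁ : ∀ a b c, ∀ y ∈ O, T a b c y = - T b a c y
  skew₂ : ∀ a b c, ∀ y ∈ O, T a b c y = - T a c b y
  pd_z : ∀ a b c, ∀ y ∈ O, pd a (z b c) y =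
    ∑ k, (Γ a b k y * z k c y + Γ a c k y * z b k y) + g a b y * τ c y - g a c y * τ b y + T a b c y

/-- Contraction of the integrability condition. -/
theorem sum_contract {g H S : Fin 4 → Fin 4 → ℝ} {W : Fin 4 → Fin 4 → Fin 4 → Fin 4 → ℝ}
    (hg : ∀ a b, g a b = g b a) (hH : ∀ a b, H a b = H b a)
    (hi : ∀ b c, ∑ a, H a b * g a c = if b = c then 1 else 0)
    (hW : ∀ d a b c, W d a b c = - W d b a c) (d c : Fin 4) :
    ∑ a, ∑ b, H a b * ((g a b * S d c - g a c * S d b + W d a b c) -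
      (g d b * S a c - g d c * S a b + W a d b c)) =
    2 * S d c + g d c * ∑ a, ∑ b, H a b * S a b - ∑ a, ∑ b, H a b * W a d b c := by
  have e1 : ∑ a, ∑ b, H a b * (g a b * S d c) = 4 * S d c := by
    rw [Finset.sum_comm]
    simp only [← mul_assoc, ← Finset.sum_mul, hi]
    simp
  have e2 : ∑ a, ∑ b, H a b * (g a c * S d b) = S d c := by
    rw [Finset.sum_comm]
    simp only [← mul_assoc, ← Finset.sum_mul, hi]
    simp
  have e3 : ∑ a, ∑ b, H a b * W d a b c = 0 := by
    have : ∑ a, ∑ b, H a b * W d a b c = - ∑ a, ∑ b, H a b * W d a b c := by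
      conv_lhs => rw [Finset.sum_comm]
      rw [← Finset.sum_neg_distrib]
      refine Finset.sum_congr rfl fun a _ => ?_
      rw [← Finset.sum_neg_distrib]
      exact Finset.sum_congr rfl fun b _ => by rw [hH b a, hW d b a]; ring
    linarith
  have e4 : ∑ a, ∑ b, H a b * (g d b * S a c) = S d c := by
    have : ∀ a, ∑ b, H a b * (g d b * S a c) = (if a = d then 1 else 0) * S a c := fun a => by
      rw [← hi a d, Finset.sum_mul]
      exact Finset.sum_congr rfl fun b _ => by rw [hH a b, hg d b]; ring
    simp [this]
  have e5 : ∑ a, ∑ b, H a b * (g d c * S a b) = g d c * ∑ a, ∑ b, H a b * S a b := by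
    simp only [Finset.mul_sum]
    exact Finset.sum_congr rfl fun a _ => Finset.sum_congr rfl fun b _ => by ring
  simp only [mul_sub, mul_add, Finset.sum_sub_distrib, Finset.sum_add_distrib, e1, e2, e3, e4, e5]
  ring

namespace IsTwistorSystem

variable {O : Set E4} {g H : Fin 4 → Fin 4 → E4 → ℝ}
  {Γ : Fin 4 → Fin 4 → Fin 4 → E4 → ℝ} {z : Fin 4 → Fin 4 → E4 → ℝ} {τ : Fin 4 → E4 → ℝ}
  {T : Fin 4 → Fin 4 → Fin 4 → E4 → ℝ}

/-- The components `z`, `τ`, `T`. -/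
def firstJet (z : Fin 4 → Fin 4 → E4 → ℝ) (τ : Fin 4 → E4 → ℝ)
    (T : Fin 4 → Fin 4 → Fin 4 → E4 → ℝ) :
    (Fin 4 × Fin 4) ⊕ Fin 4 ⊕ (Fin 4 × Fin 4 × Fin 4) → E4 → ℝ :=
  Sum.elim (fun i => z i.1 i.2) (Sum.elim τ fun i => T i.1 i.2.1 i.2.2)

/-- The components `z`, `τ`, `T` and the derivatives of `τ`. -/
def secondJet (z : Fin 4 → Fin 4 → E4 → ℝ) (τ : Fin 4 → E4 → ℝ)
    (T : Fin 4 → Fin 4 → Fin 4 → E4 → ℝ) :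
    ((Fin 4 × Fin 4) ⊕ Fin 4 ⊕ (Fin 4 × Fin 4 × Fin 4)) ⊕ (Fin 4 × Fin 4) → E4 → ℝ :=
  Sum.elim (firstJet z τ T) fun i => pd i.1 (τ i.2)

theorem span_z (O : Set E4) (z τ T) (b c : Fin 4) : SmoothSpan O (firstJet z τ T) (z b c) :=
  smoothSpan_self (firstJet z τ T) (Sum.inl (b, c))

theorem span_τ (O : Set E4) (z τ T) (c : Fin 4) : SmoothSpan O (firstJet z τ T) (τ c) :=
  smoothSpan_self (firstJet z τ T) (Sum.inr (Sum.inl c))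

theorem span_T (O : Set E4) (z τ T) (a b c : Fin 4) : SmoothSpan O (firstJet z τ T) (T a b c) :=
  smoothSpan_self (firstJet z τ T) (Sum.inr (Sum.inr (a, b, c)))

theorem span_first (O : Set E4) (z τ T) (i) : SmoothSpan O (secondJet z τ T) (firstJet z τ T i) :=
  smoothSpan_self (secondJet z τ T) (Sum.inl i)

theorem span_S (O : Set E4) (z τ T) (a c : Fin 4) : SmoothSpan O (secondJet z τ T) (pd a (τ c)) :=
  smoothSpan_self (secondJet z τ T) (Sum.inr (a, c))

variable (h : IsTwistorSystem O g H Γ z τ T)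
include h

theorem smooth_first (i) : SmoothAt O (firstJet z τ T i) := by
  rcases i with i | i | i
  · exact h.smooth_z _ _
  · exact h.smooth_τ _
  · exact h.smooth_T _ _ _

theorem smooth_second (i) : SmoothAt O (secondJet z τ T i) := by
  rcases i with i | i
  · exact h.smooth_first i
  · exact (h.smooth_τ _).pd _

theorem smooth_christoffel (a b c : Fin 4) :
    SmoothAt O fun y => ∑ k, (Γ a b k y * z k c y + Γ a c k y * z b k y) :=
  smoothAt_sum fun k => ((h.smooth_Γ a b k).mul (h.smooth_z k c)).add
    ((h.smooth_Γ a c k).mul (h.smooth_z b k))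

theorem span_pd_z (a b c : Fin 4) : SmoothSpan O (firstJet z τ T) (pd a (z b c)) := by
  refine SmoothSpan.congr ?_ (h.pd_z a b c)
  exact (((smoothSpan_sum fun k => ((span_z O z τ T k c).mul (h.smooth_Γ a b k)).add
    ((span_z O z τ T b k).mul (h.smooth_Γ a c k))).add
      ((span_τ O z τ T c).mul (h.smooth_g a b))).sub ((span_τ O z τ T b).mul (h.smooth_g a c))).add
      (span_T O z τ T a b c)

/-- Only `z` occurs here besides known coefficients, and its derivatives are expressed by the system
itself, so no new unknown appears. -/
theorem span_pd_christoffel (d a b c : Fin 4) : SmoothSpan O (firstJet z τ T)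
    (pd d fun y => ∑ k, (Γ a b k y * z k c y + Γ a c k y * z b k y)) := by
  refine SmoothSpan.pd h.isOpen (s := fun i : Fin 4 × Fin 4 => z i.1 i.2) ?_
    (fun i => h.smooth_z _ _) (fun i => span_z O z τ T _ _) d fun i => h.span_pd_z _ _ _
  exact smoothSpan_sum fun k =>
    ((smoothSpan_self (fun i : Fin 4 × Fin 4 => z i.1 i.2) (k, c)).mul (h.smooth_Γ a b k)).add
    ((smoothSpan_self (fun i : Fin 4 × Fin 4 => z i.1 i.2) (b, k)).mul (h.smooth_Γ a c k))

theorem pd_pd_z (d a b c : Fin 4) {y : E4} (hy : y ∈ O) : pd d (pd a (z b c)) y =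
    pd d (fun y => ∑ k, (Γ a b k y * z k c y + Γ a c k y * z b k y)) y
      + (pd d (g a b) y * τ c y + g a b y * pd d (τ c) y)
      - (pd d (g a c) y * τ b y + g a c y * pd d (τ b) y) + pd d (T a b c) y := by
  have h1 := h.smooth_christoffel a b c
  have h2 := (h.smooth_g a b).mul (h.smooth_τ c)
  have h3 := (h.smooth_g a c).mul (h.smooth_τ b)
  rw [pd_congr h.isOpen (h.pd_z a b c) d hy, pd_add ((h1.add h2).sub h3) (h.smooth_T a b c) d hy,
    pd_sub (h1.add h2) h3 d hy, pd_add h1 h2 d hy, pd_mul (h.smooth_g a b) (h.smooth_τ c) d hy,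
    pd_mul (h.smooth_g a c) (h.smooth_τ b) d hy]

/-- Integrability condition: second derivatives of `z` commute, so the terms with derivatives of `τ`
and `T` agree modulo lower order under the exchange of `d` and `a`. -/
theorem span_commutator (d a b c : Fin 4) : SmoothSpan O (firstJet z τ T) fun y =>
    (g a b y * pd d (τ c) y - g a c y * pd d (τ b) y + pd d (T a b c) y) -
      (g d b y * pd a (τ c) y - g d c y * pd a (τ b) y + pd a (T d b c) y) := by
  have key : ∀ d a, SmoothSpan O (firstJet z τ T) fun y =>
      pd d (fun y => ∑ k, (Γ a b k y * z k c y + Γ a c k y * z b k y)) y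
      + pd d (g a b) y * τ c y - pd d (g a c) y * τ b y := fun d a =>
    ((h.span_pd_christoffel d a b c).add ((span_τ O z τ T c).mul ((h.smooth_g a b).pd d))).sub
      ((span_τ O z τ T b).mul ((h.smooth_g a c).pd d))
  refine ((key a d).sub (key d a)).congr fun y hy => ?_
  have e1 := h.pd_pd_z d a b c hy
  have e2 := h.pd_pd_z a d b c hy
  rw [pd_comm (h.smooth_z b c) d a hy] at e1
  linarith

theorem pd_skew₁ (d a b c : Fin 4) {y : E4} (hy : y ∈ O) :
    pd d (T a b c) y = - pd d (T b a c) y := by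
  rw [pd_congr h.isOpen (h.skew₁ a b c) d hy, pd_neg]

theorem pd_skew₂ (d a b c : Fin 4) {y : E4} (hy : y ∈ O) :
    pd d (T a b c) y = - pd d (T a c b) y := by
  rw [pd_congr h.isOpen (h.skew₂ a b c) d hy, pd_neg]

/-- The symmetrized derivative of `τ` is determined by the first jet. -/
theorem span_symm (d c : Fin 4) : SmoothSpan O (firstJet z τ T) fun y =>
    pd d (τ c) y + pd c (τ d) y := by
  -- The commutator is contracted over `a` and `b` with the inverse metric.
  have h1 : ∀ d c, SmoothSpan O (firstJet z τ T) fun y => 2 * pd d (τ c) y +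
      g d c y * ∑ a, ∑ b, H a b y * pd a (τ b) y - ∑ a, ∑ b, H a b y * pd a (T d b c) y := by
    intro d c
    refine SmoothSpan.congr (smoothSpan_sum fun a => smoothSpan_sum fun b =>
      (h.span_commutator d a b c).mul (h.smooth_H a b)) fun y hy => ?_
    exact (sum_contract (g := fun a b => g a b y) (H := fun a b => H a b y)
      (S := fun a b => pd a (τ b) y) (W := fun d a b c => pd d (T a b c) y)
      (fun a b => h.g_symm a b y hy) (fun a b => h.H_symm a b y hy) (fun a b => h.inv a b y hy)
      (fun d a b c => h.pd_skew₁ d a b c hy) d c).symm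
  have h2 : ∀ d c, SmoothSpan O (firstJet z τ T) fun y =>
      (pd d (τ c) y + pd c (τ d) y) + g d c y * ∑ a, ∑ b, H a b y * pd a (τ b) y := by
    intro d c
    refine (((h1 d c).add (h1 c d)).const_mul (1 / 2)).congr fun y hy => ?_
    -- The divergence of `T` is skew in `d, c`, so symmetrization removes it.
    have e1 : ∑ a, ∑ b, H a b y * pd a (T d b c) y = - ∑ a, ∑ b, H a b y * pd a (T c b d) y := by
      rw [← Finset.sum_neg_distrib]
      refine Finset.sum_congr rfl fun a _ => ?_
      rw [← Finset.sum_neg_distrib]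
      refine Finset.sum_congr rfl fun b _ => ?_
      rw [h.pd_skew₁ a d b c hy, h.pd_skew₂ a b d c hy, h.pd_skew₁ a b c d hy]
      ring
    rw [h.g_symm c d y hy, e1]
    ring
  have h3 : SmoothSpan O (firstJet z τ T) fun y => ∑ a, ∑ b, H a b y * pd a (τ b) y := by
    -- One more contraction gives `2 + 4 = 6` times the divergence of `τ`.
    refine ((smoothSpan_sum fun a => smoothSpan_sum fun b =>
      (h2 a b).mul (h.smooth_H a b)).const_mul (1 / 6)).congr fun y hy => ?_
    have e1 : ∑ a, ∑ b, H a b y * pd b (τ a) y = ∑ a, ∑ b, H a b y * pd a (τ b) y := by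
      rw [Finset.sum_comm]
      exact Finset.sum_congr rfl fun a _ => Finset.sum_congr rfl fun b _ => by
        rw [h.H_symm b a y hy]
    have e2 : ∀ r : ℝ, ∑ a, ∑ b, H a b y * (g a b y * r) = 4 * r := fun r => by
      rw [Finset.sum_comm]
      simp only [← mul_assoc, ← Finset.sum_mul, h.inv _ _ y hy]
      simp
    simp only [mul_add, Finset.sum_add_distrib, e1, e2]
    ring
  exact ((h2 d c).sub (h3.mul (h.smooth_g d c))).congr fun y _ => by ring

/-- Modulo the second jet, `∂_d T_abc` is symmetric in `d, a` and skew in `a, b, c`. These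
symmetries are incompatible, and a combination of three exchanges isolates the component. -/
theorem span_pd_T (d a b c : Fin 4) : SmoothSpan O (secondJet z τ T) (pd d (T a b c)) := by
  have key : ∀ d a b c, SmoothSpan O (secondJet z τ T) fun y =>
      pd d (T a b c) y - pd a (T d b c) y := fun d a b c =>
    (((h.span_commutator d a b c).trans (span_first O z τ T)).add
      ((((span_S O z τ T a c).mul (h.smooth_g d b)).sub ((span_S O z τ T a b).mul
        (h.smooth_g d c))).sub (((span_S O z τ T d c).mul (h.smooth_g a b)).sub
        ((span_S O z τ T d b).mul (h.smooth_g a c))))).congr fun y _ => by ring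
  refine ((((key d a b c).add (key d b c a)).sub (key a b d c)).const_mul (1 / 2)).congr
    fun y hy => ?_
  have e1 : pd d (T b c a) y = pd d (T a b c) y := by
    rw [h.pd_skew₂ d b c a hy, h.pd_skew₁ d b a c hy, neg_neg]
  have e2 : pd a (T b d c) y = - pd a (T d b c) y := h.pd_skew₁ a b d c hy
  have e3 : pd b (T d c a) y = pd b (T a d c) y := by
    rw [h.pd_skew₂ b d c a hy, h.pd_skew₁ b d a c hy, neg_neg]
  rw [e1, e2, e3]
  ring

theorem span_pd_first (d : Fin 4) (i) : SmoothSpan O (secondJet z τ T) (pd d (firstJet z τ T i)) := by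
  rcases i with i | i | i
  · exact (h.span_pd_z d _ _).trans (span_first O z τ T)
  · exact span_S O z τ T d i
  · exact h.span_pd_T d _ _ _

/-- As for Killing fields, the symmetrized derivative of `τ` is of lower order. A Koszul-type
combination of its derivatives recovers every `∂∂τ`, and this closes the system. -/
theorem span_pd_second (d : Fin 4) (i) :
    SmoothSpan O (secondJet z τ T) (pd d (secondJet z τ T i)) := by
  rcases i with i | ⟨b, c⟩
  · exact h.span_pd_first d i
  · have key : ∀ a b c, SmoothSpan O (secondJet z τ T) (pd a fun y =>
        pd b (τ c) y + pd c (τ b) y) := fun a b c =>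
      (h.span_symm b c).pd h.isOpen h.smooth_first (span_first O z τ T) a (h.span_pd_first a)
    refine ((((key d b c).add (key b d c)).sub (key c d b)).const_mul (1 / 2)).congr
      fun y hy => ?_
    have hS : ∀ b c, SmoothAt O (pd b (τ c)) := fun b c => (h.smooth_τ c).pd b
    rw [pd_add (hS b c) (hS c b) d hy, pd_add (hS d c) (hS c d) b hy, pd_add (hS d b) (hS b d) c hy,
      pd_comm (h.smooth_τ c) b d hy, pd_comm (h.smooth_τ d) b c hy, pd_comm (h.smooth_τ b) c d hy]
    simp only [secondJet, Sum.elim_inr]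
    ring

/-- Unique continuation on convex sets. -/
theorem eq_zero (hO : Convex ℝ O) {y₀ : E4} (h₀ : y₀ ∈ O) (hz : ∀ᶠ y in 𝓝 y₀, ∀ b c, z b c y = 0)
    (hτ : ∀ᶠ y in 𝓝 y₀, ∀ c, τ c y = 0) (hT : ∀ᶠ y in 𝓝 y₀, ∀ a b c, T a b c y = 0) {y : E4}
    (hy : y ∈ O) (b c : Fin 4) : z b c y = 0 := by
  refine eq_zero_of_smoothSpan hO h.smooth_second h.span_pd_second h₀ hy (fun i => ?_)
    (Sum.inl (Sum.inl (b, c)))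
  rcases i with (i | i | i) | i
  · exact hz.self_of_nhds _ _
  · exact hτ.self_of_nhds _
  · exact hT.self_of_nhds _ _ _
  · have h1 : τ i.2 =ᶠ[𝓝 y₀] fun _ => 0 := hτ.mono fun y hy => hy i.2
    show pd i.1 (τ i.2) y₀ = 0
    rw [pd, h1.fderiv_eq, (hasFDerivAt_const (𝕜 := ℝ) (0 : ℝ) y₀).fderiv, zero_apply]

end IsTwistorSystem

/-! ### Unique continuation for twistor forms -/

/-- The coordinates on `ℝ⁴`. -/
def coordL (i : Fin 4) : E4 →L[ℝ] ℝ := LinearMap.toContinuousLinearMap (stdBasis.coord i)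

theorem coordL_stdBasis (i j : Fin 4) : coordL i (stdBasis j) = if i = j then 1 else 0 := by
  simp [coordL, Finsupp.single_apply, eq_comm]

theorem sum_coordL (v : E4) : ∑ i, coordL i v • stdBasis i = v := stdBasis.sum_repr v

/-- The components of the inverse of a bilinear form. -/
def inverseComp (B : Bil) (a b : Fin 4) : ℝ := coordL a (B.inverse (coordL b))

theorem IsInner.inverseComp_symm {B : Bil} (hB : IsInner B) (a b : Fin 4) :
    inverseComp B a b = inverseComp B b a := by
  have h : ∀ a b, inverseComp B a b = B (B.inverse (coordL a)) (B.inverse (coordL b)) := fun a b => by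
    rw [hB.apply_inverse]
    rfl
  rw [h, h, hB.symm]

theorem IsInner.inverseComp_mul {B : Bil} (hB : IsInner B) (b c : Fin 4) :
    ∑ a, inverseComp B a b * B (stdBasis a) (stdBasis c) = if b = c then 1 else 0 := by
  have h : B (∑ a, inverseComp B a b • stdBasis a) (stdBasis c) = coordL b (stdBasis c) := by
    rw [← hB.apply_inverse (coordL b)]
    exact congrArg (fun v => B v (stdBasis c)) (sum_coordL (B.inverse (coordL b)))
  rw [← coordL_stdBasis, ← h]
  simp only [map_sum, map_smul, sum_apply, smul_apply, smul_eq_mul]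

/-- The divergence determines the twistor covector. -/
theorem IsInner.sum_twistor {B : Bil} (hB : IsInner B) {D : Fin 4 → Fin 4 → Fin 4 → ℝ}
    {t : Fin 4 → ℝ} (h : ∀ a b c, D a b c + D b a c = 2 * B (stdBasis a) (stdBasis b) * t c -
      B (stdBasis a) (stdBasis c) * t b - B (stdBasis b) (stdBasis c) * t a) (c : Fin 4) :
    1 / 3 * ∑ a, ∑ b, inverseComp B a b * D a b c = t c := by
  have e1 : ∑ a, ∑ b, inverseComp B a b * D b a c = ∑ a, ∑ b, inverseComp B a b * D a b c := by
    rw [Finset.sum_comm]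
    exact Finset.sum_congr rfl fun a _ => Finset.sum_congr rfl fun b _ => by
      rw [hB.inverseComp_symm b a]
  have e2 : ∑ a, ∑ b, inverseComp B a b * (B (stdBasis a) (stdBasis b) * t c) = 4 * t c := by
    rw [Finset.sum_comm]
    simp only [← mul_assoc, ← Finset.sum_mul, hB.inverseComp_mul]
    simp
  have e3 : ∑ a, ∑ b, inverseComp B a b * (B (stdBasis a) (stdBasis c) * t b) = t c := by
    rw [Finset.sum_comm]
    simp only [← mul_assoc, ← Finset.sum_mul, hB.inverseComp_mul]
    simp
  have e4 : ∑ a, ∑ b, inverseComp B a b * (B (stdBasis b) (stdBasis c) * t a) = t c := by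
    have : ∀ a, ∑ b, inverseComp B a b * (B (stdBasis b) (stdBasis c) * t a) =
        (if a = c then 1 else 0) * t a := fun a => by
      rw [← hB.inverseComp_mul a c, Finset.sum_mul]
      exact Finset.sum_congr rfl fun b _ => by rw [hB.inverseComp_symm a b]; ring
    simp [this]
  have e5 : ∑ a, ∑ b, inverseComp B a b * (D a b c + D b a c) = 6 * t c := by
    simp only [h, mul_sub, Finset.sum_sub_distrib, e3, e4, mul_assoc, mul_left_comm _ (2 : ℝ),
      ← Finset.mul_sum, e2]
    ring
  simp only [mul_add, Finset.sum_add_distrib, e1] at e5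
  linarith

theorem contDiffAt_inverseComp {G : E4 → Bil} {y : E4} (hG : ContDiffAt ℝ ∞ G y)
    (hi : IsInner (G y)) (a b : Fin 4) : ContDiffAt ℝ ∞ (fun z => inverseComp (G z) a b) y :=
  (coordL a).contDiff.contDiffAt.comp y ((contDiffAt_inverse hG hi).clm_apply contDiffAt_const)

theorem chcov_eq_zero {G T : E4 → Bil} {y : E4} (h : ∀ᶠ z in 𝓝 y, T z = 0) (a b c : E4) :
    chcov G T y a b c = 0 := by
  have h1 : T =ᶠ[𝓝 y] fun _ => 0 := h
  rw [chcov, h1.fderiv_eq, (hasFDerivAt_const (𝕜 := ℝ) (0 : Bil) y).fderiv, h.self_of_nhds]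
  simp only [zero_apply, sub_zero]

/-- Unique continuation in coordinates. -/
theorem eq_zero_of_twistor {O : Set E4} (hO : IsOpen O) (hOc : Convex ℝ O) {G F : E4 → Bil}
    (hG : ∀ y ∈ O, ContDiffAt ℝ ∞ G y) (hi : ∀ y ∈ O, IsInner (G y))
    (hF : ∀ y ∈ O, ContDiffAt ℝ ∞ F y) (hFa : ∀ y ∈ O, ∀ a v, chcov G F y a v v = 0)
    (ht : ∀ y ∈ O, IsTwistor (G y) (chcov G F y)) {y₀ : E4} (h₀ : y₀ ∈ O)
    (hz : ∀ᶠ y in 𝓝 y₀, F y = 0) {y : E4} (hy : y ∈ O) : F y = 0 := by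
  -- `IsTwistor` provides a covector only point by point; the divergence formula shows that it is
  -- smooth.
  set τ : Fin 4 → E4 → ℝ := fun c y => 1 / 3 * ∑ a, ∑ b, inverseComp (G y) a b *
    chcov G F y (stdBasis a) (stdBasis b) (stdBasis c) with hτ
  set g : Fin 4 → Fin 4 → E4 → ℝ := fun a b y => G y (stdBasis a) (stdBasis b) with hg
  -- `T` is the remainder of `∇F` after its trace part. The twistor equation makes it skew in `a,
  -- b`, and `F` being alternating makes it skew in `b, c`.
  set T : Fin 4 → Fin 4 → Fin 4 → E4 → ℝ := fun a b c y =>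
    chcov G F y (stdBasis a) (stdBasis b) (stdBasis c) - g a b y * τ c y + g a c y * τ b y with hT
  have sg : ∀ a b, SmoothAt O (g a b) := fun a b y hy =>
    ((hG y hy).clm_apply contDiffAt_const).clm_apply contDiffAt_const
  have sD : ∀ a b c : Fin 4, SmoothAt O fun y =>
      chcov G F y (stdBasis a) (stdBasis b) (stdBasis c) := fun a b c y hy =>
    contDiffAt_chcov (hG y hy) (hi y hy) (hF y hy) _ _ _
  have sH : ∀ a b, SmoothAt O fun y => inverseComp (G y) a b := fun a b y hy =>
    contDiffAt_inverseComp (hG y hy) (hi y hy) a b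
  have sτ : ∀ c, SmoothAt O (τ c) := fun c =>
    (smoothAt_const (1 / 3)).mul (smoothAt_sum fun a => smoothAt_sum fun b => (sH a b).mul (sD a b c))
  have hsk : ∀ y ∈ O, ∀ a b c, chcov G F y a b c = - chcov G F y a c b := fun y hy a b c => by
    have h1 := hFa y hy a (b + c)
    rw [((isTrilin_chcov _ _ _).snd _ _).map_add, ((isTrilin_chcov _ _ _).trd _ _).map_add,
      ((isTrilin_chcov _ _ _).trd _ _).map_add, hFa y hy, hFa y hy] at h1
    linarith
  have hsym : ∀ y ∈ O, ∀ a b c : Fin 4, chcov G F y (stdBasis a) (stdBasis b) (stdBasis c) +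
      chcov G F y (stdBasis b) (stdBasis a) (stdBasis c) =
      2 * g a b y * τ c y - g a c y * τ b y - g b c y * τ a y := by
    intro y hy a b c
    obtain ⟨t, -, h⟩ := ht y hy
    have h1 := (hi y hy).sum_twistor (t := fun c => t (stdBasis c))
      (D := fun a b c => chcov G F y (stdBasis a) (stdBasis b) (stdBasis c))
      fun a b c => h _ _ _
    have h2 : ∀ c, τ c y = t (stdBasis c) := h1
    rw [h2, h2, h2]
    exact h _ _ _
  have sys : IsTwistorSystem O g (fun a b y => inverseComp (G y) a b)
      (fun a b k y => coordL k (chr G y (stdBasis a) (stdBasis b)))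
      (fun b c y => F y (stdBasis b) (stdBasis c)) τ T := by
    refine ⟨hO, sg, sH, fun a b k y hy => ?_, fun b c y hy => ?_, sτ, fun a b c => ?_,
      fun a b y hy => (hi y hy).symm _ _, fun a b y hy => (hi y hy).inverseComp_symm a b,
      fun b c y hy => (hi y hy).inverseComp_mul b c, fun a b c y hy => ?_, fun a b c y hy => ?_,
      fun a b c y hy => ?_⟩
    · exact (coordL k).contDiff.contDiffAt.comp y (contDiffAt_chr (hG y hy) (hi y hy) _ _)
    · exact ((hF y hy).clm_apply contDiffAt_const).clm_apply contDiffAt_const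
    · exact ((sD a b c).sub ((sg a b).mul (sτ c))).add ((sg a c).mul (sτ b))
    · have h1 := hsym y hy a b c
      have h2 : g a b y = g b a y := (hi y hy).symm _ _
      simp only [hT]
      rw [h2] at h1 ⊢
      linarith
    · have h1 := hsk y hy (stdBasis a) (stdBasis b) (stdBasis c)
      simp only [hT]
      linarith
    · have h1 : HasFDerivAt (fun y => F y (stdBasis b) (stdBasis c)) _ y :=
        ((smooth_differentiableAt (hF y hy)).hasFDerivAt.clm_apply
          (hasFDerivAt_const (𝕜 := ℝ) (stdBasis b) y)).clm_apply
          (hasFDerivAt_const (𝕜 := ℝ) (stdBasis c) y)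
      have h2 : pd a (fun y => F y (stdBasis b) (stdBasis c)) y =
          fderiv ℝ F y (stdBasis a) (stdBasis b) (stdBasis c) := by
        rw [pd, h1.fderiv]
        simp
      have h3 : ∀ v w, F y v w = ∑ k, coordL k v * F y (stdBasis k) w := fun v w => by
        conv_lhs => rw [← sum_coordL v]
        simp only [map_sum, map_smul, sum_apply, smul_apply, smul_eq_mul]
      have h4 : ∀ v w, F y v w = ∑ k, coordL k w * F y v (stdBasis k) := fun v w => by
        conv_lhs => rw [← sum_coordL w]
        simp only [map_sum, map_smul, smul_eq_mul]
      rw [h2, Finset.sum_add_distrib, ← h3, ← h4]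
      simp only [hT, chcov]
      ring
  have hz2 := eventually_eventually_nhds.2 hz
  have hτ0 : ∀ᶠ y in 𝓝 y₀, ∀ c, τ c y = 0 := by
    filter_upwards [hz2] with y hy c
    simp only [hτ, chcov_eq_zero hy]
    simp
  refine bil_ext stdBasis fun b c => ?_
  refine (sys.eq_zero hOc h₀ (hz.mono fun y hy b c => by rw [hy]; rfl) hτ0 ?_ hy b c)
  filter_upwards [hz2, hτ0] with y hy h0 a b c
  simp only [hT, h0, chcov_eq_zero hy]
  simp

theorem isTwistor_local {g : Metric M} {Z : BilinField M} (hZ : SmoothBilin Z) {p : M} {y : E4}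
    (hy : y ∈ (extChartAt (𝓡 4) p).target)
    (h : IsTwistor (bilinAt g.inner ((extChartAt (𝓡 4) p).symm y)) fun a b c =>
      covBil g Z ((extChartAt (𝓡 4) p).symm y) a b c) :
    IsTwistor (localBilin g.inner p y) (chcov (localBilin g.inner p) (localBilin Z p) y) := by
  have hs := extChartAt_symm_mem hy
  obtain ⟨t, hl, h⟩ := h
  set q := (extChartAt (𝓡 4) p).symm y with hq
  refine ⟨fun v => t (coordMap p q v), ⟨fun u v => by rw [map_add, hl.map_add],
    fun r v => by rw [map_smul, hl.map_smul]⟩, fun a b c => ?_⟩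
  have h1 := h (coordMap p q a) (coordMap p q b) (coordMap p q c)
  simp only [covBil_apply] at h1
  rw [covDeriv_coordMap g hZ hs, covDeriv_coordMap g hZ hs, hq,
    (extChartAt (𝓡 4) p).right_inv hy] at h1
  exact h1

/-- A ball in the chart at `p` is convex and contains a point near which `Z` vanishes, so unique
continuation kills `Z` on the whole ball. Consequently the interior of the zero set is closed. -/
theorem IsTwistorForm.eventually_eq_zero {g : Metric M} {o : ManifoldOrientation M} {s : ℝ}
    {Z : BilinField M} (h : IsTwistorForm g o s Z) {p : M}
    (hp : p ∈ closure (interior {q | bilinAt Z q = 0})) : ∀ᶠ q in 𝓝 p, bilinAt Z q = 0 := by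
  obtain ⟨r, hr, hrO⟩ := Metric.isOpen_iff.1 (isOpen_extChartAt_target (I := 𝓡 4) p) _
    (mem_extChartAt_target p)
  set O := Metric.ball (extChartAt (𝓡 4) p p) r with hO
  have hsm : ∀ {T : BilinField M}, SmoothBilin T → ∀ y ∈ O, ContDiffAt ℝ ∞ (localBilin T p) y := by
    intro T hT y hy
    have h1 := hT.contDiffAt (extChartAt_symm_mem (hrO hy))
    rwa [(extChartAt (𝓡 4) p).right_inv (hrO hy)] at h1
  have hnhds : ∀ᶠ q in 𝓝 p, q ∈ (extChartAt (𝓡 4) p).source ∧ extChartAt (𝓡 4) p q ∈ O := by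
    filter_upwards [extChartAt_source_mem_nhds (I := 𝓡 4) p,
      (continuousAt_extChartAt (I := 𝓡 4) p).eventually (Metric.ball_mem_nhds _ hr)] with q h1 h2
      using ⟨h1, h2⟩
  obtain ⟨q, ⟨hqs, hqO⟩, hqV⟩ := mem_closure_iff_nhds.1 hp _ hnhds
  have hz : ∀ᶠ y in 𝓝 (extChartAt (𝓡 4) p q), localBilin Z p y = 0 := by
    have h1 := continuousAt_extChartAt_symm' (I := 𝓡 4) hqs
    unfold ContinuousAt at h1
    rw [(extChartAt (𝓡 4) p).left_inv hqs] at h1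
    filter_upwards [h1.eventually (mem_interior_iff_mem_nhds.1 hqV)] with y hy
    ext a b
    rw [localBilin_apply, show bilinAt Z ((extChartAt (𝓡 4) p).symm y) = 0 from hy]
    rfl
  filter_upwards [hnhds] with x hx
  have hx' : x ∈ (chartAt E4 p).source := by simpa using hx.1
  have h0 : localBilin Z p (extChartAt (𝓡 4) p x) = 0 := by
    refine eq_zero_of_twistor Metric.isOpen_ball (convex_ball _ r) (hsm g.contMDiff)
      (fun y hy => localMetric_isInner g (hrO hy)) (hsm h.isTwoForm.smooth) (fun y hy a v => ?_)
      (fun y hy => isTwistor_local h.isTwoForm.smooth (hrO hy) (h.twistor _)) hqO hz hx.2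
    have h2 := covDeriv_coordMap g h.isTwoForm.smooth (extChartAt_symm_mem (hrO hy)) a v v
    rw [(extChartAt (𝓡 4) p).right_inv (hrO hy), ← covBil_apply,
      covBil_alternating g h.isTwoForm] at h2
    exact h2.symm
  ext a b
  obtain ⟨a, rfl⟩ := coordMap_surjective hx' a
  obtain ⟨b, rfl⟩ := coordMap_surjective hx' b
  rw [← localBilin_apply' Z hx', h0]
  rfl

/-- On a connected manifold, a twistor form with nonzero divergence vanishes on a set with empty
interior. -/
theorem IsTwistorForm.dense [ConnectedSpace M] {g : Metric M} {o : ManifoldOrientation M} {s : ℝ}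
    {Z : BilinField M} (h : IsTwistorForm g o s Z) (h0 : ∃ p, ∃ c : E4, hamiltonian g Z p c ≠ 0) :
    Dense {p | bilinAt Z p ≠ 0} := by
  set V := interior {p | bilinAt Z p = 0} with hV
  have hcl : IsClopen V := by
    refine ⟨isClosed_of_closure_subset fun p hp => ?_, isOpen_interior⟩
    exact mem_interior_iff_mem_nhds.2 (h.eventually_eq_zero hp)
  -- By connectedness the zero set either has empty interior, which is density of the complement, or
  -- is everything, which would make the divergence vanish.
  rcases isClopen_iff.1 hcl with h1 | h1
  · have := interior_eq_empty_iff_dense_compl.1 h1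
    exact this
  · exfalso
    obtain ⟨p, c, hpc⟩ := h0
    refine hpc ?_
    obtain ⟨e, he, -⟩ := exists_frame g o p
    rw [hamiltonian_frame g Z p he]
    have hz : ∀ y, localBilin Z p y = 0 := fun y => by
      have h2 : (extChartAt (𝓡 4) p).symm y ∈ V := h1 ▸ Set.mem_univ _
      have h3 : bilinAt Z ((extChartAt (𝓡 4) p).symm y) = 0 :=
        interior_subset (s := {q | bilinAt Z q = 0}) h2
      ext a b
      rw [localBilin_apply, h3]
      rfl
    simp only [covBil_apply, covDeriv_eq_chcov, chcov_eq_zero (Filter.Eventually.of_forall hz)]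
    simp

/-! ### The correspondence -/

theorem IsTwistorForm.isConformallyKahlerWithPoles [ConnectedSpace M] {g : Metric M}
    {o : ManifoldOrientation M} {s : ℝ} (hs : s = 1 ∨ s = -1) {Z : BilinField M}
    (h : IsTwistorForm g o s Z) (h0 : ∃ p, ∃ c : E4, hamiltonian g Z p c ≠ 0) :
    IsConformallyKahlerWithPoles g o s {p | bilinAt Z p ≠ 0} (formFactor g Z) (formComplex g Z)
      Z :=
  ⟨isOpen_ne_zero h.isTwoForm.smooth, h.dense h0, h.isConformallyKahlerOn hs, h.isTwoForm,
    fun _ hp => killingForm_form hs h.isTwoForm h.hodgeDual hp, fun _ hp => not_not.1 hp⟩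

/-- A twistor form without zeros is the Killing form of a conformal Kähler structure without
poles. -/
theorem IsTwistorForm.exists_conformallyKahler {g : Metric M}
    {o : ManifoldOrientation M} {s : ℝ} (hs : s = 1 ∨ s = -1) {Z : BilinField M}
    (h : IsTwistorForm g o s Z) (h0 : ∀ p, bilinAt Z p ≠ 0) :
    ∃ (Ω : M → ℝ) (J : EndField M), IsConformallyKahlerOn g o s Set.univ Ω J ∧
      killingForm g Ω J = Z := by
  refine ⟨formFactor g Z, formComplex g Z, ?_, funext fun p =>
    (killingForm_form hs h.isTwoForm h.hodgeDual (h0 p)).symm⟩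
  have hU : {p | bilinAt Z p ≠ 0} = Set.univ := Set.eq_univ_of_forall h0
  exact hU ▸ h.isConformallyKahlerOn hs

theorem hodgeDual_of_eq {g : Metric M} {o : ManifoldOrientation M} {s : ℝ} {p : M} {F F' : Bil}
    (h : HodgeDual g o s p F) (he : F' = F) : HodgeDual g o s p F' := he ▸ h

end KillingYano

end

open KillingYano in
theorem proposition1 {M : Type*} [TopologicalSpace M] [T2Space M] [SecondCountableTopology M]
    [ConnectedSpace M] [ChartedSpace E4 M] [IsManifold (𝓡 4) ∞ M]
    (g : KillingYano.Metric M) (o : ManifoldOrientation M) :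
    ((∃ Y : BilinField M, IsKillingYano g Y ∧ ¬ IsParallel g Y) ↔
      ∃ (U₁ U₂ : Set M) (Ω₁ Ω₂ : M → ℝ) (J₁ J₂ : EndField M) (Z₁ Z₂ : BilinField M),
        IsConformallyKahlerWithPoles g o 1 U₁ Ω₁ J₁ Z₁ ∧
        IsConformallyKahlerWithPoles g o (-1) U₂ Ω₂ J₂ Z₂ ∧
        (∀ p c, hamiltonian g Z₁ p c = hamiltonian g Z₂ p c) ∧
        ∃ p c, hamiltonian g Z₁ p c ≠ 0) ∧
    ((∃ Y : BilinField M, IsKillingYano g Y ∧ ¬ IsParallel g Y ∧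
        ∀ p, ¬ HodgeDual g o 1 p (Y p) ∧ ¬ HodgeDual g o (-1) p (Y p)) ↔
      ∃ (Ω₁ Ω₂ : M → ℝ) (J₁ J₂ : EndField M),
        IsConformallyKahlerOn g o 1 Set.univ Ω₁ J₁ ∧
        IsConformallyKahlerOn g o (-1) Set.univ Ω₂ J₂ ∧
        (∀ p c, hamiltonian g (killingForm g Ω₁ J₁) p c =
          hamiltonian g (killingForm g Ω₂ J₂) p c) ∧
        ∃ p c, hamiltonian g (killingForm g Ω₁ J₁) p c ≠ 0) := by
  refine ⟨⟨?_, ?_⟩, ⟨?_, ?_⟩⟩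
  · rintro ⟨Y, hY, hne⟩
    obtain ⟨Z₁, Z₂, h₁, h₂, -, ht, p, c, hpc⟩ := hY.exists_twistorForms o hne
    exact ⟨_, _, _, _, _, _, Z₁, Z₂,
      h₁.isConformallyKahlerWithPoles (Or.inl rfl) ⟨p, c, hpc⟩,
      h₂.isConformallyKahlerWithPoles (Or.inr rfl) ⟨p, c, (ht p c) ▸ hpc⟩, ht, p, c, hpc⟩
  · rintro ⟨U₁, U₂, Ω₁, Ω₂, J₁, J₂, Z₁, Z₂, h₁, h₂, ht, h0⟩
    exact ⟨_, exists_killingYano_of_conformallyKahler h₁ h₂ ht h0⟩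
  · rintro ⟨Y, hY, hne, hd⟩
    obtain ⟨Z₁, Z₂, h₁, h₂, hYZ, ht, h0⟩ := hY.exists_twistorForms o hne
    -- At a zero of `Z₁` the form `Y = -Z₂` would be anti-self-dual, which is excluded.
    obtain ⟨Ω₁, J₁, hk₁, rfl⟩ := h₁.exists_conformallyKahler (Or.inl rfl) fun p hp => by
      refine (hd p).2 (hodgeDual_iff.2 fun e he ho => ?_)
      have h3 : DualIn (-1) (bilinAt Z₂ p) e := hodgeDual_iff.1 (h₂.hodgeDual p) e he ho
      have h4 : bilinAt Y p = (-1 : ℝ) • bilinAt Z₂ p := by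
        rw [hYZ, hp, zero_sub, neg_one_smul]
      have h5 : DualIn (-1) (bilinAt Y p) e := h4 ▸ h3.smul (-1)
      exact h5
    -- At a zero of `Z₂` the form `Y = Z₁` would be self-dual.
    obtain ⟨Ω₂, J₂, hk₂, rfl⟩ := h₂.exists_conformallyKahler (Or.inr rfl) fun p hp => by
      refine (hd p).1 (hodgeDual_of_eq (h₁.hodgeDual p) ((hYZ p).trans ?_))
      rw [hp, sub_zero]
      rfl
    exact ⟨Ω₁, Ω₂, J₁, J₂, hk₁, hk₂, ht, h0⟩
  · rintro ⟨Ω₁, Ω₂, J₁, J₂, h₁, h₂, ht, h0⟩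
    obtain ⟨hY, hne⟩ := exists_killingYano_of_conformallyKahler h₁.withPoles h₂.withPoles ht h0
    have hc₁ := h₁.isConformalHermitianOn isOpen_univ
    have hc₂ := h₂.isConformalHermitianOn isOpen_univ
    exact ⟨_, hY, hne, fun p => not_hodgeDual_sub (hc₁.isTwoForm_killingForm.alternating p)
      (hc₂.isTwoForm_killingForm.alternating p) (hc₁.hodgeDual_killingForm trivial)
      (hc₂.hodgeDual_killingForm trivial) (hc₁.killingForm_ne_zero trivial)
      (hc₂.killingForm_ne_zero trivial)⟩
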